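/- All graphs are finite and simple. For an integer $k\ge 3$, a $C_k$-coloring of a graph $G$ is a graph homomorphism from $G$ to the cycle $C_k$ of length $k$. For an integer $k\ge 3$ let $f(k)$ be the least nonnegative integer $m$ such that every planar graph of girth (exactly) $k$ that has no cycle whose length lies in $\{k+1,\dots,m\}$ is $C_k$-colorable, and put $f(k)=\infty$ if there is no such $m$. Then the following hold. (1) For every integer $k\ge 3$, $f(k)$ is finite if and only if $k$ is an odd prime. (2) For every prime $p\ge 5$, $$p^2-\frac{5p-3}{2}\;\le\; f(p)\;\le\; 2p^2+2p-5 .$$ (3) The following stronger form of the upper bound holds. Let $p\ge 5$ be a prime and let $G$ be a planar graph of girth $p$ with no cycle whose length lies in $\{p+1,\dots,2(p-1)(p+2)-1\}$. Let $C$ be a cycle of length $p$ in $G$. Then every $C_p$-coloring of the subgraph of $G$ induced by $V(C)$ extends to a $C_p$-coloring of $G$. -/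

import Mathlib

/-- A rotation system (combinatorial embedding) of a graph: a permutation `next` of the darts
(oriented edges) whose cycles are exactly the sets of darts leaving a common vertex.  It records
the cyclic (say, counterclockwise) order of the edges around each vertex of a drawing on
an oriented surface. -/
structure RotationSystem {V : Type*} (G : SimpleGraph V) where
  next : Equiv.Perm G.Dart
  next_fst : ∀ d, (next d).fst = d.fst
  sameCycle_of_fst_eq : ∀ d e, d.fst = e.fst → next.SameCycle d e

namespace RotationSystem

variable {V : Type*} {G : SimpleGraph V}

/-- The face-tracing permutation: run along the dart `d`, then turn to the dart which follows the
reversal of `d` in the rotation at the end of `d`.  Its cycles are the facial walks. -/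
def face (R : RotationSystem G) : Equiv.Perm G.Dart :=
  (Function.Involutive.toPerm SimpleGraph.Dart.symm SimpleGraph.Dart.symm_involutive).trans R.next

/-- The number of faces, each connected component being drawn on a surface of its own:
the facial walks, and one further face for every isolated vertex (which carries no dart). -/
noncomputable def numFaces (R : RotationSystem G) : ℕ :=
  Nat.card (Quotient (Equiv.Perm.SameCycle.setoid R.face)) +
    Nat.card {v : V // ∀ w, ¬ G.Adj v w}

/-- The rotation system has genus `0`: `|V| - |E| + |F| = 2 c`, where `c` is the number of connected
components.  Each component contributes `2 - 2 g` with `g ≥ 0` the genus of its surface, so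
equality holds iff every component is embedded in the sphere. -/
def IsPlanar (R : RotationSystem G) : Prop :=
  Nat.card V + R.numFaces = Nat.card G.edgeSet + 2 * Nat.card G.ConnectedComponent

end RotationSystem

/-- A finite graph is planar if it has a combinatorial embedding in the sphere. -/
def SimpleGraph.IsPlanar {V : Type*} (G : SimpleGraph V) : Prop :=
  ∃ R : RotationSystem G, R.IsPlanar

/-- `G` has no cycle whose length lies in the interval `[a, b]`. -/
def SimpleGraph.NoCycleLengthIn {V : Type*} (G : SimpleGraph V) (a b : ℕ) : Prop :=
  ∀ (v : V) (c : G.Walk v v), c.IsCycle → ¬ (a ≤ c.length ∧ c.length ≤ b)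

/-- `G` is `C_k`-colorable: it admits a homomorphism to the cycle `C_k`. -/
def SimpleGraph.CycleColorable {V : Type*} (G : SimpleGraph V) (k : ℕ) : Prop :=
  Nonempty (G →g SimpleGraph.cycleGraph k)

/-- Every finite planar graph of girth `k` without cycles of length from `k + 1` to `m`
is `C_k`-colorable. -/
def SteinbergProperty (k m : ℕ) : Prop :=
  ∀ (V : Type) [Finite V] (G : SimpleGraph V), G.IsPlanar → G.egirth = (k : ℕ∞) →
    G.NoCycleLengthIn (k + 1) m → G.CycleColorable k

/-- The least `m` with `SteinbergProperty k m`, and `⊤` (infinity) if there is no such `m`. -/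
noncomputable def steinbergNumber (k : ℕ) : ℕ∞ :=
  ⨅ (m : ℕ) (_ : SteinbergProperty k m), (m : ℕ∞)

/-! Colors are residues modulo `p`, and a coloring changes by `1` or `-1` along every edge. As `p`
is odd, a cycle of length `p` (a ring) must be colored `s + ε i` with a sign `ε`, so it has only `2
p` colorings.

Upper bound. Let every cycle have length `p` or at least `L`, where `L ≥ 2 p ^ 2 - p`; the bound `2
(p - 1) (p + 2)` satisfies this. If some ring bounds no face, the sphere is cut along it: the side
containing the precolored ring is colored by induction, and the coloring that this induces on the
cutting ring is extended to the other side (`SimpleGraph.exists_coloring`). The existence of two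
sides is a mod-two form of the Jordan curve theorem (`Perm.Spherical.exists_cut`).

If every ring bounds a face, each ring is exchanged for a hub placed in its face and joined to its
vertices; the state `(s, ε)` of the hub dictates the colors on the ring
(`exists_coloring_of_facial`). The result is a constraint network in which an ordinary edge has one
degree of freedom (two admissible color differences) and a spoke has none. Walking through a hub is
charged the number of ring steps that it replaces, so closed walks in the network expand to closed
walks of the graph and are long (`IsHubSystem.le_run`).

Such a network can be colored with the state of one node prescribed
(`NetworkData.Valid.exists_colors`). A node whose edges jointly miss fewer than `p` degrees of
freedom can be removed and colored last (`exists_colors_update`). A node of degree two that is not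
of this kind is suppressed (`splice`): the admissible differences along the new edge form a sumset,
and by the Cauchy-Davenport theorem, for which `p` must be prime, the freedoms add up, with one more
if the node is a hub. The invariant kept is that the two lengths of an edge sum to at most `p` times
its freedom. Hence, if no node were reducible, the lengths would be too small for all faces to have
length at least `L`; this is a count with Euler's formula (`exists_reducible`).

Lower bounds. Every edge of a planar graph is replaced by two arcs of lengths `A` and `k - A`. They
form a cycle of length `k`, which for odd `k` forces the colors of its ends to differ by `A` or `-A`
(`color_sub_color`), while any other cycle has length at least the shortest arc length times the
girth (`length_of_isRing`). The planar graphs are subdivided wheels. For even `k`, an odd rim made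
of genuine edges contradicts bipartiteness. For odd `k` with a proper divisor `b > 1`, rim arcs of
length `b` except for one of length `1` give a contradiction modulo `b`. Both work for arbitrarily
large girth, so the threshold is infinite. For a prime `p`, arcs of lengths `(p - 1) / 2` and `(p +
1) / 2` on a wheel with `2 p - 3` spokes of length `p - 2` give the quadratic lower bound
(`not_steinbergProperty_of_odd`).

Embeddings are pairs of permutations of darts (rotation and reversal), vertices, edges and faces
being the cycles of the two and of their product. All surgeries come down to the effect of a
transposition on cycle counts (`Perm.euler_mul_swap`). -/

set_option linter.unusedSectionVars false
set_option linter.unusedVariables false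
open Equiv

/-! ### Counting the classes of an equivalence relation. -/

namespace Setoid

variable {D : Type*}

/-- The equivalence relation generated by `x ~ y`. -/
def pair (x y : D) : Setoid D := Relation.EqvGen.setoid fun a b => a = x ∧ b = y

theorem pair_le_iff {x y : D} {r : Setoid D} : pair x y ≤ r ↔ r x y := by
  constructor
  · intro h
    exact h (Relation.EqvGen.rel _ _ ⟨rfl, rfl⟩)
  · intro h
    apply Setoid.eqvGen_le
    rintro a b ⟨rfl, rfl⟩
    exact h

variable [Finite D]

theorem card_quotient_le {r s : Setoid D} (h : r ≤ s) :
    Nat.card (Quotient s) ≤ Nat.card (Quotient r) := by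
  apply Nat.card_le_card_of_surjective (Setoid.map_of_le h)
  intro q
  induction q using Quotient.inductionOn with
  | h a => exact ⟨⟦a⟧, rfl⟩

theorem card_quotient_lt {r s : Setoid D} (h : r ≤ s) {x y : D} (hs : s x y) (hr : ¬ r x y) :
    Nat.card (Quotient s) < Nat.card (Quotient r) := by
  refine lt_of_le_of_ne (card_quotient_le h) fun he => hr ?_
  have hsurj : Function.Surjective (Setoid.map_of_le h) := by
    intro q
    induction q using Quotient.inductionOn with
    | h a => exact ⟨⟦a⟧, rfl⟩
  have hb := (Nat.bijective_iff_surjective_and_card (Setoid.map_of_le h)).2 ⟨hsurj, he.symm⟩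
  have : (⟦x⟧ : Quotient r) = ⟦y⟧ := hb.1 (Quotient.sound hs)
  exact Quotient.exact this

/-- The relation obtained from `r` by merging the classes of `x` and `y`. -/
theorem sup_pair_apply {r : Setoid D} {x y a b : D} (h : (r ⊔ pair x y) a b) :
    r a b ∨ ((r a x ∨ r a y) ∧ (r b x ∨ r b y)) := by
  let t : Setoid D :=
    { r := fun a b => r a b ∨ ((r a x ∨ r a y) ∧ (r b x ∨ r b y))
      iseqv := by
        refine ⟨fun a => Or.inl (r.refl' a), ?_, ?_⟩
        · rintro a b (h | ⟨h1, h2⟩)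
          · exact Or.inl (r.symm' h)
          · exact Or.inr ⟨h2, h1⟩
        · rintro a b c (h | ⟨h1, h2⟩) (h' | ⟨h1', h2'⟩)
          · exact Or.inl (r.trans' h h')
          · exact Or.inr ⟨h1'.imp (r.trans' h) (r.trans' h), h2'⟩
          · exact Or.inr ⟨h1, h2.imp (r.trans' (r.symm' h')) (r.trans' (r.symm' h'))⟩
          · exact Or.inr ⟨h1, h2'⟩ }
  have hle : r ⊔ pair x y ≤ t := by
    refine sup_le (fun _ _ h => Or.inl h)
      (pair_le_iff.2 (Or.inr ⟨Or.inl (r.refl' x), Or.inr (r.refl' y)⟩))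
  exact hle h

theorem card_quotient_le_sup_pair (r : Setoid D) (x y : D) :
    Nat.card (Quotient r) ≤ Nat.card (Quotient (r ⊔ pair x y)) + 1 := by
  classical
  -- Only the class of `x` is sent to `none`; classes other than it that become equal must both be
  -- the class of `y`.
  let f : Quotient r → Option (Quotient (r ⊔ pair x y)) := fun q =>
    if q = ⟦x⟧ then none else some (Setoid.map_of_le le_sup_left q)
  have hf : Function.Injective f := by
    intro q q' h
    induction q using Quotient.inductionOn with
    | h a =>
    induction q' using Quotient.inductionOn with
    | h b =>
    by_cases ha : (⟦a⟧ : Quotient r) = ⟦x⟧ <;> by_cases hb : (⟦b⟧ : Quotient r) = ⟦x⟧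
    · rw [ha, hb]
    · simp [f, ha, hb] at h
    · simp [f, ha, hb] at h
    · simp only [f, ha, hb, if_false, Option.some.injEq] at h
      have h1 : (r ⊔ pair x y) a b := Quotient.exact h
      rcases sup_pair_apply h1 with h2 | ⟨h2, h3⟩
      · exact Quotient.sound h2
      · have ha' : ¬ r a x := fun h => ha (Quotient.sound h)
        have hb' : ¬ r b x := fun h => hb (Quotient.sound h)
        exact Quotient.sound (r.trans' (h2.resolve_left ha') (r.symm' (h3.resolve_left hb')))
  have := Nat.card_le_card_of_injective f hf
  rwa [Finite.card_option] at this

end Setoid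

/-! ### Cycle counts and genus of a pair of permutations. -/

namespace Equiv.Perm

variable {D : Type*} [Finite D]

theorem setoid_le_iff {f : Perm D} {r : Setoid D} :
    SameCycle.setoid f ≤ r ↔ ∀ a, r a (f a) := by
  constructor
  · intro h a
    exact h (sameCycle_apply_right.2 (SameCycle.refl f a))
  · intro h a b hab
    obtain ⟨i, -, rfl⟩ := hab.exists_pow_eq'
    clear hab
    induction i with
    | zero => exact r.refl' a
    | succ i ih =>
      rw [pow_succ', mul_apply]
      exact r.trans' ih (h _)

/-- The number of cycles of a permutation, fixed points included. -/
noncomputable def cycleCount (f : Perm D) : ℕ := Nat.card (Quotient (SameCycle.setoid f))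

/-- The number of orbits of the group generated by two permutations. -/
noncomputable def orbitCount (f g : Perm D) : ℕ :=
  Nat.card (Quotient (SameCycle.setoid f ⊔ SameCycle.setoid g))

variable [DecidableEq D]

/-- The new permutation leaves `x` for `f y` and then follows the old cycle of `y`, which avoids
`x`, up to `y`. -/
theorem sameCycle_mul_swap {f : Perm D} {x y : D} (h : ¬ SameCycle f x y) :
    SameCycle (f * swap x y) x y := by
  set g := f * swap x y with hg
  have hgx : g x = f y := by simp [hg]
  have hy : ∃ n, 0 < n ∧ (f ^ n) y = y := ⟨orderOf f, orderOf_pos f, by simp [pow_orderOf_eq_one]⟩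
  classical
  obtain ⟨hn, hfn⟩ := Nat.find_spec hy
  have key : ∀ j, 0 < j → j ≤ Nat.find hy → (g ^ j) x = (f ^ j) y := by
    intro j hj
    induction j, hj using Nat.le_induction with
    | base => intro; simpa using hgx
    | succ j hj ih =>
      intro hle
      have h1 : (f ^ j) y ≠ y := fun h => Nat.find_min hy (m := j) (by omega) ⟨by omega, h⟩
      have h2 : (f ^ j) y ≠ x := fun h' => h (SameCycle.symm ⟨j, by simpa using h'⟩)
      rw [pow_succ', mul_apply, ih (by omega), pow_succ' f, mul_apply f,
        swap_apply_of_ne_of_ne h2 h1]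
      rfl
  exact ⟨Nat.find hy, by simpa [key _ hn le_rfl] using hfn⟩

/-- From `x` the new permutation goes to `f y` and along the old cycle until it meets `x` again,
where it jumps back to `f y`; the point `y` lies on the other part of the cycle. -/
theorem not_sameCycle_mul_swap {f : Perm D} {x y : D} (h : SameCycle f x y) (hxy : x ≠ y) :
    ¬ SameCycle (f * swap x y) x y := by
  set g := f * swap x y with hg
  have hgx : g x = f y := by simp [hg]
  obtain ⟨i, -, hi⟩ := h.symm.exists_pow_eq'
  have hy : ∃ n, (f ^ n) y = x := ⟨i, hi⟩
  classical
  have hfn := Nat.find_spec hy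
  have hmin : ∀ j, j < Nat.find hy → (f ^ j) y ≠ x := fun j hj => Nat.find_min hy hj
  have hpos : 0 < Nat.find hy := by
    rcases Nat.eq_zero_or_pos (Nat.find hy) with h0 | h0
    · rw [h0] at hfn; exact absurd hfn.symm hxy
    · exact h0
  have hny : ∀ j, 0 < j → j ≤ Nat.find hy → (f ^ j) y ≠ y := by
    intro j hj hle he
    have : (f ^ (Nat.find hy - j)) y = x := by
      have h1 := hfn
      rw [show f ^ Nat.find hy = f ^ (Nat.find hy - j) * f ^ j by
        rw [← pow_add, Nat.sub_add_cancel hle], mul_apply, he] at h1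
      exact h1
    exact hmin _ (by omega) this
  have key : ∀ m, ∃ j, 0 < j ∧ j ≤ Nat.find hy ∧ (g ^ m) x = (f ^ j) y := by
    intro m
    induction m with
    | zero => exact ⟨_, hpos, le_rfl, by simpa using hfn.symm⟩
    | succ m ih =>
      obtain ⟨j, hj, hle, he⟩ := ih
      rcases hle.lt_or_eq with hlt | rfl
      · refine ⟨j + 1, by omega, hlt, ?_⟩
        rw [pow_succ', mul_apply, he, pow_succ' f, mul_apply f,
          swap_apply_of_ne_of_ne (hmin j hlt) (hny j hj hle)]
        rfl
      · refine ⟨1, one_pos, hpos, ?_⟩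
        rw [pow_succ', mul_apply, he, hfn, hgx, pow_one]
  intro hs
  obtain ⟨m, -, hm⟩ := hs.exists_pow_eq'
  obtain ⟨j, hj, hle, he⟩ := key m
  exact hny j hj hle (he ▸ hm)

/-- Once `x` and `y` are identified, composing with their transposition does not affect the orbits.
-/
theorem setoid_mul_swap_sup_pair (f : Perm D) (x y : D) :
    SameCycle.setoid (f * swap x y) ⊔ Setoid.pair x y = SameCycle.setoid f ⊔ Setoid.pair x y := by
  have key : ∀ g : Perm D, SameCycle.setoid (g * swap x y) ⊔ Setoid.pair x y ≤
      SameCycle.setoid g ⊔ Setoid.pair x y := by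
    intro g
    have hxy : (SameCycle.setoid g ⊔ Setoid.pair x y) x y :=
      Setoid.pair_le_iff.1 le_sup_right
    have hg : ∀ a, (SameCycle.setoid g ⊔ Setoid.pair x y) a (g a) :=
      setoid_le_iff.1 le_sup_left
    refine sup_le (setoid_le_iff.2 fun a => ?_) le_sup_right
    rw [mul_apply]
    rcases eq_or_ne a x with rfl | hax
    · rw [swap_apply_left]; exact Setoid.trans' _ hxy (hg _)
    rcases eq_or_ne a y with rfl | hay
    · rw [swap_apply_right]; exact Setoid.trans' _ (Setoid.symm' _ hxy) (hg _)
    · rw [swap_apply_of_ne_of_ne hax hay]; exact hg a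
  refine le_antisymm (key f) ?_
  have := key (f * swap x y)
  rwa [mul_assoc, swap_mul_self, mul_one] at this

theorem setoid_sup_pair_of_sameCycle {f : Perm D} {x y : D} (h : SameCycle f x y) :
    SameCycle.setoid f ⊔ Setoid.pair x y = SameCycle.setoid f :=
  sup_eq_left.2 (Setoid.pair_le_iff.2 h)

/-- The cycles of the product are those of `f` with the two through `x` and `y` merged, so exactly
one is lost. -/
theorem cycleCount_mul_swap_of_not_sameCycle {f : Perm D} {x y : D} (h : ¬ SameCycle f x y) :
    cycleCount (f * swap x y) + 1 = cycleCount f := by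
  have h1 := setoid_mul_swap_sup_pair f x y
  rw [setoid_sup_pair_of_sameCycle (sameCycle_mul_swap h)] at h1
  have h2 := Setoid.card_quotient_le_sup_pair (SameCycle.setoid f) x y
  have h3 := Setoid.card_quotient_lt (r := SameCycle.setoid f)
    (s := SameCycle.setoid f ⊔ Setoid.pair x y) le_sup_left
    (Setoid.pair_le_iff.1 le_sup_right) h
  unfold cycleCount
  rw [h1]
  omega

theorem cycleCount_mul_swap_of_sameCycle {f : Perm D} {x y : D} (h : SameCycle f x y)
    (hxy : x ≠ y) : cycleCount (f * swap x y) = cycleCount f + 1 := by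
  have := cycleCount_mul_swap_of_not_sameCycle (not_sameCycle_mul_swap h hxy)
  rw [mul_assoc, swap_mul_self, mul_one] at this
  exact this.symm

theorem swap_mul_eq_mul_swap' (f : Perm D) (x y : D) :
    swap (f x) (f y) * f = f * swap x y := by
  rw [swap_apply_apply]; group

/-- Two permutations describe (the vertices and edges of) a map all of whose components are
spheres. The reverse inequality holds for all pairs. -/
def Spherical (f g : Perm D) : Prop :=
  Nat.card D + 2 * orbitCount f g ≤ cycleCount f + cycleCount g + cycleCount (f * g)

theorem orbitCount_mul_swap_le (f g : Perm D) (x y : D) :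
    orbitCount (f * swap x y) g ≤ orbitCount f g + 1 := by
  refine (Setoid.card_quotient_le_sup_pair _ x y).trans (Nat.succ_le_succ ?_)
  apply Setoid.card_quotient_le
  rw [sup_assoc, sup_comm (SameCycle.setoid g), ← sup_assoc, setoid_mul_swap_sup_pair]
  exact sup_le (le_sup_left.trans le_sup_left) le_sup_right

theorem orbitCount_comm (f g : Perm D) : orbitCount f g = orbitCount g f := by
  unfold orbitCount; rw [sup_comm]

theorem cycleCount_inv (f : Perm D) : cycleCount f⁻¹ = cycleCount f := by
  unfold cycleCount
  congr 2
  ext a b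
  exact sameCycle_inv

theorem orbitCount_inv (f g : Perm D) : orbitCount f⁻¹ g⁻¹ = orbitCount f g := by
  have h : ∀ f : Perm D, SameCycle.setoid f⁻¹ = SameCycle.setoid f := by
    intro f; ext a b; exact sameCycle_inv
  unfold orbitCount
  rw [h, h]

/-- The Euler characteristic drops by at most the number of new components when a cycle of the
first permutation is split. -/
theorem euler_mul_swap {f g : Perm D} {x y : D} (h : SameCycle f x y) (hxy : x ≠ y) :
    cycleCount f + cycleCount g + cycleCount (f * g) + 2 * orbitCount (f * swap x y) g ≤
    cycleCount (f * swap x y) + cycleCount g + cycleCount (f * swap x y * g) +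
      2 * orbitCount f g := by
  rw [cycleCount_mul_swap_of_sameCycle h hxy]
  -- The transposition is moved past `g`, so that the face permutation is multiplied by a
  -- transposition on the right as well.
  have e : f * swap x y * g = (f * g) * swap (g⁻¹ x) (g⁻¹ y) := by
    rw [mul_assoc, mul_assoc, ← swap_mul_eq_mul_swap' g]; simp
  rw [e]
  by_cases hs : SameCycle (f * g) (g⁻¹ x) (g⁻¹ y)
  · rw [cycleCount_mul_swap_of_sameCycle hs (by simpa using hxy)]
    have := orbitCount_mul_swap_le f g x y
    omega
  -- If two faces merge, the merged face still connects `x` with `y`, so no component is split.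
  · have h1 := cycleCount_mul_swap_of_not_sameCycle hs
    have h2 : orbitCount (f * swap x y) g ≤ orbitCount f g := by
      apply Setoid.card_quotient_le
      set t := SameCycle.setoid (f * swap x y) ⊔ SameCycle.setoid g with ht
      have hg : ∀ a, t a (g a) := setoid_le_iff.1 le_sup_right
      have hf : ∀ a, t a ((f * swap x y) a) := setoid_le_iff.1 le_sup_left
      have hfg : t (g⁻¹ x) (g⁻¹ y) := by
        have h3 := sameCycle_mul_swap hs
        rw [← e] at h3
        have h4 : SameCycle.setoid (f * swap x y * g) ≤ t :=
          setoid_le_iff.2 fun a => t.trans' (hg a) (hf (g a))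
        exact h4 h3
      have hxy' : t x y := by
        have h5 : t (g⁻¹ x) x := by simpa using hg (g⁻¹ x)
        have h6 : t (g⁻¹ y) y := by simpa using hg (g⁻¹ y)
        exact t.trans' (t.symm' h5) (t.trans' hfg h6)
      refine sup_le ?_ le_sup_right
      calc SameCycle.setoid f ≤ SameCycle.setoid f ⊔ Setoid.pair x y := le_sup_left
        _ = _ := (setoid_mul_swap_sup_pair f x y).symm
        _ ≤ t := sup_le le_sup_left (Setoid.pair_le_iff.2 hxy')
    omega

theorem Spherical.mul_swap {f g : Perm D} (hs : Spherical f g) {x y : D} (h : SameCycle f x y)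
    (hxy : x ≠ y) : Spherical (f * swap x y) g := by
  have := euler_mul_swap (g := g) h hxy
  unfold Spherical at *
  omega

/-- Inversion exchanges the roles of the two permutations; it transfers removals from the left one
to the right one. -/
theorem Spherical.inv {f g : Perm D} (hs : Spherical f g) : Spherical g⁻¹ f⁻¹ := by
  unfold Spherical at *
  rw [← mul_inv_rev, cycleCount_inv, cycleCount_inv, cycleCount_inv, orbitCount_inv,
    orbitCount_comm]
  omega

/-- The permutation obtained from `f` by taking `d` out of its cycle. -/
def remove (f : Perm D) (d : D) : Perm D := swap d (f d) * f

theorem remove_eq (f : Perm D) (d : D) : remove f d = f * swap (f⁻¹ d) d := by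
  rw [← swap_mul_eq_mul_swap' f]; simp [remove]

theorem remove_apply_self (f : Perm D) (d : D) : remove f d d = d := by simp [remove]

theorem remove_apply_of_apply_eq {f : Perm D} {d x : D} (hx : x ≠ d) (h : f x = d) :
    remove f d x = f d := by simp [remove, h]

theorem remove_apply_of_ne {f : Perm D} {d x : D} (hx : x ≠ d) (h : f x ≠ d) :
    remove f d x = f x := by
  rw [remove, mul_apply, swap_apply_of_ne_of_ne h (by simpa using hx)]

theorem remove_of_fixed {f : Perm D} {d : D} (h : f d = d) : remove f d = f := by
  rw [remove, h, swap_self]; rfl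

theorem inv_remove (f : Perm D) (d : D) : (remove f d)⁻¹ = remove f⁻¹ d := by
  rw [remove_eq, mul_inv_rev, swap_inv, remove, swap_comm]

theorem Spherical.remove_left {f g : Perm D} (hs : Spherical f g) (d : D) :
    Spherical (remove f d) g := by
  by_cases h : f d = d
  · rwa [remove_of_fixed h]
  · rw [remove_eq]
    refine hs.mul_swap ⟨1, by simp⟩ fun h' => h ?_
    rw [← h']; simpa using h'.symm

theorem Spherical.remove_right {f g : Perm D} (hs : Spherical f g) (d : D) :
    Spherical f (remove g d) := by
  have := (hs.inv.remove_left d).inv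
  rwa [inv_inv, inv_remove, inv_inv] at this

theorem cycleCount_remove {f : Perm D} {d : D} (h : f d ≠ d) :
    cycleCount (remove f d) = cycleCount f + 1 := by
  rw [remove_eq]
  refine cycleCount_mul_swap_of_sameCycle ⟨1, by simp⟩ fun h' => h ?_
  rw [← h']; simpa using h'.symm

theorem sameCycle_remove {f : Perm D} {d x y : D} (hx : x ≠ d) (hy : y ≠ d)
    (h : SameCycle f x y) : SameCycle (remove f d) x y := by
  obtain ⟨i, -, rfl⟩ := h.exists_pow_eq'
  clear h
  -- The removed point has to be skipped: the second clause says that, when the orbit is at `d`, the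
  -- point after it is reached.
  suffices H : ∀ i, ((f ^ i) x ≠ d → SameCycle (remove f d) x ((f ^ i) x)) ∧
      ((f ^ i) x = d → SameCycle (remove f d) x ((f ^ (i + 1)) x)) from (H i).1 hy
  intro i
  induction i with
  | zero => exact ⟨fun _ => SameCycle.refl _ _, fun h => absurd h hx⟩
  | succ i ih =>
    have step : (f ^ (i + 1)) x ≠ d → SameCycle (remove f d) x ((f ^ (i + 1)) x) := by
      intro h1
      by_cases h2 : (f ^ i) x = d
      · exact ih.2 h2
      · refine (ih.1 h2).trans ⟨1, ?_⟩
        rw [pow_succ', mul_apply] at h1 ⊢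
        rw [zpow_one, remove_apply_of_ne h2 h1]
    refine ⟨step, fun h1 => ?_⟩
    by_cases h2 : (f ^ i) x = d
    · have h3 : f d = d := by
        rw [pow_succ', mul_apply, h2] at h1; exact h1
      exfalso
      have : ∀ j, (f ^ j) d = d := fun j => by
        induction j with
        | zero => rfl
        | succ j ihj => rw [pow_succ', mul_apply, ihj, h3]
      have h4 : (f ^ i) x = (f ^ i) d := by rw [h2, this]
      exact hx ((f ^ i).injective h4)
    · refine (ih.1 h2).trans ⟨1, ?_⟩
      have h1' : f ((f ^ i) x) = d := by rw [← mul_apply, ← pow_succ']; exact h1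
      rw [zpow_one, remove_apply_of_apply_eq h2 h1', pow_succ', mul_apply, h1]

theorem cycleCount_one : cycleCount (1 : Perm D) = Nat.card D := by
  apply Nat.card_congr
  have : SameCycle.setoid (1 : Perm D) = ⊥ := by
    ext a b; exact sameCycle_one
  rw [this]
  exact Setoid.quotientBotEquiv

/-- Nonnegativity of the genus. -/
theorem euler_le (f g : Perm D) :
    cycleCount f + cycleCount g + cycleCount (f * g) ≤ Nat.card D + 2 * orbitCount f g := by
  classical
  have := Fintype.ofFinite D
  suffices H : ∀ n, ∀ f : Perm D, f.support.card ≤ n →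
      cycleCount f + cycleCount g + cycleCount (f * g) ≤ Nat.card D + 2 * orbitCount f g from
    H _ f le_rfl
  intro n
  induction n with
  | zero =>
    intro f hf
    have : f = 1 := by simpa using hf
    subst this
    rw [one_mul, cycleCount_one]
    have : orbitCount 1 g = cycleCount g := by
      unfold orbitCount cycleCount
      have : SameCycle.setoid (1 : Perm D) ⊔ SameCycle.setoid g = SameCycle.setoid g := by
        refine sup_eq_right.2 (setoid_le_iff.2 fun a => Setoid.refl' _ _)
      rw [this]
    omega
  | succ n ih =>
    intro f hf
    by_cases h1 : f = 1
    · exact ih f (by simp [h1])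
    obtain ⟨d, hd⟩ : ∃ d, f d ≠ d := by
      by_contra! h; exact h1 (ext h)
    have hlt : (remove f d).support.card < f.support.card := by
      apply Finset.card_lt_card
      refine Finset.ssubset_iff_of_subset (fun x hx => ?_) |>.2 ⟨d, by simpa using hd, ?_⟩
      · rw [mem_support] at *
        intro hfx
        apply hx
        rcases eq_or_ne x d with rfl | hxd
        · exact remove_apply_self _ _
        · rw [remove_apply_of_ne hxd (by rwa [hfx]), hfx]
      · simp [remove_apply_self]
    have h2 := ih (remove f d) (by omega)
    rw [remove_eq] at h2
    have h3 := euler_mul_swap (f := f) (g := g) (x := f⁻¹ d) (y := d) ⟨1, by simp⟩ (fun h' => hd (by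
      rw [← h']; simpa using h'.symm))
    omega

/-- A function that is constant on the cycles bounds their number from below. -/
theorem card_le_cycleCount {X : Type*} (f : Perm D) (φ : D → X) (hφ : ∀ d, φ (f d) = φ d)
    (hsurj : Function.Surjective φ) : Nat.card X ≤ cycleCount f := by
  have hle : SameCycle.setoid f ≤ Setoid.ker φ := setoid_le_iff.2 fun a => (hφ a).symm
  refine Nat.card_le_card_of_surjective (Quotient.lift φ fun a b h => hle h) fun x => ?_
  obtain ⟨d, rfl⟩ := hsurj x
  exact ⟨⟦d⟧, rfl⟩

/-- A function that separates the cycles bounds their number from above. -/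
theorem cycleCount_le_card {X : Type*} [Finite X] (f : Perm D) (φ : D → X)
    (hφ : ∀ d e, φ d = φ e → SameCycle f d e) : cycleCount f ≤ Nat.card X := by
  refine Nat.card_le_card_of_injective (fun q : Quotient (SameCycle.setoid f) => φ q.out) ?_
  intro q q' h
  have := hφ _ _ h
  rw [← q.out_eq, ← q'.out_eq]
  exact Quotient.sound this

end Equiv.Perm

/-! ### Constraint networks drawn on spheres. -/

/-- The static part of a constraint network drawn on a surface. Its darts `D` leave the nodes `X`.
The state of a node is a pair `(s, ε)` and shows the color `s + ε * pos d` at the dart `d`; walking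
around a node from one dart to another takes some number `corner` of steps. -/
structure NetworkData (p : ℕ) (D X : Type*) where
  node : D → X
  pos : D → ZMod p
  corner : D → D → ℕ
  weight : X → ℕ
  corner_le : ∀ a b, corner a b ≤ p
  corner_triangle : ∀ a b c, node a = node b → node b = node c →
    corner a c ≤ corner a b + corner b c
  weight_le_one : ∀ x, weight x ≤ 1
  pos_ne : ∀ a b, a ≠ b → node a = node b → weight (node a) = 1 → pos a ≠ pos b
  pos_eq_zero : ∀ a, weight (node a) = 0 → pos a = 0

namespace NetworkData

variable {p : ℕ} {D X : Type*} (M : NetworkData p D X)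

/-- The color shown at the dart `d`. -/
def read (g : X → ZMod p × ℤˣ) (d : D) : ZMod p :=
  (g (M.node d)).1 + (((g (M.node d)).2 : ℤ) : ZMod p) * M.pos d

/-- Walks without immediate reversals, from their first dart to their last, with their lengths. -/
inductive Run (α : Perm D) (l : D → ℕ) : D → D → ℕ → Prop
  | single (d : D) : α d ≠ d → Run α l d d (l d)
  | cons (d e f : D) (n : ℕ) : α d ≠ d → M.node (α d) = M.node e → e ≠ α d → Run α l e f n →
      Run α l d f (l d + M.corner (α d) e + n)

variable [Fintype D] [DecidableEq D] [DecidableEq X]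

/-- The darts at a node that belong to an edge. -/
def liveAt (α : Perm D) (x : X) : Finset D := {d | α d ≠ d ∧ M.node d = x}

/-- The requirements on a constraint network drawn on spheres: rotation `σ`, reversal `α`, number
`n` of degrees of freedom and length `l` of the edges, sets `S` of admissible color differences. -/
structure Valid (L : ℕ) (σ α : Perm D) (n l : D → ℕ) (S : D → Finset (ZMod p)) : Prop where
  invol : ∀ d, α (α d) = d
  node_rot : ∀ d, M.node (σ d) = M.node d
  fixed : ∀ d, α d = d → σ d = d
  sameCycle : ∀ d e, α d ≠ d → α e ≠ e → M.node d = M.node e → σ.SameCycle d e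
  spherical : Perm.Spherical σ α
  n_symm : ∀ d, α d ≠ d → n (α d) = n d
  n_lt : ∀ d, α d ≠ d → n d < p
  l_le : ∀ d, α d ≠ d → l d + l (α d) ≤ p * n d
  S_symm : ∀ d, α d ≠ d → ∀ t, t ∈ S (α d) ↔ -t ∈ S d
  S_card : ∀ d, α d ≠ d → n d < (S d).card
  corner_sum : ∀ x, ∑ d ∈ M.liveAt α x, M.corner d (σ d) ≤ p * M.weight x
  run_le : ∀ d f m, M.Run α l d f m → M.node (α f) = M.node d → d ≠ α f →
    L ≤ m + M.corner (α f) d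

/-- The states `g` satisfy the constraints of the edges. -/
def Colors (α : Perm D) (S : D → Finset (ZMod p)) (g : X → ZMod p × ℤˣ) : Prop :=
  ∀ d, α d ≠ d → M.read g (α d) - M.read g d ∈ S d

variable {M} {L : ℕ} {σ α : Perm D} {n l : D → ℕ} {S : D → Finset (ZMod p)}

@[simp] theorem mem_liveAt {x : X} {d : D} : d ∈ M.liveAt α x ↔ α d ≠ d ∧ M.node d = x := by
  simp [liveAt]

/-- The two corners at the removed dart become a single one, which the triangle inequality bounds by
their sum. -/
theorem sum_corner_remove_le {A : Finset D} {x : X} (hA : ∀ a ∈ A, M.node a = x)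
    (hσ : ∀ a ∈ A, σ a ∈ A) (d : D) :
    ∑ e ∈ A.erase d, M.corner e (Perm.remove σ d e) ≤ ∑ e ∈ A, M.corner e (σ e) := by
  by_cases hfix : σ d = d
  · rw [Perm.remove_of_fixed hfix]
    exact Finset.sum_le_sum_of_subset (Finset.erase_subset _ _)
  by_cases hd : d ∈ A
  · have himg : A.image σ = A := by
      apply Finset.eq_of_subset_of_card_le
      · intro y hy
        obtain ⟨a, ha, rfl⟩ := Finset.mem_image.1 hy
        exact hσ a ha
      · rw [Finset.card_image_of_injective _ σ.injective]
    obtain ⟨c, hc, hcd⟩ := Finset.mem_image.1 (himg.symm.subset hd)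
    have hcd' : c ≠ d := by rintro rfl; exact hfix hcd
    have hcm : c ∈ A.erase d := Finset.mem_erase.2 ⟨hcd', hc⟩
    rw [← Finset.add_sum_erase A _ hd, ← Finset.add_sum_erase _ _ hcm,
      ← Finset.add_sum_erase (A.erase d) (fun e => M.corner e (σ e)) hcm, ← add_assoc]
    apply add_le_add
    · rw [Perm.remove_apply_of_apply_eq hcd' hcd, hcd, add_comm]
      exact M.corner_triangle _ _ _ ((hA c hc).trans (hA d hd).symm)
        ((hA d hd).trans (hA _ (hσ d hd)).symm)
    · refine (Finset.sum_congr rfl fun e he => ?_).le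
      simp only [Finset.mem_erase] at he
      rw [Perm.remove_apply_of_ne he.2.1]
      intro h
      exact he.1 (σ.injective (h.trans hcd.symm))
  · rw [Finset.erase_eq_of_notMem hd]
    refine (Finset.sum_congr rfl fun e he => ?_).le
    rw [Perm.remove_apply_of_ne]
    · rintro rfl; exact hd he
    · intro h; exact hd (h ▸ hσ e he)

/-! ### Deleting edges and coloring flexible nodes. -/

namespace Valid

theorem live_rot (h : M.Valid L σ α n l S) {d : D} (hd : α d ≠ d) : α (σ d) ≠ σ d := by
  intro h1
  have h2 := h.fixed _ h1
  have h3 : σ d = d := σ.injective h2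
  rw [h3] at h1
  exact hd h1

theorem live_symm (h : M.Valid L σ α n l S) {d : D} (hd : α d ≠ d) : α (α d) ≠ α d := by
  rw [h.invol]; exact hd.symm

theorem remove_reversal_apply (h : M.Valid L σ α n l S) (d e : D) :
    Perm.remove α d e = if e = d ∨ e = α d then e else α e := by
  split_ifs with he
  · rcases he with rfl | rfl
    · exact Perm.remove_apply_self _ _
    · by_cases hd : α d = d
      · rw [hd]; exact Perm.remove_apply_self _ _
      · exact Perm.remove_apply_of_apply_eq hd (h.invol d)
  · push Not at he
    refine Perm.remove_apply_of_ne he.1 fun h' => he.2 ?_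
    rw [← h', h.invol]

/-- Deleting an edge. -/
theorem delete (h : M.Valid L σ α n l S) {d : D} (hd : α d ≠ d) :
    M.Valid L (Perm.remove (Perm.remove σ d) (α d)) (Perm.remove α d) n l S := by
  have hα := h.remove_reversal_apply d
  have hlive : ∀ e, Perm.remove α d e ≠ e →
      e ≠ d ∧ e ≠ α d ∧ α e ≠ e ∧ Perm.remove α d e = α e := by
    intro e he
    rw [hα] at he
    split_ifs at he with h1
    · exact absurd rfl he
    · push Not at h1
      exact ⟨h1.1, h1.2, he, by rw [hα, if_neg (by tauto)]⟩
  -- Runs of the smaller network are runs of the old one, so they stay long.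
  have hrun : ∀ a f m, M.Run (Perm.remove α d) l a f m → M.Run α l a f m := by
    intro a f m hr
    induction hr with
    | single a ha => exact Run.single a (hlive a ha).2.2.1
    | cons a e f m ha hn he _ ih =>
      obtain ⟨-, -, h3, h4⟩ := hlive a ha
      rw [h4] at hn he ⊢
      exact Run.cons a e f m h3 hn he ih
  refine ⟨?_, ?_, ?_, ?_, ?_, ?_, ?_, ?_, ?_, ?_, ?_, ?_⟩
  · intro e
    by_cases he : Perm.remove α d e = e
    · rw [he, he]
    · obtain ⟨h1, h2, h3, h4⟩ := hlive e he
      rw [h4, hα, h.invol, if_neg]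
      rintro (h5 | h5)
      · exact h2 (by rw [← h5, h.invol])
      · exact h1 (α.injective h5)
  · have key : ∀ (τ : Perm D) (c : D), (∀ e, M.node (τ e) = M.node e) →
        ∀ e, M.node (Perm.remove τ c e) = M.node e := by
      intro τ c hτ e
      rcases eq_or_ne e c with rfl | hec
      · rw [Perm.remove_apply_self]
      by_cases h1 : τ e = c
      · rw [Perm.remove_apply_of_apply_eq hec h1, hτ, ← h1, hτ]
      · rw [Perm.remove_apply_of_ne hec h1, hτ]
    exact key _ _ (key _ _ h.node_rot)
  · intro e he
    have key : ∀ (τ : Perm D) (c : D), τ e = e → Perm.remove τ c e = e := by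
      intro τ c hτ
      rcases eq_or_ne e c with rfl | hec
      · exact Perm.remove_apply_self _ _
      · rw [Perm.remove_apply_of_ne hec (by rwa [hτ]), hτ]
    rw [hα] at he
    split_ifs at he with h1
    · rcases h1 with rfl | rfl
      · exact key _ _ (Perm.remove_apply_self _ _)
      · exact Perm.remove_apply_self _ _
    · exact key _ _ (key _ _ (h.fixed e he))
  · intro a b ha hb hab
    obtain ⟨h1, h2, h3, -⟩ := hlive a ha
    obtain ⟨h5, h6, h7, -⟩ := hlive b hb
    exact Perm.sameCycle_remove h2 h6 (Perm.sameCycle_remove h1 h5 (h.sameCycle a b h3 h7 hab))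
  · exact ((h.spherical.remove_left d).remove_left (α d)).remove_right d
  · intro e he
    obtain ⟨h1, h2, h3, h4⟩ := hlive e he
    rw [h4]; exact h.n_symm e h3
  · intro e he; exact h.n_lt e (hlive e he).2.2.1
  · intro e he
    obtain ⟨h1, h2, h3, h4⟩ := hlive e he
    rw [h4]; exact h.l_le e h3
  · intro e he
    obtain ⟨h1, h2, h3, h4⟩ := hlive e he
    rw [h4]; exact h.S_symm e h3
  · intro e he; exact h.S_card e (hlive e he).2.2.1
  · intro x
    have hset : M.liveAt (Perm.remove α d) x = ((M.liveAt α x).erase d).erase (α d) := by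
      ext e
      simp only [mem_liveAt, Finset.mem_erase]
      constructor
      · rintro ⟨h1, h2⟩
        obtain ⟨h3, h4, h5, -⟩ := hlive e h1
        exact ⟨h4, h3, h5, h2⟩
      · rintro ⟨h1, h2, h3, h4⟩
        refine ⟨?_, h4⟩
        rw [hα, if_neg (by tauto)]; exact h3
    rw [hset]
    refine le_trans ?_ (h.corner_sum x)
    have hcl : ∀ a ∈ M.liveAt α x, σ a ∈ M.liveAt α x := by
      intro a ha
      rw [mem_liveAt] at ha ⊢
      exact ⟨h.live_rot ha.1, (h.node_rot a).trans ha.2⟩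
    refine le_trans (sum_corner_remove_le (x := x) ?_ ?_ (α d))
      (sum_corner_remove_le (x := x) ?_ hcl d)
    · intro a ha; exact (mem_liveAt.1 (Finset.mem_of_mem_erase ha)).2
    · intro a ha
      obtain ⟨h1, h2⟩ := Finset.mem_erase.1 ha
      refine Finset.mem_erase.2 ⟨?_, ?_⟩
      · intro h3
        apply h1
        apply (Perm.remove σ d).injective
        rw [h3, Perm.remove_apply_self]
      · by_cases h3 : σ a = d
        · rw [Perm.remove_apply_of_apply_eq h1 h3, ← h3]; exact hcl _ (hcl _ h2)
        · rw [Perm.remove_apply_of_ne h1 h3]; exact hcl _ h2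
    · intro a ha; exact (mem_liveAt.1 ha).2
  · intro a f m hr hn ha
    have hf : Perm.remove α d f ≠ f := by
      clear hn ha
      induction hr with
      | single a ha => exact ha
      | cons _ _ _ _ _ _ _ _ ih => exact ih
    rw [(hlive f hf).2.2.2] at hn ha ⊢
    exact h.run_le a f m (hrun a f m hr) hn ha

/-- Deleting a set of edges. -/
theorem exists_delete (h : M.Valid L σ α n l S) (A : Finset D) :
    ∃ σ' α' : Perm D, M.Valid L σ' α' n l S ∧
      ∀ e, α' e = if e ∈ A ∨ α e ∈ A then e else α e := by
  induction A using Finset.induction_on with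
  | empty => exact ⟨σ, α, h, by simp⟩
  | insert d A hdA ih =>
    obtain ⟨σ', α', hv, hα'⟩ := ih
    by_cases hd : α' d = d
    · refine ⟨σ', α', hv, fun e => ?_⟩
      rw [hα']
      by_cases h1 : e ∈ A ∨ α e ∈ A
      · rw [if_pos h1, if_pos (h1.imp (Finset.mem_insert_of_mem) (Finset.mem_insert_of_mem))]
      · rw [if_neg h1]
        split_ifs with h2
        · rw [hα'] at hd
          simp only [Finset.mem_insert] at h2
          have h3 : e = d ∨ α e = d := by tauto
          rcases h3 with rfl | h3
          · rwa [if_neg h1] at hd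
          · have h4 : α d = e := by rw [← h3, h.invol]
            rw [h4, ← h3] at hd
            rw [if_neg (by tauto)] at hd
            exact hd.symm
        · rfl
    · refine ⟨_, _, hv.delete hd, fun e => ?_⟩
      rw [hv.remove_reversal_apply]
      have hd' : α' d = α d := by
        rw [hα'] at hd ⊢
        split_ifs at hd ⊢ with h1
        · exact absurd rfl hd
        · rfl
      have h5 : e = α d ↔ α e = d := by
        constructor
        · rintro rfl; exact h.invol d
        · rintro rfl; exact (h.invol e).symm
      rw [hd', hα']
      simp only [h5, Finset.mem_insert]
      split_ifs <;> first | rfl | tauto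

variable [Fact p.Prime]

/-- A loop would be a closed run of length at most `p (p - 1)`, and with a corner of at most `p`
this stays below `L`. -/
theorem node_ne (h : M.Valid L σ α n l S) (hL : 2 * p * p ≤ L + p) {d : D} (hd : α d ≠ d) :
    M.node (α d) ≠ M.node d := by
  intro h1
  have h2 := h.run_le d d _ (Run.single d hd) h1 (Ne.symm hd)
  have h3 := M.corner_le (α d) d
  have h4 := h.l_le d hd
  have h5 := h.n_lt d hd
  have hp := (Fact.out : p.Prime).two_le
  have h6 : p * n d + p ≤ p * p := by nlinarith
  nlinarith

/-- Coloring a node whose edges are jointly flexible enough. -/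
theorem exists_colors_update (h : M.Valid L σ α n l S) (hL : 2 * p * p ≤ L + p) {x : X}
    (hx : ∑ d ∈ M.liveAt α x, (p - 1 - n d) < p) {α' : Perm D}
    (hα' : ∀ e, M.node e ≠ x → M.node (α e) ≠ x → α' e = α e) {g : X → ZMod p × ℤˣ}
    (hg : M.Colors α' S g) : ∃ q, M.Colors α S (Function.update g x q) := by
  -- For either sign, each difference in `S d` determines the first component of a suitable state,
  -- so the edge admits at least `2 |S d|` of the `2 p` states.
  let good (d : D) : Finset (ZMod p × ℤˣ) :=
    Finset.univ.filter fun q => M.read g (α d) - (q.1 + ((q.2 : ℤ) : ZMod p) * M.pos d) ∈ S d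
  have hgood : ∀ d, 2 * (S d).card ≤ (good d).card := by
    intro d
    have h1 : (S d ×ˢ (Finset.univ : Finset ℤˣ)).card ≤ (good d).card := by
      apply Finset.card_le_card_of_injOn
        (fun t => (M.read g (α d) - t.1 - ((t.2 : ℤ) : ZMod p) * M.pos d, t.2))
      · rintro ⟨t, ε⟩ ht
        simp only [Finset.coe_product, Set.mem_prod, Finset.mem_coe] at ht
        simp only [good, Finset.coe_filter, Finset.mem_univ, true_and, Set.mem_ofPred_eq]
        convert ht.1 using 1
        ring
      · rintro ⟨t, ε⟩ - ⟨t', ε'⟩ - he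
        simp only [Prod.mk.injEq] at he
        obtain ⟨h1, rfl⟩ := he
        simp only [sub_left_inj, sub_right_inj] at h1
        rw [h1]
    rw [Finset.card_product, show (Finset.univ : Finset ℤˣ).card = 2 from rfl] at h1
    omega
  have htot : Fintype.card (ZMod p × ℤˣ) = 2 * p := by
    rw [Fintype.card_prod, ZMod.card, show Fintype.card ℤˣ = 2 from rfl, mul_comm]
  obtain ⟨q, hq⟩ : ∃ q, ∀ d ∈ M.liveAt α x, q ∈ good d := by
    by_contra! hno
    -- Union bound: an edge forbids at most `2 (p - 1 - n d)` states, and by `hx` these are fewer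
    -- than `2 p` in all.
    have h1 : (Finset.univ : Finset (ZMod p × ℤˣ)) ⊆ (M.liveAt α x).biUnion fun d => (good d)ᶜ := by
      intro q _
      obtain ⟨d, hd, hqd⟩ := hno q
      exact Finset.mem_biUnion.2 ⟨d, hd, Finset.mem_compl.2 hqd⟩
    have h2 := (Finset.card_le_card h1).trans Finset.card_biUnion_le
    rw [Finset.card_univ, htot] at h2
    have h3 : ∑ d ∈ M.liveAt α x, (good d)ᶜ.card ≤ ∑ d ∈ M.liveAt α x, 2 * (p - 1 - n d) := by
      apply Finset.sum_le_sum
      intro d hd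
      rw [Finset.card_compl, htot]
      have h4 := hgood d
      have h5 := h.S_card d (mem_liveAt.1 hd).1
      have h6 := h.n_lt d (mem_liveAt.1 hd).1
      omega
    rw [← Finset.mul_sum] at h3
    omega
  refine ⟨q, fun e he => ?_⟩
  have hne := h.node_ne hL he
  by_cases h1 : M.node e = x
  · have h2 := hq e (mem_liveAt.2 ⟨he, h1⟩)
    simp only [good, Finset.mem_filter, Finset.mem_univ, true_and] at h2
    have h3 : M.node (α e) ≠ x := by rwa [← h1]
    simpa [read, h1, Function.update_of_ne h3] using h2
  by_cases h3 : M.node (α e) = x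
  · have h2 := hq (α e) (mem_liveAt.2 ⟨h.live_symm he, h3⟩)
    simp only [good, Finset.mem_filter, Finset.mem_univ, true_and, h.invol, h.S_symm e he,
      neg_sub] at h2
    simpa [read, h3, Function.update_of_ne h1] using h2
  · have h4 := hα' e h1 h3
    have h5 := hg e (by rwa [h4])
    rw [h4] at h5
    simpa [read, Function.update_of_ne h1, Function.update_of_ne h3] using h5

end Valid

end NetworkData

/-! ### Suppressing a node of degree two. -/

namespace NetworkData

variable {p : ℕ} {D X : Type*} {M : NetworkData p D X} [Fintype D] [DecidableEq D] [DecidableEq X]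
  {L : ℕ} {σ α : Perm D} {n l : D → ℕ} {S : D → Finset (ZMod p)}

namespace Valid

/-- The reversal after two edges `{a, α a}`, `{b, α b}` are replaced by `{α a, α b}`. -/
def spliceRev (α : Perm D) (a b : D) : Perm D :=
  swap (α a) (α b) * Perm.remove (Perm.remove α a) b

theorem spliceRev_apply (hinv : ∀ d, α (α d) = d) {a b : D} (hab : a ≠ b) (ha : α a ≠ a)
    (hb : α b ≠ b) (hab' : α a ≠ b) (e : D) :
    spliceRev α a b e = if e = a ∨ e = b then e else if e = α a then α b
      else if e = α b then α a else α e := by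
  have hba' : α b ≠ a := fun h => hab' (by rw [← h, hinv])
  have hne : α a ≠ α b := fun h => hab (α.injective h)
  have h1 : ∀ e, Perm.remove α a e = if e = a ∨ e = α a then e else α e := by
    intro e
    split_ifs with he
    · rcases he with rfl | rfl
      · exact Perm.remove_apply_self _ _
      · exact Perm.remove_apply_of_apply_eq ha (hinv a)
    · push Not at he
      refine Perm.remove_apply_of_ne he.1 fun h' => he.2 ?_
      rw [← h', hinv]
  have h2 : ∀ e, Perm.remove (Perm.remove α a) b e =
      if e = a ∨ e = α a ∨ e = b ∨ e = α b then e else α e := by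
    intro e
    rcases eq_or_ne e b with rfl | heb
    · rw [Perm.remove_apply_self]; simp
    rcases eq_or_ne e (α b) with rfl | heb'
    · rw [Perm.remove_apply_of_apply_eq hb, h1, if_neg (by tauto), if_pos (by tauto)]
      rw [h1, if_neg (by tauto), hinv]
    · rw [Perm.remove_apply_of_ne heb, h1]
      · split_ifs <;> first | rfl | tauto
      · rw [h1]
        split_ifs with h3
        · exact heb
        · intro h4
          exact heb' (by rw [← h4, hinv])
  rw [spliceRev, Perm.mul_apply, h2]
  rcases eq_or_ne e a with rfl | h3
  · rw [if_pos (by tauto), if_pos (by tauto), swap_apply_of_ne_of_ne ha.symm hba'.symm]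
  rcases eq_or_ne e b with rfl | h4
  · rw [if_pos (by tauto), if_pos (by tauto), swap_apply_of_ne_of_ne hab'.symm hb.symm]
  rcases eq_or_ne e (α a) with rfl | h5
  · rw [if_pos (by tauto), if_neg (by tauto), if_pos rfl, swap_apply_left]
  rcases eq_or_ne e (α b) with rfl | h6
  · rw [if_pos (by tauto), if_neg (by tauto), if_neg (by tauto), if_pos rfl, swap_apply_right]
  · rw [if_neg (by tauto), if_neg (by tauto), if_neg h5, if_neg h6, swap_apply_of_ne_of_ne]
    · exact fun h => h3 (α.injective h)
    · exact fun h => h4 (α.injective h)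

/-- Cutting the 2-cycle `(a b)` of the rotation gains one cycle, replacing two edges by one gains
one cycle of the reversal, and two faces are gained. These four pay for the at most two new
components, the isolated darts `a` and `b`. -/
theorem spherical_splice (hs : Perm.Spherical σ α) (hinv : ∀ d, α (α d) = d) {a b : D}
    (hab : a ≠ b) (ha : α a ≠ a) (hb : α b ≠ b) (hab' : α a ≠ b) (hσa : σ a = b) (hσb : σ b = a) :
    Perm.Spherical (Perm.remove σ a) (spliceRev α a b) := by
  have hba' : α b ≠ a := fun h => hab' (by rw [← h, hinv])
  have hne : α a ≠ α b := fun h => hab (α.injective h)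
  have hσ' : ∀ e, Perm.remove σ a e = if e = a ∨ e = b then e else σ e := by
    intro e
    rcases eq_or_ne e a with rfl | h1
    · rw [Perm.remove_apply_self]; simp
    rcases eq_or_ne e b with rfl | h2
    · rw [Perm.remove_apply_of_apply_eq h1 hσb, hσa]; simp
    · rw [Perm.remove_apply_of_ne h1, if_neg (by tauto)]
      intro h3; exact h2 (σ.injective (h3.trans hσb.symm))
  have hα' := spliceRev_apply hinv hab ha hb hab'
  have c1 := Perm.cycleCount_remove (f := σ) (d := a) (by rw [hσa]; exact hab.symm)
  have c2 := Perm.cycleCount_remove (f := α) (d := a) ha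
  have hrb : Perm.remove α a b = α b :=
    Perm.remove_apply_of_ne hab.symm hba'
  have c3 := Perm.cycleCount_remove (f := Perm.remove α a) (d := b) (by rw [hrb]; exact hb)
  have hfa : Perm.remove (Perm.remove α a) b (α a) = α a := by
    have h1 : Perm.remove α a (α a) = α a := Perm.remove_apply_of_apply_eq ha (hinv a)
    rw [Perm.remove_apply_of_ne hab' (by rwa [h1]), h1]
  have hfb : Perm.remove (Perm.remove α a) b (α b) = α b := by
    rw [Perm.remove_apply_of_apply_eq hb, hrb]
    rw [Perm.remove_apply_of_ne hba', hinv]; rw [hinv]; exact hab.symm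
  have c4 := Perm.cycleCount_mul_swap_of_not_sameCycle (f := Perm.remove (Perm.remove α a) b)
    (x := α a) (y := α b) (fun h => hne (h.eq_of_left hfa))
  rw [← Perm.swap_mul_eq_mul_swap', hfa, hfb] at c4
  -- The new facial walks are the old ones with the darts `a` and `b` taken out.
  have hφ : Perm.remove σ a * spliceRev α a b = Perm.remove (Perm.remove (σ * α) a) b := by
    have hψ : ∀ e, Perm.remove (σ * α) a e = if e = a then a else if e = α b then σ (α a)
        else σ (α e) := by
      intro e
      rcases eq_or_ne e a with rfl | h1
      · rw [Perm.remove_apply_self]; simp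
      rcases eq_or_ne e (α b) with rfl | h2
      · rw [Perm.remove_apply_of_apply_eq h1, Perm.mul_apply]
        · simp [h1]
        · rw [Perm.mul_apply, hinv, hσb]
      · rw [Perm.remove_apply_of_ne h1, if_neg h1, if_neg h2, Perm.mul_apply]
        rw [Perm.mul_apply]
        intro h3
        apply h2
        rw [← hinv e, σ.injective (h3.trans hσb.symm)]
    ext e
    rw [Perm.mul_apply, hα', hσ']
    rcases eq_or_ne e b with rfl | h1
    · rw [Perm.remove_apply_self]; simp
    rcases eq_or_ne e (α a) with rfl | h2
    · rw [Perm.remove_apply_of_apply_eq h1, hψ]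
      · simp [hab.symm, ha, hab', hba', hb, hb.symm]
      · rw [hψ, if_neg ha, if_neg hne, hinv, hσa]
    rcases eq_or_ne e a with rfl | h3
    · rw [Perm.remove_apply_of_ne h1] <;> rw [hψ, if_pos rfl]
      · simp
      · exact h1
    rcases eq_or_ne e (α b) with rfl | h4
    · rw [if_neg (show ¬ (α b = a ∨ α b = b) by tauto), if_neg h2, if_pos rfl, if_neg (by tauto),
        Perm.remove_apply_of_ne h1, hψ, if_neg hba', if_pos rfl]
      rw [hψ, if_neg hba', if_pos rfl]
      intro h5
      exact ha (σ.injective (h5.trans hσa.symm))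
    · have h6 : ¬ (α e = a ∨ α e = b) := by
        rintro (h5 | h5)
        · exact h2 (by rw [← h5, hinv])
        · exact h4 (by rw [← h5, hinv])
      rw [if_neg (show ¬ (e = a ∨ e = b) by tauto), if_neg h2, if_neg h4, if_neg h6,
        Perm.remove_apply_of_ne h1, hψ, if_neg h3, if_neg h4]
      · rw [hψ, if_neg h3, if_neg h4]
        intro h5
        apply h2
        rw [← hinv e, σ.injective (h5.trans hσa.symm)]
  have c5 := Perm.cycleCount_remove (f := σ * α) (d := a) (by
    rw [Perm.mul_apply]; intro h; exact hab' (σ.injective (h.trans hσb.symm)))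
  have hfb' : Perm.remove (σ * α) a b = σ (α b) := by
    rw [Perm.remove_apply_of_ne hab.symm, Perm.mul_apply]
    rw [Perm.mul_apply]; intro h; exact hb (σ.injective (h.trans hσb.symm))
  have c6 := Perm.cycleCount_remove (f := Perm.remove (σ * α) a) (d := b) (by
    rw [hfb']; intro h; exact hba' (σ.injective (h.trans hσa.symm)))
  have ho : Perm.orbitCount (Perm.remove σ a) (spliceRev α a b) ≤ Perm.orbitCount σ α + 2 := by
    unfold Perm.orbitCount
    set t := Perm.SameCycle.setoid (Perm.remove σ a) ⊔ Perm.SameCycle.setoid (spliceRev α a b)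
    have h1 := Setoid.card_quotient_le_sup_pair t a (α a)
    have h2 := Setoid.card_quotient_le_sup_pair (t ⊔ Setoid.pair a (α a)) b (α b)
    set u := t ⊔ Setoid.pair a (α a) ⊔ Setoid.pair b (α b)
    have hua : u a (α a) := Setoid.pair_le_iff.1 (le_sup_right.trans le_sup_left)
    have hub : u b (α b) := Setoid.pair_le_iff.1 le_sup_right
    have htu : t ≤ u := le_sup_left.trans le_sup_left
    have hσu : ∀ e, u e (Perm.remove σ a e) := fun e =>
      htu (Perm.setoid_le_iff.1 le_sup_left e)
    have hαu : ∀ e, u e (spliceRev α a b e) := fun e =>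
      htu (Perm.setoid_le_iff.1 le_sup_right e)
    have huab : u a b := by
      have h3 := hαu (α a)
      rw [hα', if_neg (by tauto), if_pos rfl] at h3
      exact u.trans' hua (u.trans' h3 (u.symm' hub))
    have h3 : Nat.card (Quotient u) ≤ _ := Setoid.card_quotient_le
      (r := Perm.SameCycle.setoid σ ⊔ Perm.SameCycle.setoid α) (s := u) (by
        refine sup_le (Perm.setoid_le_iff.2 fun e => ?_) (Perm.setoid_le_iff.2 fun e => ?_)
        · have h4 := hσu e
          rw [hσ'] at h4
          split_ifs at h4 with h5
          · rcases h5 with rfl | rfl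
            · rw [hσa]; exact huab
            · rw [hσb]; exact u.symm' huab
          · exact h4
        · have h4 := hαu e
          rw [hα'] at h4
          split_ifs at h4 with h5 h6 h7
          · rcases h5 with rfl | rfl
            · exact hua
            · exact hub
          · rw [h6, hinv]; exact u.symm' hua
          · rw [h7, hinv]; exact u.symm' hub
          · exact h4)
    omega
  unfold Perm.Spherical at *
  rw [hφ]
  have c4' : Perm.cycleCount (spliceRev α a b) + 1 = _ := c4
  omega

end Valid

end NetworkData

namespace NetworkData

variable {p : ℕ} {D X : Type*} {M : NetworkData p D X} [Fintype D] [DecidableEq D] [DecidableEq X]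
  {L : ℕ} {σ α : Perm D} {n l : D → ℕ} {S : D → Finset (ZMod p)}

theorem neg_ne_self_of_ne_zero [Fact p.Prime] (hp2 : p ≠ 2) {t : ZMod p} (ht : t ≠ 0) : -t ≠ t := by
  intro h
  have h1 : (2 : ZMod p) * t = 0 := by linear_combination -h
  rcases mul_eq_zero.1 h1 with h2 | h2
  · have h3 : ((2 : ℕ) : ZMod p) = 0 := by exact_mod_cast h2
    rw [ZMod.natCast_eq_zero_iff] at h3
    exact hp2 ((Nat.prime_dvd_prime_iff_eq Fact.out Nat.prime_two).1 h3)
  · exact ht h2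

open scoped Pointwise in
/-- The color differences available along a path of two edges through a node of degree two. -/
theorem exists_splice_set [Fact p.Prime] (hp2 : p ≠ 2) {a b : D} (hab : a ≠ b)
    (hnode : M.node a = M.node b) (A B : Finset (ZMod p)) {k m : ℕ} (hA : k < A.card)
    (hB : m < B.card) (hkm : k + m + M.weight (M.node a) < p) :
    ∃ T : Finset (ZMod p), k + m + M.weight (M.node a) < T.card ∧ ∀ t ∈ T,
      ∃ u ∈ A, ∃ v ∈ B, ∃ ε : ℤˣ, t = u + ((ε : ℤ) : ZMod p) * (M.pos b - M.pos a) + v := by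
  have hp : p.Prime := Fact.out
  -- `P` collects what passing through the node contributes: the two signs of a hub give two
  -- opposite nonzero values, distinct because `p` is odd; a vertex gives `0` only.
  obtain ⟨P, hP, hPm⟩ : ∃ P : Finset (ZMod p), P.card = M.weight (M.node a) + 1 ∧
      ∀ w ∈ P, ∃ ε : ℤˣ, w = ((ε : ℤ) : ZMod p) * (M.pos b - M.pos a) := by
    rcases Nat.le_one_iff_eq_zero_or_eq_one.1 (M.weight_le_one (M.node a)) with h0 | h1
    · refine ⟨{0}, by simp [h0], fun w hw => ⟨1, ?_⟩⟩
      rw [M.pos_eq_zero a h0, M.pos_eq_zero b (hnode ▸ h0)]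
      simpa using hw
    · have hne : M.pos b - M.pos a ≠ 0 := sub_ne_zero.2 (M.pos_ne a b hab hnode h1).symm
      refine ⟨{M.pos b - M.pos a, -(M.pos b - M.pos a)}, ?_, ?_⟩
      · rw [Finset.card_pair (neg_ne_self_of_ne_zero hp2 hne).symm, h1]
      · intro w hw
        rcases Finset.mem_insert.1 hw with rfl | hw
        · exact ⟨1, by simp⟩
        · exact ⟨-1, by rw [Finset.mem_singleton.1 hw]; simp⟩
  have hAne : A.Nonempty := Finset.card_pos.1 (by omega)
  have hBne : B.Nonempty := Finset.card_pos.1 (by omega)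
  have hPne : P.Nonempty := Finset.card_pos.1 (by omega)
  refine ⟨A + P + B, ?_, ?_⟩
  -- The minimum with `p` in the Cauchy-Davenport bound is harmless, because `hkm` keeps the
  -- required size at most `p`.
  · have h1 := ZMod.cauchy_davenport hp hAne hPne
    have h2 := ZMod.cauchy_davenport hp (hAne.add hPne) hBne
    rw [min_le_iff] at h1 h2
    omega
  · intro t ht
    obtain ⟨y, hy, v, hv, rfl⟩ := Finset.mem_add.1 ht
    obtain ⟨u, hu, w, hw, rfl⟩ := Finset.mem_add.1 hy
    obtain ⟨ε, rfl⟩ := hPm w hw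
    exact ⟨u, hu, v, hv, ε, rfl⟩

namespace Valid

/-- Suppressing a node of degree two. -/
theorem splice [Fact p.Prime] (h : M.Valid L σ α n l S) (hp2 : p ≠ 2) (hL : 2 * p * p ≤ L + p)
    {a b : D} (hab : a ≠ b) (ha : α a ≠ a) (hb : α b ≠ b) (hnode : M.node a = M.node b)
    (honly : ∀ d, α d ≠ d → M.node d = M.node a → d = a ∨ d = b)
    (hn : n a + n b + M.weight (M.node a) < p) :
    ∃ (σ' α' : Perm D) (n' l' : D → ℕ) (S' : D → Finset (ZMod p)), M.Valid L σ' α' n' l' S' ∧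
      (∀ d, α' d ≠ d → α d ≠ d ∧ d ≠ a) ∧
      ∀ g, M.Colors α' S' g → ∃ q, M.Colors α S (Function.update g (M.node a) q) := by
  have hinv := h.invol
  have hnea := h.node_ne hL ha
  have hneb := h.node_ne hL hb
  have hab' : α a ≠ b := fun h' => hnea (by rw [h', hnode])
  have hba' : α b ≠ a := fun h => hab' (by rw [← h, hinv])
  have hne : α a ≠ α b := fun h => hab (α.injective h)
  -- The rotation exchanges `a` and `b`, as they are the only live darts at the node and lie on one
  -- cycle.
  have hσa : σ a = b := by
    rcases honly (σ a) (h.live_rot ha) (h.node_rot a) with h1 | h1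
    · exact absurd ((h.sameCycle a b ha hb hnode).eq_of_left h1) hab
    · exact h1
  have hσb : σ b = a := by
    rcases honly (σ b) (h.live_rot hb) ((h.node_rot b).trans hnode.symm) with h1 | h1
    · exact h1
    · exact absurd ((h.sameCycle a b ha hb hnode).eq_of_right h1) hab
  have hσ' : ∀ e, Perm.remove σ a e = if e = a ∨ e = b then e else σ e := by
    intro e
    rcases eq_or_ne e a with rfl | h1
    · rw [Perm.remove_apply_self]; simp
    rcases eq_or_ne e b with rfl | h2
    · rw [Perm.remove_apply_of_apply_eq h1 hσb, hσa]; simp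
    · rw [Perm.remove_apply_of_ne h1, if_neg (by tauto)]
      intro h3; exact h2 (σ.injective (h3.trans hσb.symm))
  have hα' := spliceRev_apply hinv hab ha hb hab'
  set α' := spliceRev α a b with hα'def
  have hα'a : α' a = a := by rw [hα', if_pos (by tauto)]
  have hα'b : α' b = b := by rw [hα', if_pos (by tauto)]
  have hα'ra : α' (α a) = α b := by rw [hα', if_neg (by tauto), if_pos rfl]
  have hα'rb : α' (α b) = α a := by
    rw [hα', if_neg (by tauto), if_neg hne.symm, if_pos rfl]
  have hα'o : ∀ e, e ≠ a → e ≠ b → e ≠ α a → e ≠ α b → α' e = α e := by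
    intro e h1 h2 h3 h4
    rw [hα', if_neg (by tauto), if_neg h3, if_neg h4]
  have hlive : ∀ e, α' e ≠ e → e ≠ a ∧ e ≠ b ∧ α e ≠ e := by
    intro e he
    refine ⟨fun h1 => he (by rw [h1, hα'a]), fun h1 => he (by rw [h1, hα'b]), fun h1 => ?_⟩
    by_cases h2 : e = α a
    · rw [h2, hinv] at h1; exact ha h1.symm
    by_cases h3 : e = α b
    · rw [h3, hinv] at h1; exact hb h1.symm
    exact he (by
      rw [hα'o e (fun h1 => he (by rw [h1, hα'a])) (fun h1 => he (by rw [h1, hα'b])) h2 h3,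
      h1])
  have hSa : n (α a) < (S (α a)).card := h.S_card _ (h.live_symm ha)
  rw [h.n_symm a ha] at hSa
  -- The path is traversed from `α a` through the node to the far end of `b`, hence the sets `S (α
  -- a)` and `S b`.
  obtain ⟨T, hTc, hT⟩ := exists_splice_set (M := M) hp2 hab hnode (S (α a)) (S b) hSa
    (h.S_card b hb) hn
  have hcorner : M.corner a b + M.corner b a ≤ p * M.weight (M.node a) := by
    have h1 := h.corner_sum (M.node a)
    have h2 : M.liveAt α (M.node a) = {a, b} := by
      ext e
      simp only [mem_liveAt, Finset.mem_insert, Finset.mem_singleton]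
      constructor
      · rintro ⟨h3, h4⟩; exact honly e h3 h4
      · rintro (rfl | rfl)
        · exact ⟨ha, rfl⟩
        · exact ⟨hb, hnode.symm⟩
    rwa [h2, Finset.sum_pair hab, hσa, hσb] at h1
  let n' : D → ℕ := fun d => if d = α a ∨ d = α b then n a + n b + M.weight (M.node a) else n d
  let l' : D → ℕ := fun d => if d = α a then l (α a) + M.corner a b + l b
    else if d = α b then l (α b) + M.corner b a + l a else l d
  let S' : D → Finset (ZMod p) := fun d => if d = α a then T
    else if d = α b then T.image Neg.neg else S d
  have hn'a : n' (α a) = n a + n b + M.weight (M.node a) := if_pos (Or.inl rfl)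
  have hn'b : n' (α b) = n a + n b + M.weight (M.node a) := if_pos (Or.inr rfl)
  have hl'a : l' (α a) = l (α a) + M.corner a b + l b := if_pos rfl
  have hl'b : l' (α b) = l (α b) + M.corner b a + l a := by
    simp only [l', if_neg hne.symm, if_true]
  have hS'a : S' (α a) = T := if_pos rfl
  have hS'b : S' (α b) = T.image Neg.neg := by
    simp only [S', if_neg hne.symm, if_true]
  have hcases : ∀ e, α' e ≠ e → e = α a ∨ e = α b ∨
      (e ≠ α a ∧ e ≠ α b ∧ α e ≠ e ∧ α' e = α e ∧ α e ≠ α a ∧ α e ≠ α b ∧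
        n' e = n e ∧ n' (α e) = n (α e) ∧ l' e = l e ∧ l' (α e) = l (α e) ∧
        S' e = S e ∧ S' (α e) = S (α e)) := by
    intro e he
    obtain ⟨h1, h2, h3⟩ := hlive e he
    by_cases h4 : e = α a
    · exact Or.inl h4
    by_cases h5 : e = α b
    · exact Or.inr (Or.inl h5)
    have h6 : α e ≠ α a := fun h => h1 (α.injective h)
    have h7 : α e ≠ α b := fun h => h2 (α.injective h)
    refine Or.inr (Or.inr ⟨h4, h5, h3, hα'o e h1 h2 h4 h5, h6, h7, ?_, ?_, ?_, ?_, ?_, ?_⟩) <;>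
      simp [n', l', S', h4, h5, h6, h7]
  refine ⟨Perm.remove σ a, α', n', l', S', ?_, fun d hd => ⟨(hlive d hd).2.2, (hlive d hd).1⟩, ?_⟩
  · refine ⟨?_, ?_, ?_, ?_, ?_, ?_, ?_, ?_, ?_, ?_, ?_, ?_⟩
    · intro e
      by_cases he : α' e = e
      · rw [he, he]
      rcases hcases e he with rfl | rfl | ⟨h1, h2, h3, h4, h5, h6, -⟩
      · rw [hα'ra, hα'rb]
      · rw [hα'rb, hα'ra]
      · rw [h4, hα'o, hinv]
        · intro h7; exact h1 (by rw [← h7, hinv])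
        · intro h7; exact h2 (by rw [← h7, hinv])
        · exact h5
        · exact h6
    · intro e
      rw [hσ']
      split_ifs
      · rfl
      · exact h.node_rot e
    · intro e he
      rw [hσ']
      split_ifs with h1
      · rfl
      · apply h.fixed
        by_contra h2
        by_cases h3 : e = α a
        · rw [h3, hα'ra] at he; exact hne he.symm
        by_cases h4 : e = α b
        · rw [h4, hα'rb] at he; exact hne he
        exact h2 ((hα'o e (by tauto) (by tauto) h3 h4).symm.trans he)
    · intro d e hd he hde
      exact Perm.sameCycle_remove (hlive d hd).1 (hlive e he).1
        (h.sameCycle d e (hlive d hd).2.2 (hlive e he).2.2 hde)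
    · exact spherical_splice h.spherical hinv hab ha hb hab' hσa hσb
    · intro e he
      rcases hcases e he with rfl | rfl | ⟨h1, h2, h3, h4, h5, h6, h7, h8, -⟩
      · rw [hα'ra, hn'a, hn'b]
      · rw [hα'rb, hn'a, hn'b]
      · rw [h4, h8, h7, h.n_symm e h3]
    · intro e he
      rcases hcases e he with rfl | rfl | ⟨h1, h2, h3, h4, h5, h6, h7, h8, -⟩
      · rw [hn'a]; exact hn
      · rw [hn'b]; exact hn
      · rw [h7]; exact h.n_lt e h3
    · have hla := h.l_le a ha
      have hlb := h.l_le b hb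
      intro e he
      rcases hcases e he with rfl | rfl | ⟨h1, h2, h3, h4, h5, h6, h7, h8, h9, h10, -⟩
      · rw [hα'ra, hn'a, hl'a, hl'b]; ring_nf at *; omega
      · rw [hα'rb, hn'b, hl'a, hl'b]; ring_nf at *; omega
      · rw [h4, h9, h10, h7]; exact h.l_le e h3
    · intro e he t
      rcases hcases e he with rfl | rfl | ⟨h1, h2, h3, h4, h5, h6, h7, h8, h9, h10, h11, h12⟩
      · rw [hα'ra, hS'a, hS'b, Finset.mem_image]
        constructor
        · rintro ⟨u, hu, rfl⟩; simpa using hu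
        · intro ht; exact ⟨-t, ht, neg_neg t⟩
      · rw [hα'rb, hS'a, hS'b, Finset.mem_image]
        constructor
        · intro ht; exact ⟨t, ht, rfl⟩
        · rintro ⟨u, hu, hut⟩; rw [neg_inj] at hut; rwa [← hut]
      · rw [h4, h12, h11]; exact h.S_symm e h3 t
    · intro e he
      rcases hcases e he with rfl | rfl | ⟨h1, h2, h3, h4, h5, h6, h7, h8, h9, h10, h11, h12⟩
      · rw [hn'a, hS'a]; exact hTc
      · rw [hn'b, hS'b, Finset.card_image_of_injective _ neg_injective]; exact hTc
      · rw [h7, h11]; exact h.S_card e h3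
    · intro x
      by_cases hx : x = M.node a
      · subst hx
        have h2 : M.liveAt α' (M.node a) = ∅ := by
          rw [Finset.eq_empty_iff_forall_notMem]
          intro e he
          rw [mem_liveAt] at he
          obtain ⟨h1, h2, h3⟩ := hlive e he.1
          exact (honly e h3 he.2).elim h1 h2
        simp [h2]
      · refine le_trans (le_trans (Finset.sum_congr rfl fun e he => ?_).le
          (Finset.sum_le_sum_of_subset (t := M.liveAt α x)
            (f := fun e => M.corner e (σ e)) ?_)) (h.corner_sum x)
        · rw [mem_liveAt] at he
          rw [hσ', if_neg]
          have := hlive e he.1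
          tauto
        · intro e he
          rw [mem_liveAt] at he ⊢
          exact ⟨(hlive e he.1).2.2, he.2⟩
    -- The new edge stands for a path of two old edges, so a run ending with it ends in the old
    -- network with the second of them.
    · set lst : D → D := fun f => if f = α a then b else if f = α b then a else f with hlst
      have hlsta : lst (α a) = b := if_pos rfl
      have hlstb : lst (α b) = a := by simp only [hlst, if_neg hne.symm, if_true]
      have hrun : ∀ d f m, M.Run α' l' d f m → M.Run α l d (lst f) m := by
        intro d f m hr
        induction hr with
        | single d hd =>
          rcases hcases d hd with rfl | rfl | ⟨h1, h2, h3, h4, h5, h6, h7, h8, h9, h10, -⟩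
          · rw [hl'a, hlsta]
            have := Run.cons (M := M) (α a) b b (l b) (h.live_symm ha) (by rw [hinv, hnode])
              (by rw [hinv]; exact hab.symm) (Run.single (l := l) b hb)
            rwa [hinv] at this
          · rw [hl'b, hlstb]
            have := Run.cons (M := M) (α b) a a (l a) (h.live_symm hb) (by rw [hinv, hnode])
              (by rw [hinv]; exact hab) (Run.single (l := l) a ha)
            rwa [hinv] at this
          · rw [h9]
            simp only [hlst, if_neg h1, if_neg h2]
            exact Run.single d h3
        | cons d e f m hd hnd he _ ih =>
          rcases hcases d hd with rfl | rfl | ⟨h1, h2, h3, h4, h5, h6, h7, h8, h9, h10, -⟩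
          · rw [hα'ra] at hnd he ⊢
            rw [hl'a]
            have := Run.cons (M := M) (α a) b (lst f) _ (h.live_symm ha) (by rw [hinv, hnode])
              (by rw [hinv]; exact hab.symm) (Run.cons b e (lst f) m hb hnd he ih)
            rw [hinv] at this
            convert this using 1
            ring
          · rw [hα'rb] at hnd he ⊢
            rw [hl'b]
            have := Run.cons (M := M) (α b) a (lst f) _ (h.live_symm hb) (by rw [hinv, hnode])
              (by rw [hinv]; exact hab) (Run.cons a e (lst f) m ha hnd he ih)
            rw [hinv] at this
            convert this using 1
            ring
          · rw [h4] at hnd he ⊢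
            rw [h9]
            exact Run.cons d e (lst f) m h3 hnd he ih
      intro d f m hr hnd hd
      have hf : α' f ≠ f := by
        clear hnd hd
        induction hr with
        | single a ha => exact ha
        | cons _ _ _ _ _ _ _ _ ih => exact ih
      have hlf : α (lst f) = α' f := by
        rcases hcases f hf with rfl | rfl | ⟨h1, h2, h3, h4, -⟩
        · rw [hlsta, hα'ra]
        · rw [hlstb, hα'rb]
        · simp only [hlst, if_neg h1, if_neg h2, h4]
      rw [← hlf] at hnd hd ⊢
      exact h.run_le d (lst f) m (hrun d f m hr) hnd hd
  · intro g hg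
    have h1 := hg (α a) (by rw [hα'ra]; exact hne.symm)
    rw [hα'ra, hS'a] at h1
    obtain ⟨u, hu, v, hv, ε, huv⟩ := hT _ h1
    have hna : M.node (α a) ≠ M.node a := hnea
    have hnb : M.node (α b) ≠ M.node a := by rw [hnode]; exact hneb
    -- The sign comes from the decomposition of the color difference; the shift makes the node show
    -- at `a` the color read at `α a` plus `u`.
    refine ⟨(M.read g (α a) + u - ((ε : ℤ) : ZMod p) * M.pos a, ε), ?_⟩
    set g' := Function.update g (M.node a)
      (M.read g (α a) + u - ((ε : ℤ) : ZMod p) * M.pos a, ε) with hg'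
    have hread : ∀ e, M.node e ≠ M.node a → M.read g' e = M.read g e := by
      intro e he
      simp only [read, hg', Function.update_of_ne he]
    have hra : M.read g' a = M.read g (α a) + u := by
      simp [read, hg']
    have hrb : M.read g' b = M.read g (α b) - v := by
      simp only [read, hg', ← hnode, Function.update_self]
      rw [sub_eq_iff_eq_add] at huv
      simp only [read] at huv ⊢
      rw [huv]
      ring
    have key : ∀ e, α e ≠ e → (M.read g' (α e) - M.read g' e ∈ S e ↔
        M.read g' e - M.read g' (α e) ∈ S (α e)) := by
      intro e he
      rw [h.S_symm e he, neg_sub]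
    have hca : M.read g' a - M.read g' (α a) ∈ S (α a) := by
      rw [hra, hread _ hna]; simpa using hu
    have hcb : M.read g' (α b) - M.read g' b ∈ S b := by
      rw [hrb, hread _ hnb]; simpa using hv
    intro e he
    rcases eq_or_ne e a with rfl | h2
    · exact (key _ he).2 hca
    rcases eq_or_ne e b with rfl | h3
    · exact hcb
    rcases eq_or_ne e (α a) with rfl | h4
    · rw [hinv]; exact hca
    rcases eq_or_ne e (α b) with rfl | h5
    · have := (key b hb).1 hcb
      rw [hinv]; exact this
    have h6 := hα'o e h2 h3 h4 h5
    have h7 : α' e ≠ e := by rwa [h6]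
    have h8 := hg e h7
    have hn1 : M.node e ≠ M.node a := fun h9 => (honly e he h9).elim h2 h3
    have hn2 : M.node (α e) ≠ M.node a := fun h9 => by
      rcases honly (α e) (h.live_symm he) h9 with h10 | h10
      · exact h4 (by rw [← h10, hinv])
      · exact h5 (by rw [← h10, hinv])
    rw [hread _ hn1, hread _ hn2, ← h6]
    rcases hcases e h7 with h9 | h9 | ⟨-, -, -, -, -, -, -, -, -, -, h11, -⟩
    · exact absurd h9 h4
    · exact absurd h9 h5
    · rwa [h11] at h8

end Valid

end NetworkData

/-! ### Face lengths, Euler's formula and the existence of a reducible node. -/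

namespace Equiv.Perm

/-- If the total weight of every cycle inside `A` is at least `K`, then there are few cycles. -/
theorem mul_cycleCount_le {D : Type*} [Fintype D] [DecidableEq D] (f : Perm D) (A : Finset D)
    (w : D → ℕ) (K : ℕ)
    (hK : ∀ d ∈ A, ∃ B ⊆ A, (∀ e ∈ B, SameCycle f d e) ∧ K ≤ ∑ e ∈ B, w e) :
    K * cycleCount f ≤ K * Aᶜ.card + ∑ e ∈ A, w e := by
  classical
  have : Fintype (Quotient (SameCycle.setoid f)) := Fintype.ofFinite _
  let mk : D → Quotient (SameCycle.setoid f) := Quotient.mk _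
  have hsplit := Finset.card_filter_add_card_filter_not
    (s := (Finset.univ : Finset (Quotient (SameCycle.setoid f)))) (fun q => q.out ∈ A)
  have h1 : (Finset.univ.filter fun q : Quotient (SameCycle.setoid f) => ¬ q.out ∈ A).card ≤
      Aᶜ.card := by
    apply Finset.card_le_card_of_injOn Quotient.out
    · intro q hq; simpa using hq
    · intro q _ q' _ h; exact Quotient.out_injective h
  have h2 : K * (Finset.univ.filter fun q : Quotient (SameCycle.setoid f) => q.out ∈ A).card ≤
      ∑ e ∈ A, w e := by
    calc K * (Finset.univ.filter fun q : Quotient (SameCycle.setoid f) => q.out ∈ A).card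
        = ∑ q ∈ Finset.univ.filter (fun q : Quotient (SameCycle.setoid f) => q.out ∈ A), K := by
          rw [Finset.sum_const, smul_eq_mul, mul_comm]
      _ ≤ ∑ q ∈ Finset.univ.filter (fun q : Quotient (SameCycle.setoid f) => q.out ∈ A),
            ∑ e ∈ A with mk e = q, w e := by
          apply Finset.sum_le_sum
          intro q hq
          obtain ⟨B, hB, hBs, hBK⟩ := hK q.out (Finset.mem_filter.1 hq).2
          refine hBK.trans (Finset.sum_le_sum_of_subset fun e he => Finset.mem_filter.2 ⟨hB he, ?_⟩)
          rw [← q.out_eq]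
          exact Quotient.sound (hBs e he).symm
      _ ≤ ∑ q, ∑ e ∈ A with mk e = q, w e :=
          Finset.sum_le_sum_of_subset (Finset.filter_subset _ _)
      _ = ∑ e ∈ A, w e := Finset.sum_fiberwise _ _ _
  have h3 : cycleCount f = (Finset.univ : Finset (Quotient (SameCycle.setoid f))).card := by
    rw [cycleCount, Nat.card_eq_fintype_card, Finset.card_univ]
  rw [h3, ← hsplit, mul_add, add_comm]
  exact add_le_add (Nat.mul_le_mul_left _ h1) h2

theorem card_le_orbitCount {D Y : Type*} [Finite D] (f g : Perm D) (φ : D → Y)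
    (hf : ∀ d, φ (f d) = φ d) (hg : ∀ d, φ (g d) = φ d) (hsurj : Function.Surjective φ) :
    Nat.card Y ≤ orbitCount f g := by
  have hle : SameCycle.setoid f ⊔ SameCycle.setoid g ≤ Setoid.ker φ :=
    sup_le (setoid_le_iff.2 fun a => (hf a).symm) (setoid_le_iff.2 fun a => (hg a).symm)
  refine Nat.card_le_card_of_surjective (Quotient.lift φ fun a b h => hle h) fun x => ?_
  obtain ⟨d, rfl⟩ := hsurj x
  exact ⟨⟦d⟧, rfl⟩

end Equiv.Perm

namespace NetworkData

variable {p : ℕ} {D X : Type*} {M : NetworkData p D X} [Fintype D] [DecidableEq D] [DecidableEq X]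
  {L : ℕ} {σ α : Perm D} {n l : D → ℕ} {S : D → Finset (ZMod p)}

namespace Valid

/-- The total length of a facial walk. -/
theorem le_sum_face (h : M.Valid L σ α n l S) (hdeg : ∀ d, α d ≠ d → σ d ≠ d) {d : D}
    (hd : α d ≠ d) : ∃ B : Finset D, (∀ e ∈ B, α e ≠ e) ∧ (∀ e ∈ B, (σ * α).SameCycle d e) ∧
      L ≤ ∑ e ∈ B, (l e + M.corner (α e) (σ (α e))) := by
  set φ := σ * α with hφ
  set W : D → ℕ := fun e => l e + M.corner (α e) (σ (α e)) with hW
  have hex : ∃ m, 0 < m ∧ (φ ^ m) d = d := ⟨orderOf φ, orderOf_pos φ, by simp [pow_orderOf_eq_one]⟩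
  obtain ⟨m, ⟨hm, hmd⟩, hmin⟩ : ∃ m, (0 < m ∧ (φ ^ m) d = d) ∧
      ∀ k < m, ¬ (0 < k ∧ (φ ^ k) d = d) :=
    ⟨Nat.find hex, Nat.find_spec hex, fun k hk => Nat.find_min hex hk⟩
  have hlive : ∀ i, α ((φ ^ i) d) ≠ (φ ^ i) d := by
    intro i
    induction i with
    | zero => exact hd
    | succ i ih =>
      rw [pow_succ', Perm.mul_apply]
      exact h.live_rot (h.live_symm ih)
  -- Runs grow at the front, so the facial walk is built backwards from its last dart.
  have hrun : ∀ j, j < m → ∃ N, M.Run α l ((φ ^ (m - 1 - j)) d) ((φ ^ (m - 1)) d) N ∧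
      N + M.corner (α ((φ ^ (m - 1)) d)) (σ (α ((φ ^ (m - 1)) d))) =
        ∑ i ∈ Finset.Ico (m - 1 - j) m, W ((φ ^ i) d) := by
    intro j
    induction j with
    | zero =>
      intro _
      refine ⟨_, Run.single _ (hlive _), ?_⟩
      rw [Nat.sub_zero, Nat.Ico_pred_singleton hm, Finset.sum_singleton]
    | succ j ih =>
      intro hj
      obtain ⟨N, hN, hsum⟩ := ih (by omega)
      have h1 : m - 1 - j = m - 1 - (j + 1) + 1 := by omega
      have h2 : (φ ^ (m - 1 - j)) d = σ (α ((φ ^ (m - 1 - (j + 1))) d)) := by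
        rw [h1, pow_succ', Perm.mul_apply]; rfl
      refine ⟨_, Run.cons _ _ _ N (hlive _) ?_ ?_ hN, ?_⟩
      · rw [h2, h.node_rot]
      · rw [h2]; exact hdeg _ (h.live_symm (hlive _))
      · rw [Finset.sum_eq_sum_Ico_succ_bot (by omega : m - 1 - (j + 1) < m), ← h1, ← hsum, h2]
        simp only [hW]
        ring
  obtain ⟨N, hN, hsum⟩ := hrun (m - 1) (by omega)
  rw [Nat.sub_self, pow_zero, Perm.one_apply] at hN
  rw [Nat.sub_self] at hsum
  have hlast : σ (α ((φ ^ (m - 1)) d)) = d := by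
    rw [← Perm.mul_apply, ← hφ, ← Perm.mul_apply, ← pow_succ', Nat.sub_add_cancel hm, hmd]
  -- The closing turn is no reversal, because `hdeg` excludes nodes of degree one.
  have hle := h.run_le d _ N hN (by rw [← h.node_rot, hlast]) (fun h1 => by
    have h2 := hdeg _ (h.live_symm (hlive (m - 1)))
    rw [hlast] at h2
    exact h2 h1)
  rw [hlast] at hsum
  rw [hsum] at hle
  have hinj : Set.InjOn (fun i => (φ ^ i) d) (Finset.Ico 0 m : Finset ℕ) := by
    have key : ∀ i j, i < j → j < m → (φ ^ i) d ≠ (φ ^ j) d := by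
      intro i j hij hj he
      refine hmin (j - i) (by omega) ⟨by omega, ?_⟩
      apply (φ ^ i).injective
      rw [← Perm.mul_apply, ← pow_add, he]
      congr 2
      omega
    intro i hi j hj hij
    simp only [Finset.coe_Ico, Set.mem_Ico] at hi hj
    rcases lt_trichotomy i j with h1 | h1 | h1
    · exact absurd hij (key i j h1 hj.2)
    · exact h1
    · exact absurd hij.symm (key j i h1 hi.2)
  refine ⟨(Finset.Ico 0 m).image fun i => (φ ^ i) d, ?_, ?_, ?_⟩
  · intro e he
    obtain ⟨i, -, rfl⟩ := Finset.mem_image.1 he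
    exact hlive i
  · intro e he
    obtain ⟨i, -, rfl⟩ := Finset.mem_image.1 he
    exact ⟨i, by simp⟩
  · rw [Finset.sum_image hinj]
    exact hle

set_option maxHeartbeats 800000 in
/-- Some node other than `r` is loosely constrained. -/
theorem exists_reducible (h : M.Valid L σ α n l S) (hp : 2 ≤ p) (hL : 2 * p * p ≤ L + p) (r : X)
    (hr : (M.liveAt α r).card ≠ 1) (hlive : ∃ d, α d ≠ d) :
    ∃ x ≠ r, (M.liveAt α x).Nonempty ∧
      (∑ d ∈ M.liveAt α x, (p - 1 - n d) < p ∨ (M.liveAt α x).card = 2) := by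
  by_contra! hno
  set A : Finset D := {d | α d ≠ d} with hA
  have hAm : ∀ d, d ∈ A ↔ α d ≠ d := fun d => by simp [hA]
  set N : Finset X := A.image M.node with hN
  have hfib : ∀ x, A.filter (fun d => M.node d = x) = M.liveAt α x := by
    intro x; ext d; simp [hA]
  have hmaps : ∀ d ∈ A, M.node d ∈ N := fun d hd => Finset.mem_image_of_mem _ hd
  have hbound : ∀ x, ∑ d ∈ M.liveAt α x, (p - 1 - n d) + ∑ d ∈ M.liveAt α x, n d =
      (M.liveAt α x).card * (p - 1) := by
    intro x
    rw [← Finset.sum_add_distrib, ← smul_eq_mul, ← Finset.sum_const]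
    refine Finset.sum_congr rfl fun d hd => ?_
    have := h.n_lt d (mem_liveAt.1 hd).1
    omega
  have hne : ∀ x ∈ N, (M.liveAt α x).Nonempty := by
    intro x hx
    obtain ⟨d, hd, rfl⟩ := Finset.mem_image.1 hx
    exact ⟨d, mem_liveAt.2 ⟨(hAm d).1 hd, rfl⟩⟩
  have hdeg3 : ∀ x ∈ N, x ≠ r → 3 ≤ (M.liveAt α x).card := by
    intro x hx hxr
    obtain ⟨h1, h2⟩ := hno x hxr (hne x hx)
    have h3 := (hne x hx).card_pos
    -- A single edge misses at most `p - 1` degrees of freedom, so a node of degree one would be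
    -- flexible.
    have h4 : (M.liveAt α x).card ≠ 1 := by
      intro h5
      have h6 := hbound x
      rw [h5] at h6
      omega
    omega
  have hdeg : ∀ d, α d ≠ d → σ d ≠ d := by
    intro d hd hσ
    have h1 : M.liveAt α (M.node d) = {d} := by
      ext e
      simp only [mem_liveAt, Finset.mem_singleton]
      constructor
      · rintro ⟨he, hne⟩
        exact ((h.sameCycle d e hd he hne.symm).eq_of_left hσ).symm
      · rintro rfl; exact ⟨hd, rfl⟩
    by_cases hxr : M.node d = r
    · rw [hxr] at h1; exact hr (by rw [h1, Finset.card_singleton])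
    · have := hdeg3 _ (hmaps d ((hAm d).2 hd)) hxr
      rw [h1, Finset.card_singleton] at this
      omega
  -- counts of vertices, edges, faces and components
  have hDcard : Nat.card D = Aᶜ.card + A.card := by
    rw [Nat.card_eq_fintype_card, Finset.card_compl]
    have := Finset.card_le_univ A
    omega
  have hV : Perm.cycleCount σ ≤ Aᶜ.card + N.card := by
    have h1 := Perm.cycleCount_le_card (X := {d // d ∈ Aᶜ} ⊕ {x // x ∈ N}) σ
      (fun d => if hd : d ∈ A then Sum.inr ⟨M.node d, hmaps d hd⟩
        else Sum.inl ⟨d, Finset.mem_compl.2 hd⟩) (by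
        intro d e hde
        by_cases hd : d ∈ A <;> by_cases he : e ∈ A
        · simp only [hd, he, dif_pos, Sum.inr.injEq, Subtype.mk.injEq] at hde
          exact h.sameCycle d e ((hAm d).1 hd) ((hAm e).1 he) hde
        · simp [hd, he] at hde
        · simp [hd, he] at hde
        · simp only [hd, he, dif_neg, not_false_eq_true, Sum.inl.injEq, Subtype.mk.injEq] at hde
          exact hde.sameCycle σ)
    rwa [Nat.card_sum, Nat.card_eq_fintype_card, Nat.card_eq_fintype_card, Fintype.card_coe,
      Fintype.card_coe] at h1
  have hE : 2 * Perm.cycleCount α ≤ 2 * Aᶜ.card + A.card := by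
    have := Perm.mul_cycleCount_le α A (fun _ => 1) 2 (by
      intro d hd
      have hd' := (hAm d).1 hd
      refine ⟨{d, α d}, ?_, ?_, ?_⟩
      · intro e he
        rcases Finset.mem_insert.1 he with rfl | he
        · exact hd
        · rw [Finset.mem_singleton.1 he, hAm]; exact h.live_symm hd'
      · intro e he
        rcases Finset.mem_insert.1 he with rfl | he
        · exact Perm.SameCycle.refl _ _
        · rw [Finset.mem_singleton.1 he]; exact ⟨1, by simp⟩
      · rw [Finset.sum_const, Finset.card_pair hd'.symm]; rfl)
    simpa using this
  have hF : L * Perm.cycleCount (σ * α) ≤ L * Aᶜ.card +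
      ∑ e ∈ A, (l e + M.corner (α e) (σ (α e))) := by
    apply Perm.mul_cycleCount_le
    intro d hd
    obtain ⟨B, hB1, hB2, hB3⟩ := h.le_sum_face hdeg ((hAm d).1 hd)
    exact ⟨B, fun e he => (hAm e).2 (hB1 e he), hB2, hB3⟩
  -- Every dead dart is a component of its own, and the live darts make up at least one more.
  have hC : Aᶜ.card + 1 ≤ Perm.orbitCount σ α := by
    obtain ⟨d0, hd0⟩ := hlive
    have h1 := Perm.card_le_orbitCount (Y := Option {d // d ∈ Aᶜ}) σ α
      (fun d => if hd : d ∈ A then none else some ⟨d, Finset.mem_compl.2 hd⟩) ?_ ?_ ?_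
    · rwa [Finite.card_option, Nat.card_eq_fintype_card, Fintype.card_coe] at h1
    · intro d
      by_cases hd : d ∈ A
      · have : σ d ∈ A := (hAm _).2 (h.live_rot ((hAm d).1 hd))
        simp [hd, this]
      · have : σ d = d := h.fixed d (by simpa [hAm] using hd)
        simp [hd, this]
    · intro d
      by_cases hd : d ∈ A
      · have : α d ∈ A := (hAm _).2 (h.live_symm ((hAm d).1 hd))
        simp [hd, this]
      · have : α d = d := by simpa [hAm] using hd
        simp [hd, this]
    · intro y
      cases y with
      | none => exact ⟨d0, by simp [(hAm d0).2 hd0]⟩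
      | some y => exact ⟨y, by simp [Finset.mem_compl.1 y.2]⟩
  have hs := h.spherical
  unfold Perm.Spherical at hs
  -- the weights
  have hreidx : ∀ w : D → ℕ, ∑ e ∈ A, w (α e) = ∑ e ∈ A, w e := by
    intro w
    refine Finset.sum_bij' (fun e _ => α e) (fun e _ => α e) ?_ ?_ ?_ ?_ ?_
    · intro e he; exact (hAm _).2 (h.live_symm ((hAm e).1 he))
    · intro e he; exact (hAm _).2 (h.live_symm ((hAm e).1 he))
    · intro e _; exact h.invol e
    · intro e _; exact h.invol e
    · intro e _; rfl
  have hl : 2 * ∑ e ∈ A, l e ≤ p * ∑ e ∈ A, n e := by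
    have h1 : 2 * ∑ e ∈ A, l e = ∑ e ∈ A, (l e + l (α e)) := by
      rw [Finset.sum_add_distrib, hreidx l]; ring
    rw [h1, Finset.mul_sum]
    exact Finset.sum_le_sum fun e he => h.l_le e ((hAm e).1 he)
  have hcor : ∑ e ∈ A, M.corner (α e) (σ (α e)) ≤ p * N.card := by
    rw [hreidx (fun e => M.corner e (σ e)), ← Finset.sum_fiberwise_of_maps_to hmaps]
    calc _ ≤ ∑ x ∈ N, p := by
          apply Finset.sum_le_sum
          intro x _
          rw [hfib]
          refine (h.corner_sum x).trans ?_
          exact (Nat.mul_le_mul_left p (M.weight_le_one x)).trans (by simp)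
      _ = _ := by rw [Finset.sum_const, smul_eq_mul, mul_comm]
  rw [Finset.sum_add_distrib] at hF
  have hAsum : A.card = ∑ x ∈ N, (M.liveAt α x).card := by
    rw [Finset.card_eq_sum_card_fiberwise hmaps]
    simp_rw [hfib]
  have hnsum : ∑ e ∈ A, n e = ∑ x ∈ N, ∑ e ∈ M.liveAt α x, n e := by
    rw [← Finset.sum_fiberwise_of_maps_to hmaps]
    simp_rw [hfib]
  -- The charge of a node. Summed over all nodes, Euler's formula and the face lengths bound it
  -- above by `-4 L`. Away from `r`, the degree is `c ≥ 3` and the freedom is at most `c (p - 1) -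
  -- p`; for `L ≥ 2 p ^ 2 - p` the charge is then at least `p ^ 2 (c - 3)`. This is the source of
  -- the threshold on `L`.
  have hlocal : ∀ x ∈ N, (if x = r then -4 * (L : ℤ) + 1 else 0) ≤
      (L : ℤ) * ((M.liveAt α x).card - 2) - p * (∑ e ∈ M.liveAt α x, n e : ℕ) - 2 * p := by
    intro x hx
    have h0 := hbound x
    have hpos := (hne x hx).card_pos
    set s := ∑ d ∈ M.liveAt α x, n d with hs
    set c := (M.liveAt α x).card with hc
    set t := ∑ d ∈ M.liveAt α x, (p - 1 - n d) with ht
    have h0' : (t : ℤ) + s = c * (p - 1) := by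
      have : ((p - 1 : ℕ) : ℤ) = p - 1 := by push_cast [Nat.cast_sub (by omega : 1 ≤ p)]; ring
      rw [← this]; exact_mod_cast h0
    have hLz : 2 * (p : ℤ) * p ≤ L + p := by exact_mod_cast hL
    have hpz : (2 : ℤ) ≤ p := by exact_mod_cast hp
    split_ifs with hxr
    · have hc1 : (1 : ℤ) ≤ c := by exact_mod_cast hpos
      have ht0 : (0 : ℤ) ≤ t := by positivity
      have h1 : (p : ℤ) * s ≤ p * (c * (p - 1)) := by
        apply mul_le_mul_of_nonneg_left _ (by omega)
        linarith
      have h2 : (2 * (p : ℤ) * p - p) * (c + 2) ≤ L * (c + 2) := by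
        apply mul_le_mul_of_nonneg_right <;> linarith
      have h3 : (0 : ℤ) ≤ p * p * c := by positivity
      have h4 : (0 : ℤ) ≤ p * (p - 2) := mul_nonneg (by linarith) (by linarith)
      linarith
    · have hc3 : (3 : ℤ) ≤ c := by exact_mod_cast hdeg3 x hx hxr
      have htp : (p : ℤ) ≤ t := by exact_mod_cast (hno x hxr (hne x hx)).1
      have h1 : (p : ℤ) * s ≤ p * (c * (p - 1) - p) := by
        apply mul_le_mul_of_nonneg_left _ (by omega)
        linarith
      have h2 : (2 * (p : ℤ) * p - p) * (c - 2) ≤ L * (c - 2) := by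
        apply mul_le_mul_of_nonneg_right <;> linarith
      have h3 : (0 : ℤ) ≤ p * p * (c - 3) := mul_nonneg (by positivity) (by linarith)
      linarith
  have hsum := Finset.sum_le_sum hlocal
  rw [Finset.sum_sub_distrib, Finset.sum_sub_distrib, ← Finset.mul_sum, ← Finset.mul_sum,
    Finset.sum_sub_distrib, Finset.sum_const, Finset.sum_const, Finset.sum_ite_eq'] at hsum
  rw [← Nat.cast_sum, ← Nat.cast_sum, ← hAsum, ← hnsum] at hsum
  -- The deficit conceded to the root stays below the `4 L` contributed by the Euler characteristic
  -- of the sphere.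
  have hif : -4 * (L : ℤ) < if r ∈ N then -4 * (L : ℤ) + 1 else 0 := by
    have : 0 < L := by nlinarith
    split_ifs <;> omega
  have h5 := hif.trans_le hsum
  simp only [nsmul_eq_mul] at h5
  have hfaces : (2 * Aᶜ.card + A.card + 4 : ℤ) - 2 * N.card ≤ 2 * Perm.cycleCount (σ * α) := by
    omega
  have h6 : (L : ℤ) * ((2 * Aᶜ.card + A.card + 4 : ℤ) - 2 * N.card) ≤
      L * (2 * Perm.cycleCount (σ * α)) :=
    mul_le_mul_of_nonneg_left hfaces (by positivity)
  zify at hF hl hcor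
  rw [Nat.cast_sum] at h5
  linarith

/-! ### Coloring a network with one prescribed state. -/

variable [Fact p.Prime]

/-- The state of one node can be prescribed. -/
theorem exists_colors (h : M.Valid L σ α n l S) (hp2 : p ≠ 2) (hL : 2 * p * p ≤ L + p) (r : X)
    (q : ZMod p × ℤˣ) : ∃ g, M.Colors α S g ∧ g r = q := by
  have hp : p.Prime := Fact.out
  obtain ⟨N, hN⟩ : ∃ N, (Finset.univ.filter fun d => α d ≠ d).card = N := ⟨_, rfl⟩
  induction N using Nat.strong_induction_on generalizing σ α n l S r q with
  | _ N ih =>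
  by_cases hlive : ∃ d, α d ≠ d
  swap
  · push Not at hlive
    exact ⟨fun _ => q, fun d hd => absurd (hlive d) hd, rfl⟩
  have hlt : ∀ α' : Perm D, (∀ d, α' d ≠ d → α d ≠ d) → (∃ d, α d ≠ d ∧ α' d = d) →
      (Finset.univ.filter fun d => α' d ≠ d).card < N := by
    rintro α' h1 ⟨d, h2, h3⟩
    rw [← hN]
    apply Finset.card_lt_card
    refine Finset.ssubset_iff_of_subset (fun x hx => ?_) |>.2
      ⟨d, by simpa using h2, by simpa using h3⟩
    simp only [Finset.mem_filter, Finset.mem_univ, true_and] at hx ⊢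
    exact h1 x hx
  -- A root of degree one, at which facial walks would reverse, is cut off: its neighbour becomes
  -- the root, in a state that shows at the deleted edge a color compatible with `q`.
  by_cases hr : (M.liveAt α r).card = 1
  · obtain ⟨d, hd⟩ := Finset.card_eq_one.1 hr
    have hdm : d ∈ M.liveAt α r := by rw [hd]; exact Finset.mem_singleton_self d
    obtain ⟨hdl, hdr⟩ := mem_liveAt.1 hdm
    obtain ⟨σ', α', hv, hα'⟩ := h.exists_delete {d}
    obtain ⟨t, ht⟩ : (S d).Nonempty := Finset.card_pos.1 (by have := h.S_card d hdl; omega)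
    obtain ⟨g, hg, hgy⟩ := ih _ (hlt α' (by
        intro e he; rw [hα'] at he; split_ifs at he <;> tauto) ⟨d, hdl, by rw [hα']; simp⟩) hv
      (M.node (α d)) (q.1 + ((q.2 : ℤ) : ZMod p) * M.pos d + t - M.pos (α d), 1) rfl
    refine ⟨Function.update g r q, fun e he => ?_, Function.update_self _ _ _⟩
    have hne : M.node (α d) ≠ r := hdr ▸ h.node_ne hL hdl
    have hmem : M.read (Function.update g r q) (α d) - M.read (Function.update g r q) d ∈ S d := by
      simp only [read, Function.update_of_ne hne, hgy, hdr, Function.update_self]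
      convert ht using 1
      simp
    rcases eq_or_ne e d with rfl | hed
    · exact hmem
    by_cases hed' : α e = d
    · have h1 : e = α d := by rw [← hed', h.invol]
      rw [h1, h.S_symm d hdl, h.invol, neg_sub]
      exact hmem
    · have h1 : M.node e ≠ r := fun h2 => hed (by
        have : e ∈ M.liveAt α r := mem_liveAt.2 ⟨he, h2⟩
        rwa [hd, Finset.mem_singleton] at this)
      have h2 : M.node (α e) ≠ r := fun h2 => hed' (by
        have : α e ∈ M.liveAt α r := mem_liveAt.2 ⟨h.live_symm he, h2⟩
        rwa [hd, Finset.mem_singleton] at this)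
      have h3 : α' e = α e := by rw [hα', if_neg]; simp [hed, hed']
      have h4 := hg e (by rwa [h3])
      rw [h3] at h4
      simpa [read, Function.update_of_ne h1, Function.update_of_ne h2] using h4
  obtain ⟨x, hxr, ⟨d, hd⟩, hx⟩ := h.exists_reducible hp.two_le hL r hr hlive
  obtain ⟨hdl, hdx⟩ := mem_liveAt.1 hd
  by_cases hsum : ∑ d ∈ M.liveAt α x, (p - 1 - n d) < p
  -- A flexible node loses its edges and is colored last.
  · obtain ⟨σ', α', hv, hα'⟩ := h.exists_delete (M.liveAt α x)
    obtain ⟨g, hg, hgr⟩ := ih _ (hlt α' (by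
      intro e he; rw [hα'] at he; split_ifs at he <;> tauto)
      ⟨d, hdl, by rw [hα', if_pos (Or.inl hd)]⟩) hv r q rfl
    obtain ⟨q', hq'⟩ := h.exists_colors_update hL hsum (α' := α') (by
      intro e h1 h2
      rw [hα', if_neg]
      rintro (h3 | h3)
      · exact h1 (mem_liveAt.1 h3).2
      · exact h2 (mem_liveAt.1 h3).2) hg
    exact ⟨_, hq', by rw [Function.update_of_ne hxr.symm, hgr]⟩
  · have hcard := hx.resolve_left hsum
    obtain ⟨a, b, hab, hset⟩ := Finset.card_eq_two.1 hcard
    have ha : a ∈ M.liveAt α x := by rw [hset]; simp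
    have hb : b ∈ M.liveAt α x := by rw [hset]; simp
    obtain ⟨hal, hax⟩ := mem_liveAt.1 ha
    obtain ⟨hbl, hbx⟩ := mem_liveAt.1 hb
    rw [hset, Finset.sum_pair hab] at hsum
    have hna := h.n_lt a hal
    have hnb := h.n_lt b hbl
    have hw := M.weight_le_one (M.node a)
    -- The two edges miss at least `p` degrees of freedom, so `n a + n b ≤ p - 2`, which leaves room
    -- for the weight of the node.
    obtain ⟨σ', α', n', l', S', hv, hα', hext⟩ := h.splice hp2 hL hab hal hbl (hax.trans hbx.symm)
      (by
        intro e he hea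
        have : e ∈ M.liveAt α x := mem_liveAt.2 ⟨he, hea.trans hax⟩
        rw [hset] at this
        simpa using this) (by omega)
    obtain ⟨g, hg, hgr⟩ := ih _ (hlt α' (fun e he => (hα' e he).1)
      ⟨a, hal, by by_contra h1; exact (hα' a h1).2 rfl⟩) hv r q rfl
    obtain ⟨q', hq'⟩ := hext g hg
    refine ⟨_, hq', ?_⟩
    rw [Function.update_of_ne, hgr]
    rw [hax]; exact hxr.symm

end Valid

end NetworkData

/-! ### Rings, the cycles of length `p`. -/

namespace SimpleGraph

variable {V : Type*} {H : SimpleGraph V} {p L : ℕ}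

/-- Every cycle of `H` has length `p` or at least `L`. -/
def CyclesGood (H : SimpleGraph V) (p L : ℕ) : Prop :=
  ∀ (m : ℕ) (c : ℕ → V), 3 ≤ m → Set.InjOn c (Set.Iio m) →
    (∀ i, i + 1 < m → H.Adj (c i) (c (i + 1))) → H.Adj (c (m - 1)) (c 0) → m = p ∨ L ≤ m

/-- A cycle of length `p`, parametrized by the integers modulo `p`. -/
structure IsRing (H : SimpleGraph V) (T : ZMod p → V) : Prop where
  inj : Function.Injective T
  adj : ∀ i, H.Adj (T i) (T (i + 1))

theorem CyclesGood.mono {H' : SimpleGraph V} (h : H.CyclesGood p L) (hle : H' ≤ H) :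
    H'.CyclesGood p L :=
  fun m c hm hc hadj hlast => h m c hm hc (fun i hi => hle (hadj i hi)) (hle hlast)

namespace IsRing

theorem shift {T : ZMod p → V} (h : H.IsRing T) (a : ZMod p) : H.IsRing fun i => T (a + i) where
  inj := fun i j hij => add_left_cancel (h.inj hij)
  adj := fun i => by
    have := h.adj (a + i)
    rwa [add_assoc] at this

theorem neg {T : ZMod p → V} (h : H.IsRing T) : H.IsRing fun i => T (-i) where
  inj := fun i j hij => neg_injective (h.inj hij)
  adj := fun i => by
    have := (h.adj (-i - 1)).symm
    rw [sub_add_cancel] at this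
    rwa [neg_add, ← sub_eq_add_neg]

end IsRing

theorem natCast_inj_of_lt {p a b : ℕ} (ha : a < p) (hb : b < p) (h : (a : ZMod p) = b) : a = b := by
  rw [ZMod.natCast_eq_natCast_iff] at h
  exact h.eq_of_lt_of_lt ha hb

/-- A path outside a ring closes up to a cycle of length `p` only. -/
theorem IsRing.add_eq_of_path {T U : ZMod p → V} (hT : H.IsRing T) (hU : H.IsRing U)
    (hG : H.CyclesGood p L) (hL : 2 * p ≤ L) {a b : ZMod p} {x l : ℕ} (hx : 0 < x) (hxp : x < p)
    (hl : 0 < l) (hlp : l < p) (h0 : U a = T b) (h1 : U (a + l) = T (b + x))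
    (hint : ∀ m, 0 < m → m < l → ∀ i, U (a + (m : ℕ)) ≠ T i) (hne : ¬ (x = 1 ∧ l = 1)) :
    x + l = p := by
  have hp0 : NeZero p := ⟨by omega⟩
  -- The cycle runs `x` steps along `T` and returns along the path on `U`; being shorter than `2 p`,
  -- it has length `p`.
  have h := hG (x + l) (fun m => if m ≤ x then T (b + m) else U (a + (x + l - m : ℕ)))
    (by omega) ?_ ?_ ?_
  · omega
  · intro m hm k hk hmk
    simp only [Set.mem_Iio] at hm hk
    by_cases h2 : m ≤ x <;> by_cases h3 : k ≤ x
    · simp only [h2, h3, if_true] at hmk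
      exact natCast_inj_of_lt (by omega) (by omega) (add_left_cancel (hT.inj hmk))
    · simp only [h2, h3, if_true, if_false] at hmk
      exact absurd hmk.symm (hint _ (by omega) (by omega) _)
    · simp only [h2, h3, if_true, if_false] at hmk
      exact absurd hmk (hint _ (by omega) (by omega) _)
    · simp only [h2, h3, if_false] at hmk
      have := natCast_inj_of_lt (p := p) (by omega) (by omega) (add_left_cancel (hU.inj hmk))
      omega
  · intro m hm
    by_cases h2 : m + 1 ≤ x
    · simp only [h2, if_true, show m ≤ x by omega]
      have := hT.adj (b + m)
      push_cast
      rwa [add_assoc] at this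
    · by_cases h3 : m ≤ x
      · have h4 : m = x := by omega
        subst h4
        simp only [le_refl, if_true, h2, if_false]
        rw [← h1]
        have := (hU.adj (a + (m + l - (m + 1) : ℕ))).symm
        rw [add_assoc, ← Nat.cast_add_one, show m + l - (m + 1) + 1 = l by omega] at this
        exact this
      · simp only [h3, h2, if_false]
        have := (hU.adj (a + (x + l - (m + 1) : ℕ))).symm
        rw [add_assoc, ← Nat.cast_add_one, show x + l - (m + 1) + 1 = x + l - m by omega] at this
        exact this
  · simp only [Nat.zero_le, if_true, Nat.cast_zero, add_zero]
    rw [← h0]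
    by_cases h2 : x + l - 1 ≤ x
    · have h3 : l = 1 := by omega
      subst h3
      simp only [h2, if_true]
      rw [show x + 1 - 1 = x by omega, ← h1]
      simpa using (hU.adj a).symm
    · simp only [h2, if_false]
      rw [show x + l - (x + l - 1) = 1 by omega]
      simpa using (hU.adj a).symm

/-- Two rings with two common vertices have the same edges. -/
theorem IsRing.edge_of_two_common {T U : ZMod p → V} (hT : H.IsRing T) (hU : H.IsRing U)
    (hG : H.CyclesGood p L) (hL : 2 * p ≤ L) (hodd : Odd p) {i j : ZMod p} (hij : i ≠ j)
    (hi : U i ∈ Set.range T) (hj : U j ∈ Set.range T) (k : ZMod p) :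
    ∃ a, (U k = T a ∧ U (k + 1) = T (a + 1)) ∨ (U k = T (a + 1) ∧ U (k + 1) = T a) := by
  have hp0 : NeZero p := ⟨hodd.pos.ne'⟩
  by_contra! hno
  classical
  -- From an edge of `U` off `T`, the ring `U` is followed in both directions until it meets `T`.
  have hv : ∃ v : ℕ, U (k + 1 + v) ∈ Set.range T := ⟨(i - (k + 1)).val, by simpa using hi⟩
  have hu : ∃ u : ℕ, U (k - u) ∈ Set.range T := ⟨(k - i).val, by simpa using hi⟩
  obtain ⟨v, hv1, hv2⟩ : ∃ v : ℕ, U (k + 1 + v) ∈ Set.range T ∧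
      ∀ m < v, U (k + 1 + (m : ℕ)) ∉ Set.range T :=
    ⟨Nat.find hv, Nat.find_spec hv, fun m hm => Nat.find_min hv hm⟩
  obtain ⟨u, hu1, hu2⟩ : ∃ u : ℕ, U (k - u) ∈ Set.range T ∧
      ∀ m < u, U (k - (m : ℕ)) ∉ Set.range T :=
    ⟨Nat.find hu, Nat.find_spec hu, fun m hm => Nat.find_min hu hm⟩
  have huv : u + v + 1 < p := by
    have key : ∀ i, U i ∈ Set.range T → v ≤ (i - (k + 1)).val ∧ u + (i - (k + 1)).val + 1 ≤ p := by
      intro i hi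
      have hlt := ZMod.val_lt (i - (k + 1))
      constructor
      · by_contra! h
        exact hv2 _ h (by simpa using hi)
      · by_contra! h
        refine hu2 (p - 1 - (i - (k + 1)).val) (by omega) ?_
        have : ((p - 1 - (i - (k + 1)).val : ℕ) : ZMod p) = -1 - (i - (k + 1)) := by
          rw [Nat.cast_sub (by omega), Nat.cast_sub (by omega)]
          simp
        rw [this]
        convert hi using 2
        ring
    have hne : (i - (k + 1)).val ≠ (j - (k + 1)).val := by
      intro h
      exact hij (sub_left_injective (ZMod.val_injective p h))
    have h1 := key i hi
    have h2 := key j hj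
    omega
  obtain ⟨b, hb⟩ := hu1
  obtain ⟨b', hb'⟩ := hv1
  set l := u + v + 1 with hl
  have hend : k - (u : ℕ) + (l : ℕ) = k + 1 + (v : ℕ) := by rw [hl]; push_cast; ring
  have hbb : b' ≠ b := by
    rintro rfl
    rw [hb'] at hb
    have h1 := hU.inj hb
    rw [← hend] at h1
    have h2 : ((l : ℕ) : ZMod p) = (0 : ℕ) := by push_cast; linear_combination h1
    have := natCast_inj_of_lt (by omega) (by omega) h2
    omega
  set x := (b' - b).val with hx
  have hxp : x < p := ZMod.val_lt _
  have hx0 : 0 < x := by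
    rw [Nat.pos_iff_ne_zero]
    intro h
    exact hbb (sub_eq_zero.1 ((ZMod.val_eq_zero _).1 h))
  have hbx : b + (x : ℕ) = b' := by simp [hx]
  have hint : ∀ m, 0 < m → m < l → ∀ i, U (k - (u : ℕ) + (m : ℕ)) ≠ T i := by
    intro m hm hml i h
    by_cases h1 : m ≤ u
    · refine hu2 (u - m) (by omega) ⟨i, ?_⟩
      rw [← h, Nat.cast_sub h1]
      congr 1
      ring
    · refine hv2 (m - u - 1) (by omega) ⟨i, ?_⟩
      rw [← h, Nat.cast_sub (by omega), Nat.cast_sub (by omega)]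
      congr 1
      push_cast
      ring
  have h1 := hT.add_eq_of_path hU hG hL (a := k - (u : ℕ)) (b := b) hx0 hxp (by omega : 0 < l) huv
    hb.symm (by rw [hend, hbx, hb']) hint (by
      rintro ⟨h2, h3⟩
      have hu0 : u = 0 := by omega
      have hv0 : v = 0 := by omega
      subst hu0 hv0
      apply (hno b).1
      · simpa using hb.symm
      · rw [h2] at hbx
        simp only [Nat.cast_one] at hbx
        rw [hbx]; simpa using hb'.symm)
  -- The same path also closes up with the complementary arc of `T`. Then `x + l = p` and `p - x + l
  -- = p`, so `p = 2 x`, contrary to `p` being odd.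
  have h2 := hT.neg.add_eq_of_path hU hG hL (a := k - (u : ℕ)) (b := -b) (x := p - x)
    (by omega) (by omega) (by omega : 0 < l) huv
    (by simpa using hb.symm) (by
      rw [hend, Nat.cast_sub hxp.le, ← hb', ← hbx]
      congr 1
      simp only [CharP.cast_eq_zero]
      ring) (fun m hm hml i => hint m hm hml _) (by
      rintro ⟨h2, h3⟩
      have hu0 : u = 0 := by omega
      have hv0 : v = 0 := by omega
      subst hu0 hv0
      have hbx' : b = b' + 1 := by
        have : ((p - x : ℕ) : ZMod p) = 1 := by rw [h2]; simp
        rw [Nat.cast_sub hxp.le] at this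
        simp only [CharP.cast_eq_zero, zero_sub] at this
        rw [← hbx]
        linear_combination this
      apply (hno b').2
      · rw [← hbx']; simpa using hb.symm
      · simpa using hb'.symm)
  obtain ⟨t, ht⟩ := hodd
  omega

/-- A closed walk without immediate reversals contains a cycle. -/
theorem exists_cycle_of_closed_walk {m : ℕ} (hm : 0 < m) (x : ℕ → V × V)
    (hadj : ∀ i < m, H.Adj (x i).1 (x i).2)
    (hchain : ∀ i, i + 1 < m → (x i).2 = (x (i + 1)).1 ∧ x (i + 1) ≠ (x i).swap)
    (hclosed : (x (m - 1)).2 = (x 0).1) :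
    ∃ i k, i + k ≤ m ∧ 3 ≤ k ∧ Set.InjOn (fun j => (x (i + j)).1) (Set.Iio k) ∧
      (x (i + (k - 1))).2 = (x i).1 := by
  classical
  -- A shortest closed segment repeats no vertex; the absence of loops and reversals excludes
  -- lengths one and two.
  have hex : ∃ k, 0 < k ∧ ∃ i, i + k ≤ m ∧ (x (i + (k - 1))).2 = (x i).1 :=
    ⟨m, hm, 0, by omega, by simpa using hclosed⟩
  obtain ⟨k, ⟨hk, i, hik, he⟩, hmin⟩ : ∃ k, (0 < k ∧ ∃ i, i + k ≤ m ∧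
      (x (i + (k - 1))).2 = (x i).1) ∧
      ∀ k' < k, ¬ (0 < k' ∧ ∃ i, i + k' ≤ m ∧ (x (i + (k' - 1))).2 = (x i).1) :=
    ⟨Nat.find hex, Nat.find_spec hex, fun k' hk' => Nat.find_min hex hk'⟩
  refine ⟨i, k, hik, ?_, ?_, he⟩
  · by_contra! hk3
    have h12 : k = 1 ∨ k = 2 := by omega
    rcases h12 with rfl | rfl
    · have := hadj i (by omega)
      simp only [Nat.sub_self, add_zero] at he
      rw [he] at this
      exact H.loopless.irrefl _ this
    · have h1 := hchain i (by omega)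
      apply h1.2
      simp only [Nat.add_one_sub_one] at he
      ext
      · exact h1.1.symm
      · exact he
  · have key : ∀ a b, a < b → b < k → (x (i + a)).1 ≠ (x (i + b)).1 := by
      intro a b hab hb heq
      refine hmin (b - a) (by omega) ⟨by omega, i + a, by omega, ?_⟩
      have h1 := hchain (i + (b - 1)) (by omega)
      rw [show i + a + (b - a - 1) = i + (b - 1) by omega, h1.1,
        show i + (b - 1) + 1 = i + b by omega, heq]
    intro a ha b hb hab
    simp only [Set.mem_Iio] at ha hb
    rcases lt_trichotomy a b with h | h | h
    · exact absurd hab (key a b h hb)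
    · exact h
    · exact absurd hab.symm (key b a h ha)

/-- A cycle of length `p` in a closed walk is a ring. -/
theorem isRing_of_walk (hp : 3 ≤ p) {x : ℕ → V × V} {i : ℕ}
    (hadj : ∀ j < p, H.Adj (x (i + j)).1 (x (i + j)).2)
    (hchain : ∀ j, j + 1 < p → (x (i + j)).2 = (x (i + (j + 1))).1)
    (hinj : Set.InjOn (fun j => (x (i + j)).1) (Set.Iio p))
    (hclosed : (x (i + (p - 1))).2 = (x i).1) :
    H.IsRing (fun j : ZMod p => (x (i + j.val)).1) ∧
      ∀ j < p, (x (i + j)).2 = (x (i + ((j : ZMod p) + 1).val)).1 := by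
  have hp0 : NeZero p := ⟨by omega⟩
  have hstep : ∀ j < p, (x (i + j)).2 = (x (i + ((j : ZMod p) + 1).val)).1 := by
    intro j hj
    rw [← Nat.cast_add_one, ZMod.val_natCast]
    rcases (Nat.succ_le_of_lt hj).lt_or_eq with h | h
    · rw [Nat.mod_eq_of_lt h]; exact hchain j h
    · rw [show j + 1 = p from h, Nat.mod_self]
      rw [show j = p - 1 by omega]; exact hclosed
  refine ⟨⟨?_, ?_⟩, hstep⟩
  · intro a b hab
    exact ZMod.val_injective p (hinj (ZMod.val_lt a) (ZMod.val_lt b) hab)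
  · intro j
    have h1 := hadj j.val (ZMod.val_lt j)
    rw [hstep _ (ZMod.val_lt j)] at h1
    simpa using h1

/-- A closed sequence of `p` steps `±1` in `ZMod p` goes around once. -/
theorem exists_unit_of_odd_steps (hodd : Odd p) (a : ZMod p → ZMod p)
    (h : ∀ i, a (i + 1) - a i = 1 ∨ a (i + 1) - a i = -1) :
    ∃ ε : ℤˣ, ∀ i, a i = a 0 + ((ε : ℤ) : ZMod p) * i := by
  classical
  have : NeZero p := ⟨hodd.pos.ne'⟩
  have hsum : ∑ i, (a (i + 1) - a i) = 0 := by
    rw [Finset.sum_sub_distrib, sub_eq_zero]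
    exact Fintype.sum_equiv (Equiv.addRight 1) _ _ (fun i => rfl)
  -- All steps sum to zero, so twice the number of steps `+1` vanishes modulo the odd number `p`;
  -- this number is therefore `0` or `p`.
  set P : Finset (ZMod p) := {i | a (i + 1) - a i = 1} with hP
  have hone : ∀ i, a (i + 1) - a i = if i ∈ P then 1 else -1 := by
    intro i
    split_ifs with hi
    · simpa [hP] using hi
    · exact (h i).resolve_left (by simpa [hP] using hi)
  have hcount : (2 : ZMod p) * (P.card : ZMod p) = 0 := by
    have h1 : ∑ i : ZMod p, (a (i + 1) - a i) =
        ∑ i : ZMod p, (2 * (if i ∈ P then 1 else 0) - 1) := by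
      apply Finset.sum_congr rfl
      intro i _
      rw [hone]
      split_ifs <;> ring
    rw [hsum, Finset.sum_sub_distrib, ← Finset.mul_sum] at h1
    simpa using h1.symm
  have h2 : p ∣ P.card := by
    have h4 : ((2 * P.card : ℕ) : ZMod p) = 0 := by exact_mod_cast hcount
    rw [ZMod.natCast_eq_zero_iff] at h4
    exact (Nat.coprime_two_right.2 hodd).dvd_of_dvd_mul_left h4
  have h3 : P.card ≤ p := by simpa [ZMod.card] using Finset.card_le_univ P
  have hconst : ∃ ε : ℤˣ, ∀ i, a (i + 1) - a i = ((ε : ℤ) : ZMod p) := by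
    rcases Nat.eq_zero_or_pos P.card with h4 | h4
    · rw [Finset.card_eq_zero] at h4
      exact ⟨-1, fun i => by rw [hone, h4]; simp⟩
    · have h5 : P = Finset.univ := by
        apply Finset.eq_univ_of_card
        rw [ZMod.card]
        exact le_antisymm h3 (Nat.le_of_dvd h4 h2)
      exact ⟨1, fun i => by rw [hone, h5]; simp⟩
  obtain ⟨ε, hε⟩ := hconst
  refine ⟨ε, fun i => ?_⟩
  have key : ∀ m : ℕ, a (m : ZMod p) = a 0 + ((ε : ℤ) : ZMod p) * (m : ZMod p) := by
    intro m
    induction m with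
    | zero => simp
    | succ m ih =>
      have := hε (m : ZMod p)
      push_cast
      linear_combination this + ih
  have := key i.val
  rwa [ZMod.natCast_zmod_val] at this

theorem exists_unit_of_steps [Fact p.Prime] (hp2 : p ≠ 2) (a : ZMod p → ZMod p)
    (h : ∀ i, a (i + 1) - a i = 1 ∨ a (i + 1) - a i = -1) :
    ∃ ε : ℤˣ, ∀ i, a i = a 0 + ((ε : ℤ) : ZMod p) * i :=
  exists_unit_of_odd_steps ((Fact.out : p.Prime).odd_of_ne_two hp2) a h

/-- A ring all of whose edges lie on another one runs along it. -/
theorem IsRing.exists_unit [Fact p.Prime] (hp2 : p ≠ 2) {T U : ZMod p → V} (hT : H.IsRing T)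
    (hU : H.IsRing U)
    (hedge : ∀ k, ∃ a, (U k = T a ∧ U (k + 1) = T (a + 1)) ∨ (U k = T (a + 1) ∧ U (k + 1) = T a)) :
    ∃ (ε : ℤˣ) (c : ZMod p), ∀ i, U i = T (c + ((ε : ℤ) : ZMod p) * i) := by
  have hex : ∀ k, ∃ a, U k = T a := by
    intro k
    obtain ⟨a, h | h⟩ := hedge k
    · exact ⟨_, h.1⟩
    · exact ⟨_, h.1⟩
  choose a ha using hex
  obtain ⟨ε, hε⟩ := exists_unit_of_steps hp2 a (by
    intro k
    obtain ⟨b, ⟨h1, h2⟩ | ⟨h1, h2⟩⟩ := hedge k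
    · rw [ha] at h1 h2
      rw [hT.inj h1, hT.inj h2]; left; ring
    · rw [ha] at h1 h2
      rw [hT.inj h1, hT.inj h2]; right; ring)
  exact ⟨ε, a 0, fun i => by rw [ha, hε]⟩

end SimpleGraph

/-! ### Embedded graphs and hubs in the faces bounded by rings. -/

namespace SimpleGraph

variable {V : Type*} {H : SimpleGraph V} {p L : ℕ}

open scoped Classical in
/-- Reversal of the darts of `H`; the pairs that are not darts are fixed. -/
noncomputable def dartRev (H : SimpleGraph V) : Perm (V × V) :=
  Function.Involutive.toPerm (fun d => if H.Adj d.1 d.2 then d.swap else d) <| by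
    intro d
    by_cases h : H.Adj d.1 d.2
    · simp [h, h.symm]
    · simp [h]

theorem dartRev_of_adj {d : V × V} (h : H.Adj d.1 d.2) : dartRev H d = d.swap :=
  if_pos h

theorem dartRev_of_not_adj {d : V × V} (h : ¬ H.Adj d.1 d.2) : dartRev H d = d :=
  if_neg h

@[simp] theorem dartRev_dartRev (d : V × V) : dartRev H (dartRev H d) = d :=
  Function.Involutive.toPerm_involutive _ d

theorem dartRev_ne_iff {d : V × V} : dartRev H d ≠ d ↔ H.Adj d.1 d.2 := by
  constructor
  · intro h
    by_contra h'
    exact h (dartRev_of_not_adj h')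
  · intro h h'
    rw [dartRev_of_adj h] at h'
    have h1 : d.2 = d.1 := congrArg Prod.fst h'
    rw [h1] at h
    exact H.loopless.irrefl _ h

/-- `σ` is a rotation at the vertices of `H` that embeds every component into the sphere. -/
structure IsMap (H : SimpleGraph V) (σ : Perm (V × V)) : Prop where
  fst : ∀ d, (σ d).1 = d.1
  fixed : ∀ d : V × V, ¬ H.Adj d.1 d.2 → σ d = d
  sameCycle : ∀ d e : V × V, H.Adj d.1 d.2 → H.Adj e.1 e.2 → d.1 = e.1 → σ.SameCycle d e
  spherical : Perm.Spherical σ (dartRev H)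

/-- The walk along `T` turns at each vertex to the next dart in the rotation. -/
def IsFacial (σ : Perm (V × V)) (T : ZMod p → V) : Prop :=
  ∀ i, σ (T (i + 1), T i) = (T (i + 1), T (i + 1 + 1))

theorem IsMap.adj_iff {σ : Perm (V × V)} (h : H.IsMap σ) (d : V × V) :
    H.Adj (σ d).1 (σ d).2 ↔ H.Adj d.1 d.2 := by
  constructor
  · intro h1
    by_contra h2
    rw [h.fixed d h2] at h1
    exact h2 h1
  · intro h1
    by_contra h2
    have h3 := σ.injective (h.fixed _ h2)
    rw [h3] at h2
    exact h2 h1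

/-- The face on one side of a dart. -/
noncomputable abbrev faceClass (H : SimpleGraph V) (σ : Perm (V × V)) (d : V × V) :
    Quotient (Perm.SameCycle.setoid (σ * dartRev H)) := Quotient.mk _ d

theorem faceClass_rot {σ : Perm (V × V)} (d : V × V) :
    faceClass H σ (σ (dartRev H d)) = faceClass H σ d :=
  Quotient.sound (Perm.SameCycle.symm ⟨1, by simp⟩)

/-- A choice `M` of one facial orientation of each ring, with the rings `T` indexed by the faces
and the positions `idx` of the chosen darts on them. -/
structure IsHubSystem (H : SimpleGraph V) (σ : Perm (V × V)) (M : Set (V × V))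
    (T : Quotient (Perm.SameCycle.setoid (σ * dartRev H)) → ZMod p → V)
    (idx : V × V → ZMod p) : Prop where
  rev : ∀ d ∈ M, d.swap ∉ M
  isRing : ∀ d ∈ M, H.IsRing (T (faceClass H σ d))
  facial : ∀ d ∈ M, IsFacial σ (T (faceClass H σ d))
  mem : ∀ d ∈ M, ∀ i, (T (faceClass H σ d) i, T (faceClass H σ d) (i + 1)) ∈ M
  cls : ∀ d ∈ M, ∀ i, faceClass H σ (T (faceClass H σ d) i, T (faceClass H σ d) (i + 1)) =
    faceClass H σ d
  eq : ∀ d ∈ M, d = (T (faceClass H σ d) (idx d), T (faceClass H σ d) (idx d + 1))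
  cover : ∀ U : ZMod p → V, H.IsRing U → ∀ i, (U i, U (i + 1)) ∈ M ∨ (U (i + 1), U i) ∈ M

theorem IsRing.two_ne_zero (hp : 3 ≤ p) : (2 : ZMod p) ≠ 0 := by
  intro h
  have := natCast_inj_of_lt (p := p) (a := 2) (b := 0) (by omega) (by omega) (by exact_mod_cast h)
  omega

/-- A maximal set of marked darts composed of facial rings, with no dart marked together with its
reversal, serves. A ring sharing an edge with a marked ring has the same edges, by
`edge_of_two_common`; a ring without marked edges could be added in its facial direction. -/
theorem exists_maximal_marking [Finite V] {σ : Perm (V × V)} (hG : H.CyclesGood p L)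
    (hL : 2 * p ≤ L) (hp : 3 ≤ p) (hodd : Odd p)
    (hfac : ∀ T : ZMod p → V, H.IsRing T → IsFacial σ T ∨ IsFacial σ fun i => T (-i)) :
    ∃ M : Set (V × V), (∀ d ∈ M, d.swap ∉ M) ∧
      (∀ d ∈ M, ∃ T : ZMod p → V, H.IsRing T ∧ IsFacial σ T ∧ d = (T 0, T 1) ∧
        ∀ i, (T i, T (i + 1)) ∈ M) ∧
      ∀ U : ZMod p → V, H.IsRing U → ∀ i, (U i, U (i + 1)) ∈ M ∨ (U (i + 1), U i) ∈ M := by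
  have hfin : Finite (Set (V × V)) := inferInstance
  let P : Set (V × V) → Prop := fun M => (∀ d ∈ M, d.swap ∉ M) ∧
      (∀ d ∈ M, ∃ T : ZMod p → V, H.IsRing T ∧ IsFacial σ T ∧ d = (T 0, T 1) ∧
        ∀ i, (T i, T (i + 1)) ∈ M)
  obtain ⟨M, -, ⟨hM1, hM2⟩, hmax⟩ := Finite.exists_le_maximal (p := P) (a := ∅) (by simp [P])
  refine ⟨M, hM1, hM2, ?_⟩
  have h10 : (0 : ZMod p) ≠ 1 := by
    intro h
    have := natCast_inj_of_lt (p := p) (a := 0) (b := 1) (by omega) (by omega) (by exact_mod_cast h)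
    omega
  have key : ∀ U : ZMod p → V, H.IsRing U → IsFacial σ U →
      ∀ i, (U i, U (i + 1)) ∈ M ∨ (U (i + 1), U i) ∈ M := by
    intro U hU hUf
    by_cases hex : ∃ i, (U i, U (i + 1)) ∈ M ∨ (U (i + 1), U i) ∈ M
    · obtain ⟨i, hi⟩ := hex
      have : ∃ T : ZMod p → V, H.IsRing T ∧ (∀ i, (T i, T (i + 1)) ∈ M) ∧
          U i ∈ Set.range T ∧ U (i + 1) ∈ Set.range T := by
        rcases hi with hi | hi
        · obtain ⟨T, h1, -, h2, h3⟩ := hM2 _ hi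
          simp only [Prod.mk.injEq] at h2
          exact ⟨T, h1, h3, ⟨_, h2.1.symm⟩, ⟨_, h2.2.symm⟩⟩
        · obtain ⟨T, h1, -, h2, h3⟩ := hM2 _ hi
          simp only [Prod.mk.injEq] at h2
          exact ⟨T, h1, h3, ⟨_, h2.2.symm⟩, ⟨_, h2.1.symm⟩⟩
      obtain ⟨T, hT, hTM, h1, h2⟩ := this
      intro k
      obtain ⟨a, ⟨h3, h4⟩ | ⟨h3, h4⟩⟩ := hT.edge_of_two_common hU hG hL hodd
        (by simpa using h10.symm : i ≠ i + 1) h1 h2 k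
      · left; rw [h3, h4]; exact hTM a
      · right; rw [h3, h4]; exact hTM a
    · push Not at hex
      exfalso
      have hP : P (M ∪ Set.range fun i => (U i, U (i + 1))) := by
        constructor
        · rintro d (hd | ⟨i, rfl⟩) (hd' | ⟨j, hj⟩)
          · exact hM1 d hd hd'
          · apply (hex j).2
            have : d = (U (j + 1), U j) := by
              rw [← Prod.swap_swap d, ← hj]; rfl
            rwa [← this]
          · exact (hex i).2 hd'
          · simp only [Prod.swap_prod_mk, Prod.mk.injEq] at hj
            have h1 := hU.inj hj.1
            have h2 := hU.inj hj.2
            apply IsRing.two_ne_zero hp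
            linear_combination h2 - h1
        · rintro d (hd | ⟨i, rfl⟩)
          · obtain ⟨T, h1, h2, h3, h4⟩ := hM2 d hd
            exact ⟨T, h1, h2, h3, fun i => Or.inl (h4 i)⟩
          · refine ⟨fun j => U (i + j), hU.shift i, ?_, by simp, ?_⟩
            · intro j
              have := hUf (i + j)
              rwa [add_assoc, add_assoc] at this
            · intro j
              right
              exact ⟨i + j, by simp [add_assoc]⟩
      have := hmax hP Set.subset_union_left (Or.inr ⟨0, rfl⟩)
      exact (hex 0).1 this
  intro U hU i
  rcases hfac U hU with h | h
  · exact key U hU h i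
  · have := key _ hU.neg h (-i - 1)
    simp only [neg_sub, sub_neg_eq_add, sub_add_cancel, neg_neg] at this
    rw [add_comm 1 i] at this
    exact this.symm

/-- A facial walk that starts at a marked dart follows its ring, so a single ring can be fixed for
each face and indexes all marked darts of that face. -/
theorem exists_hubSystem [Finite V] {σ : Perm (V × V)} (hG : H.CyclesGood p L)
    (hL : 2 * p ≤ L) (hp : 3 ≤ p) (hodd : Odd p)
    (hfac : ∀ T : ZMod p → V, H.IsRing T → IsFacial σ T ∨ IsFacial σ fun i => T (-i)) :
    ∃ (M : Set (V × V)) (T : Quotient (Perm.SameCycle.setoid (σ * dartRev H)) → ZMod p → V)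
      (idx : V × V → ZMod p), IsHubSystem H σ M T idx := by
  classical
  obtain ⟨M, hM1, hM2, hM3⟩ := exists_maximal_marking hG hL hp hodd hfac
  by_cases hne : M.Nonempty
  swap
  · rw [Set.not_nonempty_iff_eq_empty] at hne
    subst hne
    by_cases hV : Nonempty V
    · obtain ⟨v⟩ := hV
      exact ⟨∅, fun _ _ => v, fun _ => 0, by simp, by simp, by simp, by simp, by simp, by simp, hM3⟩
    · exact ⟨∅, fun q => (hV ⟨q.out.1⟩).elim, fun _ => 0, by simp, by simp, by simp, by simp,
        by simp, by simp, hM3⟩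
  obtain ⟨m, hm⟩ := hne
  have : Nonempty V := ⟨m.1⟩
  choose! R hR1 hR2 hR3 hR4 using hM2
  have hrot : ∀ d ∈ M, ∀ i,
      σ (dartRev H (R d i, R d (i + 1))) = (R d (i + 1), R d (i + 1 + 1)) := by
    intro d hd i
    rw [dartRev_of_adj ((hR1 d hd).adj i)]
    exact hR2 d hd i
  have hpow : ∀ d ∈ M, ∀ j : ℕ, ((σ * dartRev H) ^ j) d = (R d j, R d (j + 1)) := by
    intro d hd j
    induction j with
    | zero => simpa using hR3 d hd
    | succ j ih =>
      rw [pow_succ', Perm.mul_apply, ih, Perm.mul_apply, hrot d hd]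
      push_cast; rfl
  let rep : Quotient (Perm.SameCycle.setoid (σ * dartRev H)) → V × V := fun q =>
    if h : ∃ d ∈ M, faceClass H σ d = q then h.choose else m
  have hrepM : ∀ q, rep q ∈ M := by
    intro q
    simp only [rep]
    split_ifs with h
    · exact h.choose_spec.1
    · exact hm
  have hrep : ∀ d ∈ M, faceClass H σ (rep (faceClass H σ d)) = faceClass H σ d := by
    intro d hd
    have h : ∃ e ∈ M, faceClass H σ e = faceClass H σ d := ⟨d, hd, rfl⟩
    simp only [rep, dif_pos h]
    exact h.choose_spec.2
  have hidx : ∀ d ∈ M, ∃ i,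
      d = (R (rep (faceClass H σ d)) i, R (rep (faceClass H σ d)) (i + 1)) := by
    intro d hd
    have h1 : (σ * dartRev H).SameCycle (rep (faceClass H σ d)) d := Quotient.exact (hrep d hd)
    obtain ⟨j, -, hj⟩ := h1.exists_pow_eq'
    rw [hpow _ (hrepM _)] at hj
    exact ⟨j, hj.symm⟩
  choose! idx hidx using hidx
  refine ⟨M, fun q => R (rep q), idx, hM1, fun d _ => hR1 _ (hrepM _), fun d _ => hR2 _ (hrepM _),
    fun d _ => hR4 _ (hrepM _), ?_, hidx, hM3⟩
  intro d hd i
  have : NeZero p := ⟨by omega⟩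
  rw [← hrep d hd]
  apply Quotient.sound
  refine Perm.SameCycle.symm ⟨i.val, ?_⟩
  rw [hrep d hd, zpow_natCast, hpow _ (hrepM _)]
  simp

namespace IsHubSystem

variable {σ : Perm (V × V)} {M : Set (V × V)}
  {T : Quotient (Perm.SameCycle.setoid (σ * dartRev H)) → ZMod p → V} {idx : V × V → ZMod p}

theorem adj (h : IsHubSystem H σ M T idx) {d : V × V} (hd : d ∈ M) : H.Adj d.1 d.2 := by
  have h1 := (h.isRing d hd).adj (idx d)
  have h2 := h.eq d hd
  rw [h2]
  exact h1

theorem rev_eq (h : IsHubSystem H σ M T idx) {d : V × V} (hd : d ∈ M) : dartRev H d = d.swap :=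
  dartRev_of_adj (h.adj hd)

theorem rev_notMem (h : IsHubSystem H σ M T idx) {d : V × V} (hd : d ∈ M) : dartRev H d ∉ M := by
  rw [h.rev_eq hd]; exact h.rev d hd

theorem idx_eq (h : IsHubSystem H σ M T idx) {d : V × V} (hd : d ∈ M) (i : ZMod p) :
    idx (T (faceClass H σ d) i, T (faceClass H σ d) (i + 1)) = i := by
  have h1 := h.eq _ (h.mem d hd i)
  rw [h.cls d hd i] at h1
  exact ((h.isRing d hd).inj (congrArg Prod.fst h1)).symm

theorem rot_rev (h : IsHubSystem H σ M T idx) {d : V × V} (hd : d ∈ M) (i : ZMod p) :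
    σ (dartRev H (T (faceClass H σ d) i, T (faceClass H σ d) (i + 1))) =
      (T (faceClass H σ d) (i + 1), T (faceClass H σ d) (i + 1 + 1)) := by
  rw [dartRev_of_adj ((h.isRing d hd).adj i)]
  exact h.facial d hd i

theorem face_eq (h : IsHubSystem H σ M T idx) {d : V × V} (hd : d ∈ M) :
    σ (dartRev H d) =
      (T (faceClass H σ d) (idx d + 1), T (faceClass H σ d) (idx d + 1 + 1)) := by
  have h1 := h.rot_rev hd (idx d)
  rwa [← h.eq d hd] at h1

theorem face_mem (h : IsHubSystem H σ M T idx) {d : V × V} (hd : d ∈ M) :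
    σ (dartRev H d) ∈ M := by
  rw [h.face_eq hd]; exact h.mem d hd _

theorem idx_face (h : IsHubSystem H σ M T idx) {d : V × V} (hd : d ∈ M) :
    idx (σ (dartRev H d)) = idx d + 1 := by
  rw [h.face_eq hd, h.idx_eq hd]

/-- The predecessor of a chosen dart on its face. -/
theorem exists_face_eq (h : IsHubSystem H σ M T idx) {d : V × V} (hd : d ∈ M) :
    ∃ e ∈ M, σ (dartRev H e) = d :=
  ⟨_, h.mem d hd (idx d - 1), by rw [h.rot_rev hd, sub_add_cancel]; exact (h.eq d hd).symm⟩

theorem face_mem_iff (h : IsHubSystem H σ M T idx) {d : V × V} :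
    σ (dartRev H d) ∈ M ↔ d ∈ M := by
  refine ⟨fun hd => ?_, h.face_mem⟩
  obtain ⟨e, he, h1⟩ := h.exists_face_eq hd
  rwa [← (dartRev H).injective (σ.injective h1)]

/-- If `σ d` is marked, then so is its predecessor on the face, the reversal of `d`. Hence skipping
one dart suffices in `rot`. -/
theorem rot_notMem (h : IsHubSystem H σ M T idx) {d : V × V} (hd : d ∈ M) : σ d ∉ M := by
  intro h1
  have h2 : dartRev H d ∈ M := h.face_mem_iff.1 (by simpa using h1)
  exact h.rev_notMem hd h2

theorem mem_of_class (h : IsHubSystem H σ M T idx) {d e : V × V} (hd : d ∈ M)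
    (he : faceClass H σ e = faceClass H σ d) [Finite V] : e ∈ M := by
  have h1 : (σ * dartRev H).SameCycle d e := Quotient.exact he.symm
  obtain ⟨j, -, rfl⟩ := h1.exists_pow_eq'
  clear he h1
  induction j with
  | zero => exact hd
  | succ j ih => rw [pow_succ', Perm.mul_apply]; exact h.face_mem ih

theorem ext_of_class (h : IsHubSystem H σ M T idx) {d e : V × V} (hd : d ∈ M) (he : e ∈ M)
    (hc : faceClass H σ d = faceClass H σ e) (hi : idx d = idx e) : d = e := by
  rw [h.eq d hd, h.eq e he, hc, hi]

open scoped Classical in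
/-- The rotation after cutting each chosen face off along a hub that is joined to the second vertex
of each of its darts. -/
noncomputable def rot [Finite V] (h : IsHubSystem H σ M T idx) : Perm (V × V) :=
  Equiv.ofBijective (fun d => if d ∈ M then dartRev H (σ⁻¹ d) else if σ d ∈ M then σ (σ d) else σ d)
    (Finite.injective_iff_bijective.1 <| by
      have hin : ∀ d ∈ M, dartRev H (σ⁻¹ d) ∈ M := by
        intro d hd
        obtain ⟨e, he, rfl⟩ := h.exists_face_eq hd
        simpa using he
      have hout : ∀ d ∉ M, (if σ d ∈ M then σ (σ d) else σ d) ∉ M := by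
        intro d hd
        split_ifs with h1
        · exact h.rot_notMem h1
        · exact h1
      intro d e hde
      by_cases hd : d ∈ M <;> by_cases he : e ∈ M
      · simpa [hd, he] using hde
      · simp only [hd, he, if_true, if_false] at hde
        exact absurd (hde ▸ hin d hd) (hout e he)
      · simp only [hd, he, if_true, if_false] at hde
        exact absurd (hde ▸ hin e he) (hout d hd)
      · simp only [hd, he, if_false] at hde
        split_ifs at hde with h1 h2 h2
        · simpa using hde
        · exact absurd (σ.injective hde ▸ h1) he
        · exact absurd (σ.injective hde.symm ▸ h2) hd
        · simpa using hde)

section rot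

variable [Finite V] (h : IsHubSystem H σ M T idx)

theorem rot_face {d : V × V} (hd : d ∈ M) : h.rot (σ (dartRev H d)) = d := by
  simp [rot, h.face_mem hd]

theorem rot_of_rot_mem {d : V × V} (hd : d ∉ M) (h1 : σ d ∈ M) : h.rot d = σ (σ d) := by
  simp [rot, hd, h1]

theorem rot_of_rot_notMem {d : V × V} (hd : d ∉ M) (h1 : σ d ∉ M) : h.rot d = σ d := by
  simp [rot, hd, h1]

theorem rot_mem_iff {d : V × V} : h.rot d ∈ M ↔ d ∈ M := by
  constructor
  · intro h1
    by_contra hd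
    by_cases h2 : σ d ∈ M
    · rw [h.rot_of_rot_mem hd h2] at h1
      exact h.rot_notMem h2 h1
    · rw [h.rot_of_rot_notMem hd h2] at h1
      exact h2 h1
  · intro hd
    obtain ⟨e, he, rfl⟩ := h.exists_face_eq hd
    rwa [h.rot_face he]

theorem rot_fst (hm : H.IsMap σ) {d : V × V} (hd : d ∉ M) : (h.rot d).1 = d.1 := by
  by_cases h2 : σ d ∈ M
  · rw [h.rot_of_rot_mem hd h2, hm.fst, hm.fst]
  · rw [h.rot_of_rot_notMem hd h2, hm.fst]

theorem rot_class {d : V × V} (hd : d ∈ M) : faceClass H σ (h.rot d) = faceClass H σ d := by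
  obtain ⟨e, he, rfl⟩ := h.exists_face_eq hd
  rw [h.rot_face he, faceClass_rot]

theorem idx_rot {d : V × V} (hd : d ∈ M) : idx d = idx (h.rot d) + 1 := by
  obtain ⟨e, he, rfl⟩ := h.exists_face_eq hd
  rw [h.rot_face he, h.idx_face he]

theorem sameCycle_rot_mem {d e : V × V} (hd : d ∈ M)
    (hc : faceClass H σ d = faceClass H σ e) : h.rot.SameCycle d e := by
  have h1 : (σ * dartRev H).SameCycle d e := Quotient.exact hc
  obtain ⟨j, -, rfl⟩ := h1.exists_pow_eq'
  clear hc h1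
  suffices H' : ((σ * dartRev H) ^ j) d ∈ M ∧ h.rot.SameCycle d (((σ * dartRev H) ^ j) d) from H'.2
  induction j with
  | zero => exact ⟨hd, Perm.SameCycle.refl _ _⟩
  | succ j ih =>
    rw [pow_succ', Perm.mul_apply, Perm.mul_apply]
    refine ⟨h.face_mem ih.1, ih.2.trans (Perm.SameCycle.symm ⟨1, ?_⟩)⟩
    rw [zpow_one]
    exact h.rot_face ih.1

theorem sameCycle_rot_notMem {d e : V × V} (hd : d ∉ M) (he : e ∉ M) (hs : σ.SameCycle d e) :
    h.rot.SameCycle d e := by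
  obtain ⟨i, -, rfl⟩ := hs.exists_pow_eq'
  clear hs
  suffices H' : ∀ i, ((σ ^ i) d ∉ M → h.rot.SameCycle d ((σ ^ i) d)) ∧
      ((σ ^ i) d ∈ M → h.rot.SameCycle d ((σ ^ (i + 1)) d)) from (H' i).1 he
  intro i
  induction i with
  | zero => exact ⟨fun _ => Perm.SameCycle.refl _ _, fun h1 => absurd h1 hd⟩
  | succ i ih =>
    by_cases h1 : (σ ^ i) d ∈ M
    · refine ⟨fun _ => ih.2 h1, fun h2 => ?_⟩
      rw [pow_succ', Perm.mul_apply] at h2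
      exact absurd h2 (h.rot_notMem h1)
    · constructor
      · intro h2
        refine (ih.1 h1).trans ⟨1, ?_⟩
        rw [pow_succ', Perm.mul_apply] at h2 ⊢
        rw [zpow_one, h.rot_of_rot_notMem h1 h2]
      · intro h2
        refine (ih.1 h1).trans ⟨1, ?_⟩
        rw [pow_succ', Perm.mul_apply] at h2
        rw [zpow_one, h.rot_of_rot_mem h1 h2, pow_succ', Perm.mul_apply, pow_succ', Perm.mul_apply]

/-- The spokes of a hub keep together what the ring edges had joined. -/
theorem orbitCount_rot_le : Perm.orbitCount h.rot (dartRev H) ≤ Perm.orbitCount σ (dartRev H) := by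
  apply Setoid.card_quotient_le
  set r := Perm.SameCycle.setoid h.rot ⊔ Perm.SameCycle.setoid (dartRev H) with hr
  have hρ : ∀ a, r a (h.rot a) := Perm.setoid_le_iff.1 le_sup_left
  have hα : ∀ a, r a (dartRev H a) := Perm.setoid_le_iff.1 le_sup_right
  refine sup_le (Perm.setoid_le_iff.2 fun d => ?_) le_sup_right
  by_cases hd : d ∈ M
  · obtain ⟨e, he, rfl⟩ := h.exists_face_eq hd
    have h1 := hρ (σ (dartRev H e))
    rw [h.rot_face he] at h1
    have h2 := hρ (dartRev H e)
    rw [h.rot_of_rot_mem (h.rev_notMem he) hd] at h2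
    exact r.trans' h1 (r.trans' (hα e) h2)
  · by_cases h1 : σ d ∈ M
    · obtain ⟨e, he, h2⟩ := h.exists_face_eq h1
      have h3 := σ.injective h2
      subst h3
      have h4 := hρ (σ (dartRev H e))
      rw [h.rot_face he] at h4
      exact r.symm' (r.trans' h4 (hα e))
    · have := hρ d
      rwa [h.rot_of_rot_notMem hd h1] at this

/-- Each hub is a new vertex that uses up the chosen face it fills. The darts and their reversal
stay the same, as ring edges are reused as spokes, and the number of components does not grow. -/
theorem spherical_rot (hm : H.IsMap σ) : Perm.Spherical h.rot (dartRev H) := by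
  classical
  let Q := Quotient (Perm.SameCycle.setoid (σ * dartRev H))
  let MQ : Set Q := {q | ∃ d ∈ M, faceClass H σ d = q}
  have hcard : Nat.card MQ + Nat.card {q : Q // q ∉ MQ} = Perm.cycleCount (σ * dartRev H) := by
    have h1 := Nat.card_congr (Equiv.sumCompl (fun q : Q => q ∈ MQ))
    rw [Nat.card_sum] at h1
    exact h1
  have hMQ : ∀ d, faceClass H σ d ∈ MQ → d ∈ M := by
    rintro d ⟨e, he, h1⟩
    exact h.mem_of_class he h1.symm
  have h1 : Perm.cycleCount σ + Nat.card MQ ≤ Perm.cycleCount h.rot := by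
    have := Perm.card_le_cycleCount
      (X := Quotient (Perm.SameCycle.setoid σ) ⊕ MQ) h.rot
      (fun d => if hd : d ∈ M then Sum.inr ⟨faceClass H σ d, d, hd, rfl⟩ else Sum.inl ⟦d⟧) ?_ ?_
    · rwa [Nat.card_sum] at this
    · intro d
      by_cases hd : d ∈ M
      · simp only [hd, h.rot_mem_iff.2 hd, dif_pos, Sum.inr.injEq, Subtype.mk.injEq]
        exact h.rot_class hd
      · have h2 : h.rot d ∉ M := fun h' => hd (h.rot_mem_iff.1 h')
        simp only [hd, h2, dif_neg, not_false_eq_true, Sum.inl.injEq]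
        apply Quotient.sound
        by_cases h3 : σ d ∈ M
        · rw [h.rot_of_rot_mem hd h3]
          exact Perm.SameCycle.symm ⟨2, by rw [zpow_two]; rfl⟩
        · rw [h.rot_of_rot_notMem hd h3]
          exact Perm.SameCycle.symm ⟨1, by simp⟩
    · rintro (q | ⟨q, d, hd, rfl⟩)
      · induction q using Quotient.inductionOn with
        | h d =>
          by_cases hd : d ∈ M
          · refine ⟨σ d, ?_⟩
            simp only [h.rot_notMem hd, dif_neg, not_false_eq_true, Sum.inl.injEq]
            exact Quotient.sound (Perm.SameCycle.symm ⟨1, by simp⟩)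
          · exact ⟨d, by simp [hd]⟩
      · exact ⟨d, by simp [hd]⟩
  have h2 : Nat.card {q : Q // q ∉ MQ} ≤ Perm.cycleCount (h.rot * dartRev H) := by
    have hne : ∀ d, faceClass H σ (if d ∈ M then dartRev H (σ (dartRev H d)) else d) ∉ MQ := by
      intro d h1
      have := hMQ _ h1
      split_ifs at this with h2
      · exact h.rev_notMem (h.face_mem h2) this
      · exact h2 this
    refine Perm.card_le_cycleCount (X := {q : Q // q ∉ MQ}) (h.rot * dartRev H)
      -- A marked dart, now leaving its hub, lies on the face at the outer side of the next edge of
      -- its ring.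
      (fun d => ⟨faceClass H σ (if d ∈ M then dartRev H (σ (dartRev H d)) else d), hne d⟩) ?_ ?_
    · intro d
      rw [Subtype.mk.injEq, Perm.mul_apply]
      by_cases hd : d ∈ M
      · have h3 := h.rev_notMem hd
        have h4 := h.face_mem hd
        have h5 := h.rot_of_rot_mem h3 h4
        rw [h5, if_neg (h.rot_notMem h4), if_pos hd]
        have := faceClass_rot (H := H) (σ := σ) (dartRev H (σ (dartRev H d)))
        rwa [dartRev_dartRev] at this
      · by_cases hd' : dartRev H d ∈ M
        · obtain ⟨e, he, h3⟩ := h.exists_face_eq hd'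
          rw [← h3, h.rot_face he, if_pos he, if_neg hd, h3, dartRev_dartRev]
        · have h3 : σ (dartRev H d) ∉ M := fun h' => hd (h.face_mem_iff.1 h')
          rw [h.rot_of_rot_notMem hd' h3, if_neg h3, if_neg hd, faceClass_rot]
    · rintro ⟨q, hq⟩
      induction q using Quotient.inductionOn with
      | h d =>
        have hd : d ∉ M := fun hd => hq ⟨d, hd, rfl⟩
        exact ⟨d, by simp [hd]⟩
  have h3 := h.orbitCount_rot_le
  have h4 := hm.spherical
  unfold Perm.Spherical at *
  omega

end rot

end IsHubSystem

end SimpleGraph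

/-! ### The network of vertices and hubs, and the walks behind its runs. -/

namespace SimpleGraph

variable {V : Type*} {H : SimpleGraph V} {p L : ℕ}

/-- The distance from a position on a ring to another, a full turn if they agree. -/
def turnLength (t : ZMod p) : ℕ := if t = 0 then p else t.val

theorem turnLength_le [NeZero p] (t : ZMod p) : turnLength t ≤ p := by
  unfold turnLength
  split_ifs
  · exact le_rfl
  · exact (ZMod.val_lt t).le

theorem val_le_turnLength [NeZero p] (t : ZMod p) : t.val ≤ turnLength t := by
  unfold turnLength
  split_ifs
  · exact (ZMod.val_lt t).le
  · exact le_rfl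

theorem turnLength_pos [NeZero p] (t : ZMod p) : 0 < turnLength t := by
  unfold turnLength
  split_ifs with h
  · exact NeZero.pos p
  · rw [Nat.pos_iff_ne_zero]
    intro h1
    exact h ((ZMod.val_eq_zero t).1 h1)

theorem turnLength_add_le [NeZero p] (s t : ZMod p) :
    turnLength (s + t) ≤ turnLength s + turnLength t := by
  by_cases h : s + t = 0
  · rw [turnLength, if_pos h]
    by_cases hs : s = 0
    · rw [turnLength, if_pos hs]; omega
    have ht : t ≠ 0 := by rintro rfl; exact hs (by simpa using h)
    have h1 : (s.val + t.val) % p = 0 := by rw [← ZMod.val_add, h, ZMod.val_zero]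
    have h2 := Nat.le_of_dvd (by
      have := turnLength_pos s
      rw [turnLength, if_neg hs] at this
      omega) (Nat.dvd_of_mod_eq_zero h1)
    exact h2.trans (add_le_add (val_le_turnLength s) (val_le_turnLength t))
  · rw [turnLength, if_neg h]
    exact (ZMod.val_add_le s t).trans (add_le_add (val_le_turnLength s) (val_le_turnLength t))

namespace IsHubSystem

variable {σ : Perm (V × V)} {M : Set (V × V)}
  {T : Quotient (Perm.SameCycle.setoid (σ * dartRev H)) → ZMod p → V} {idx : V × V → ZMod p}

open scoped Classical in
/-- The network of the vertices and the hubs. -/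
noncomputable def network [NeZero p] [Finite V] (h : IsHubSystem H σ M T idx) :
    NetworkData p (V × V) (V ⊕ Quotient (Perm.SameCycle.setoid (σ * dartRev H))) where
  node d := if d ∈ M then Sum.inr (faceClass H σ d) else Sum.inl d.1
  pos d := if d ∈ M then idx d else 0
  corner a b := if a ∈ M ∧ b ∈ M then turnLength (idx a - idx b) else 0
  weight := Sum.elim (fun _ => 0) fun _ => 1
  corner_le a b := by
    split_ifs
    · exact turnLength_le _
    · exact Nat.zero_le _
  corner_triangle a b c hab hbc := by
    by_cases ha : a ∈ M <;> by_cases hb : b ∈ M <;> by_cases hc : c ∈ M <;>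
      simp only [ha, hb, hc, if_true, if_false, reduceCtorEq] at hab hbc <;>
      simp [ha, hb, hc]
    have := turnLength_add_le (idx a - idx b) (idx b - idx c)
    rwa [sub_add_sub_cancel] at this
  weight_le_one x := by cases x <;> simp
  pos_ne a b hab hn hw := by
    by_cases ha : a ∈ M <;> by_cases hb : b ∈ M <;>
      simp only [ha, hb, if_true, if_false, reduceCtorEq, Sum.inr.injEq, Sum.elim_inl,
        zero_ne_one] at hn hw
    simp only [ha, hb, if_true]
    exact fun h1 => hab (h.ext_of_class ha hb hn h1)
  pos_eq_zero a hw := by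
    by_cases ha : a ∈ M <;> simp only [ha, if_true, if_false, Sum.elim_inr, one_ne_zero] at hw ⊢

open scoped Classical in
/-- The length of a dart: darts at hubs have length zero. -/
noncomputable def dartLength (H : SimpleGraph V) (M : Set (V × V)) (d : V × V) : ℕ :=
  if d ∈ M ∨ dartRev H d ∈ M then 0 else 1

/-- Consecutive darts of a walk without reversals. -/
def Step (x y : V × V) : Prop := x.2 = y.1 ∧ y ≠ x.swap

/-- The walk does not follow a ring all around. -/
def HubShort (H : SimpleGraph V) (σ : Perm (V × V)) (p : ℕ) (M : Set (V × V))
    (W : List (V × V)) : Prop :=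
  ∀ q, ∀ U, U <:+: W → (∀ x ∈ U, x.swap ∈ M ∧ faceClass H σ x.swap = q) → U.length < p

section network

variable [NeZero p] [Finite V] (h : IsHubSystem H σ M T idx)

theorem node_of_mem {d : V × V} (hd : d ∈ M) : h.network.node d = Sum.inr (faceClass H σ d) := by
  simp [network, hd]

theorem node_of_notMem {d : V × V} (hd : d ∉ M) : h.network.node d = Sum.inl d.1 := by
  simp [network, hd]

theorem corner_of_mem {d e : V × V} (hd : d ∈ M) (he : e ∈ M) :
    h.network.corner d e = turnLength (idx d - idx e) := by
  simp [network, hd, he]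

theorem corner_of_notMem {d e : V × V} (hd : d ∉ M) : h.network.corner d e = 0 := by
  simp [network, hd]

theorem mem_of_node_eq {d e : V × V} (hd : d ∈ M) (hn : h.network.node d = h.network.node e) :
    e ∈ M ∧ faceClass H σ d = faceClass H σ e := by
  by_cases he : e ∈ M
  · rw [h.node_of_mem hd, h.node_of_mem he] at hn
    exact ⟨he, Sum.inr_injective hn⟩
  · rw [h.node_of_mem hd, h.node_of_notMem he] at hn
    cases hn

theorem fst_of_node_eq {d e : V × V} (hd : d ∉ M) (hn : h.network.node d = h.network.node e) :
    e ∉ M ∧ d.1 = e.1 := by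
  by_cases he : e ∈ M
  · rw [h.node_of_notMem hd, h.node_of_mem he] at hn
    cases hn
  · rw [h.node_of_notMem hd, h.node_of_notMem he] at hn
    exact ⟨he, Sum.inl_injective hn⟩

open scoped Classical in
/-- A walk of the network expands to a walk of the graph that bypasses the hubs along rings. -/
theorem exists_walk (hp : 3 ≤ p) {a f : V × V} {m : ℕ}
    (hr : h.network.Run (dartRev H) (dartLength H M) a f m) :
    ∃ W : List (V × V), W.length = m ∧ (∀ x ∈ W, H.Adj x.1 x.2 ∧ x ∉ M) ∧ W.IsChain Step ∧
      HubShort H σ p M W ∧ (∀ x ∈ W.head?, (a ∉ M → x = a) ∧ (a ∈ M → x.1 = a.2 ∧ x ≠ a.swap)) ∧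
      (∀ x ∈ W.getLast?, x.2 = if dartRev H f ∈ M then f.1 else f.2) ∧
      (W = [] → (if dartRev H f ∈ M then f.1 else f.2) = if a ∈ M then a.2 else a.1) ∧
      (W = [] → a ∉ M → dartRev H f ∈ M) := by
  have hshort0 : HubShort H σ p M [] := by
    intro q U hU _
    rw [List.infix_nil.1 hU]
    simp; omega
  have hcons : ∀ (d : V × V) W, dartRev H d ∉ M → H.Adj d.1 d.2 → HubShort H σ p M W →
      HubShort H σ p M (d :: W) := by
    intro d W hd hadj hW q U hU hUq
    rcases List.infix_cons_iff.1 hU with h1 | h1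
    · rcases List.prefix_cons_iff.1 h1 with rfl | ⟨t, rfl, -⟩
      · simp; omega
      · have := (hUq d (by simp)).1
        rw [dartRev_of_adj hadj] at hd
        exact absurd this hd
    · exact hW q U h1 hUq
  induction hr with
  | single d hd =>
    have hadj := dartRev_ne_iff.1 hd
    by_cases h1 : d ∈ M
    · have h2 := h.rev_notMem h1
      exact ⟨[], by simp [dartLength, h1], by simp, by simp, hshort0, by simp, by simp,
        by simp [h1, h2], by simp [h1]⟩
    · by_cases h2 : dartRev H d ∈ M
      · exact ⟨[], by simp [dartLength, h2], by simp, by simp, hshort0, by simp, by simp,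
          by simp [h1, h2], by simp [h2]⟩
      · refine ⟨[d], by simp [dartLength, h1, h2], by simp [hadj, h1], by simp,
          hcons d [] h2 hadj hshort0, by simp [h1], by simp [h2], by simp, by simp⟩
  | cons d e f n hd hn he _ ih =>
    obtain ⟨W, hlen, hW, hchain, hshort, hhead, hlast, hnil, hnil'⟩ := ih
    have hadj := dartRev_ne_iff.1 hd
    have hrev := dartRev_of_adj hadj
    -- A dart leaving a hub adds nothing to the walk, a dart entering a hub is replaced by the ring
    -- darts of the corner that follows, and an ordinary dart is kept.
    by_cases h1 : d ∈ M
    · have h2 := h.rev_notMem h1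
      obtain ⟨h3, h4⟩ := h.fst_of_node_eq h2 hn
      rw [hrev] at h4 he
      simp only [Prod.fst_swap] at h4
      refine ⟨W, ?_, hW, hchain, hshort, ?_, hlast, ?_, ?_⟩
      · rw [hlen, h.corner_of_notMem h2]; simp [dartLength, h1]
      · intro x hx
        rw [(hhead x hx).1 h3]
        exact ⟨fun h5 => absurd h1 h5, fun _ => ⟨h4.symm, he⟩⟩
      · intro h5
        rw [hnil h5, if_neg h3, if_pos h1, h4]
      · intro _ h5; exact absurd h1 h5
    · by_cases h2 : dartRev H d ∈ M
      · obtain ⟨h3, h4⟩ := h.mem_of_node_eq h2 hn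
        set t := dartRev H d with ht
        set q := faceClass H σ t with hq
        have hd' : d = (T q (idx t + 1), T q (idx t)) := by
          have h5 := h.eq t h2
          rw [← Prod.swap_swap d, ← hrev]
          exact congrArg Prod.swap h5
        have hidx : idx t - idx e ≠ 0 := by
          intro h5
          exact he (h.ext_of_class h2 h3 h4 (sub_eq_zero.1 h5)).symm
        set k := (idx t - idx e).val with hk
        have hkpos : 0 < k := by
          rw [Nat.pos_iff_ne_zero]
          intro h5
          exact hidx ((ZMod.val_eq_zero _).1 h5)
        have hkp : k < p := ZMod.val_lt _
        have hkcast : (k : ZMod p) = idx t - idx e := by simp [hk]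
        have heq : e = (T q (idx e), T q (idx e + 1)) := by
          have h5 := h.eq e h3
          rwa [← h4] at h5
        have heq2 : e.2 = T q (idx e + 1) := congrArg Prod.snd heq
        -- The ring is followed against the orientation of its marked darts, which keeps the walk
        -- off `M`.
        let s : ℕ → V × V := fun i => (T q (idx t + 1 - i), T q (idx t - i))
        have hs : ∀ i, (s i).swap ∈ M ∧ faceClass H σ (s i).swap = q := by
          intro i
          have h5 := h.mem t h2 (idx t - i)
          have h6 := h.cls t h2 (idx t - i)
          rw [show idx t - (i : ZMod p) + 1 = idx t + 1 - i by ring] at h5 h6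
          exact ⟨h5, h6⟩
        have hs' : ∀ i, s i ∉ M := fun i h5 => h.rev _ h5 (hs i).1
        have hlastS : s (k - 1) = (T q (idx e + 1 + 1), T q (idx e + 1)) := by
          have h5 : ((k - 1 : ℕ) : ZMod p) = idx t - idx e - 1 := by
            rw [Nat.cast_sub (by omega), hkcast]; simp
          simp only [s, h5]
          congr 2 <;> ring
        have hjoin : ∀ x ∈ ((List.range k).map s).getLast?, ∀ y ∈ W.head?, Step x y := by
          intro x hx y hy
          rw [List.getLast?_map, List.getLast?_range, if_neg (by omega)] at hx
          simp only [Option.map_some, Option.mem_def, Option.some.injEq] at hx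
          subst hx
          have h5 := ((hhead y hy).2 h3).1
          refine ⟨?_, fun h6 => ?_⟩
          · rw [h5, hlastS, heq2]
          · exact (hW y (List.mem_of_mem_head? hy)).2 (h6 ▸ (hs _).1)
        refine ⟨(List.range k).map s ++ W, ?_, ?_, ?_, ?_, ?_, ?_, ?_, ?_⟩
        · rw [List.length_append, hlen, h.corner_of_mem h2 h3, turnLength, if_neg hidx]
          simp [dartLength, ← ht, h2, ← hk]
        · intro x hx
          rcases List.mem_append.1 hx with h5 | h5
          · obtain ⟨i, -, rfl⟩ := List.mem_map.1 h5
            have := (h.adj (hs i).1).symm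
            exact ⟨this, hs' i⟩
          · exact hW x h5
        · rw [List.isChain_append]
          refine ⟨?_, hchain, hjoin⟩
          rw [List.isChain_map, List.isChain_range]
          intro i _
          refine ⟨?_, fun h5 => hs' (i + 1) (h5 ▸ (hs i).1)⟩
          simp only [s, Nat.succ_eq_add_one]
          congr 1
          push_cast; ring
        · intro q' U hU hUq
          rcases List.infix_append_iff.1 hU with h5 | h5 | ⟨U1, U2, rfl, h5, h6⟩
          · have := h5.length_le
            simp only [List.length_map, List.length_range] at this
            omega
          · exact hshort q' U h5 hUq
          · by_cases hU2 : U2 = []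
            · subst hU2
              have := h5.length_le
              simp only [List.length_map, List.length_range] at this
              simp; omega
            by_cases hU1 : U1 = []
            · subst hU1
              exact hshort q' U2 h6.isInfix (by simpa using hUq)
            -- A stretch along one ring cannot extend beyond the corner: the next dart would have to
            -- be the reversal of `e`.
            exfalso
            obtain ⟨y, U2', rfl⟩ := List.exists_cons_of_ne_nil hU2
            obtain ⟨x, U1', rfl⟩ := List.exists_cons_of_ne_nil hU1
            obtain ⟨W', rfl⟩ := h6
            have h7 := (hUq x (by simp)).2
            have h8 := h5.subset (List.mem_cons_self (a := x))
            obtain ⟨i, -, rfl⟩ := List.mem_map.1 h8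
            rw [(hs i).2] at h7
            obtain ⟨h9, h10⟩ := hUq y (by simp)
            obtain ⟨h11, h12⟩ := (hhead y (by simp)).2 h3
            have h13 := h.eq _ h9
            rw [h10, ← h7] at h13
            have h14 : y.1 = T q (idx y.swap + 1) := congrArg Prod.snd h13
            rw [h11, heq2] at h14
            have h15 := (h.isRing t h2).inj h14
            have h16 : y.swap = e := by
              rw [h13, ← add_right_cancel h15]; exact heq.symm
            apply h12
            rw [← h16, Prod.swap_swap]
        · intro x hx
          rw [List.head?_append, List.head?_map] at hx
          have h5 : (List.range k).head? = some 0 := by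
            rw [List.head?_range, if_neg (by omega)]
          rw [h5] at hx
          simp only [Option.map_some, Option.some_or, Option.mem_def, Option.some.injEq] at hx
          subst hx
          refine ⟨fun _ => ?_, fun h6 => absurd h6 h1⟩
          rw [hd']
          simp [s]
        · intro x hx
          rw [List.getLast?_append] at hx
          rcases hW' : W.getLast? with _ | y
          · rw [hW', List.getLast?_map, List.getLast?_range, if_neg (by omega)] at hx
            simp only [Option.map_some, Option.none_or, Option.mem_def, Option.some.injEq] at hx
            subst hx
            rw [hnil (List.getLast?_eq_none_iff.1 hW'), if_pos h3, hlastS, heq2]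
          · rw [hW'] at hx
            simp only [Option.some_or, Option.mem_def, Option.some.injEq] at hx
            subst hx
            exact hlast _ hW'
        · intro h5
          have := congrArg List.length h5
          simp at this
          omega
        · intro h5
          have := congrArg List.length h5
          simp at this
          omega
      · obtain ⟨h3, h4⟩ := h.fst_of_node_eq h2 hn
        have h4' : e.1 = d.2 := by
          rw [hrev] at h4
          exact h4.symm
        rw [hrev] at he
        refine ⟨d :: W, ?_, ?_, ?_, hcons d W h2 hadj hshort, by simp [h1], ?_, by simp, by simp⟩
        · rw [h.corner_of_notMem h2]
          simp [dartLength, h1, h2, hlen, add_comm]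
        · intro x hx
          rcases List.mem_cons.1 hx with rfl | hx
          · exact ⟨hadj, h1⟩
          · exact hW x hx
        · rw [List.isChain_cons]
          refine ⟨fun y hy => ?_, hchain⟩
          rw [(hhead y hy).1 h3]
          exact ⟨h4'.symm, he⟩
        · intro x hx
          rw [List.getLast?_cons] at hx
          rcases hW' : W.getLast? with _ | y
          · rw [hW'] at hx
            simp only [Option.getD_none, Option.mem_def, Option.some.injEq] at hx
            subst hx
            rw [hnil (List.getLast?_eq_none_iff.1 hW'), if_neg h3, h4']
          · rw [hW'] at hx
            simp only [Option.getD_some, Option.mem_def, Option.some.injEq] at hx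
            subst hx
            exact hlast _ hW'

/-- A closed walk that does not follow a ring all around is long. -/
theorem le_length_of_closed (h : IsHubSystem H σ M T idx) (hp : 3 ≤ p) (hodd : Odd p)
    (hG : H.CyclesGood p L) (hL : 2 * p ≤ L)
    {W : List (V × V)} (hne : W ≠ [])
    (hW : ∀ x ∈ W, H.Adj x.1 x.2 ∧ x ∉ M) (hchain : W.IsChain Step)
    (hshort : HubShort H σ p M W) (hclosed : (W.getLast hne).2 = (W.head hne).1) :
    L ≤ W.length := by
  have hm : 0 < W.length := List.length_pos_iff.2 hne
  let x : ℕ → V × V := fun i => W.getD i (W.head hne)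
  have hx : ∀ i (hi : i < W.length), x i = W[i] := by
    intro i hi
    simp [x, hi]
  have hxW : ∀ i < W.length, x i ∈ W := by
    intro i hi
    rw [hx i hi]; exact List.getElem_mem hi
  have hstep : ∀ i, i + 1 < W.length → Step (x i) (x (i + 1)) := by
    intro i hi
    rw [hx i (by omega), hx _ hi]
    exact List.isChain_iff_getElem.1 hchain i hi
  obtain ⟨i, k, hik, hk3, hinj, hcl⟩ := exists_cycle_of_closed_walk (H := H) hm x
    (fun i hi => (hW _ (hxW i hi)).1) hstep (by
      rw [hx _ (by omega), hx _ hm, ← List.getLast_eq_getElem hne, ← List.head_eq_getElem hne]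
      exact hclosed)
  have hgood := hG k (fun j => (x (i + j)).1) hk3 hinj (fun j hj => by
      have h1 := (hW _ (hxW (i + j) (by omega))).1
      rwa [(hstep (i + j) (by omega)).1] at h1) (by
      have h1 := (hW _ (hxW (i + (k - 1)) (by omega))).1
      rwa [hcl] at h1)
  rcases hgood with rfl | hgood
  swap
  · omega
  -- The cycle found is a ring. Its darts are unmarked, so their reversals are marked, and all of
  -- these belong to one face; the walk thus follows that ring all around, contrary to `hshort`.
  exfalso
  obtain ⟨hring, hnext⟩ := isRing_of_walk (H := H) (p := k) hk3 (x := x) (i := i)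
    (fun j hj => (hW _ (hxW (i + j) (by omega))).1)
    (fun j hj => (hstep (i + j) (by omega)).1) hinj hcl
  set U : ZMod k → V := fun j : ZMod k => (x (i + j.val)).1 with hU
  have hxU : ∀ j < k, x (i + j) = (U (j : ZMod k), U ((j : ZMod k) + 1)) := by
    intro j hj
    ext
    · simp [hU, ZMod.val_natCast, Nat.mod_eq_of_lt hj]
    · exact hnext j hj
  have hswap : ∀ j < k, (x (i + j)).swap ∈ M := by
    intro j hj
    have h1 := (hW _ (hxW (i + j) (by omega))).2
    have h2 := h.cover U hring j
    rw [hxU j hj] at h1 ⊢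
    exact h2.resolve_left h1
  have h0 := hswap 0 (by omega)
  set d := (x (i + 0)).swap with hd
  have hd2 : d = (U (0 + 1), U 0) := by
    have := hxU 0 (by omega)
    rw [hd, this]; simp
  have h01 : (0 : ZMod k) ≠ 1 := by
    intro h
    have := natCast_inj_of_lt (p := k) (a := 0) (b := 1) (by omega) (by omega) (by exact_mod_cast h)
    omega
  have heq := h.eq d h0
  have hr1 : U 0 ∈ Set.range (T (faceClass H σ d)) := by
    refine ⟨idx d + 1, ?_⟩
    · have := congrArg Prod.snd heq
      rw [hd2] at this
      rw [hd2]
      exact this.symm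
  have hr2 : U 1 ∈ Set.range (T (faceClass H σ d)) := by
    refine ⟨idx d, ?_⟩
    · have := congrArg Prod.fst heq
      rw [hd2] at this
      rw [hd2]
      rw [zero_add] at this ⊢
      exact this.symm
  have hcls : ∀ j < k, faceClass H σ (x (i + j)).swap = faceClass H σ d := by
    intro j hj
    have h1 := hswap j hj
    have h1' := (hW _ (hxW (i + j) (by omega))).2
    obtain ⟨b, ⟨h2, h3⟩ | ⟨h2, h3⟩⟩ := (h.isRing d h0).edge_of_two_common hring hG hL hodd h01
      hr1 hr2 j
    · exfalso
      apply h1'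
      rw [hxU j hj, h2, h3]
      exact h.mem d h0 b
    · rw [hxU j hj, h2, h3]
      exact h.cls d h0 b
  have := hshort (faceClass H σ d) ((W.drop i).take k)
    ((List.take_prefix _ _).isInfix.trans (List.drop_suffix _ _).isInfix) (by
      intro y hy
      rw [List.mem_take_iff_getElem] at hy
      obtain ⟨j, hj, rfl⟩ := hy
      simp only [List.length_drop] at hj
      rw [List.getElem_drop, ← hx (i + j) (by omega)]
      exact ⟨hswap j (by omega), hcls j (by omega)⟩)
  rw [List.length_take, List.length_drop] at this
  omega

/-- A run that closes at a vertex expands to a closed walk. If it closes at a hub, the last dart is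
prepended, so that the closing corner is expanded into ring steps as well. -/
theorem le_run (hp : 3 ≤ p) (hodd : Odd p) (hG : H.CyclesGood p L) (hL : 2 * p ≤ L)
    {a f : V × V} {m : ℕ} (hr : h.network.Run (dartRev H) (dartLength H M) a f m)
    (hn : h.network.node (dartRev H f) = h.network.node a) (hne : a ≠ dartRev H f) :
    L ≤ m + h.network.corner (dartRev H f) a := by
  classical
  have main : ∀ {a f m}, h.network.Run (dartRev H) (dartLength H M) a f m → a ∉ M →
      (if dartRev H f ∈ M then f.1 else f.2) = a.1 → (dartRev H f ∈ M → 0 < m) → L ≤ m := by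
    intro a f m hr ha hclosed hpos
    obtain ⟨W, hlen, hW, hchain, hshort, hhead, hlast, hnil, hnil'⟩ := h.exists_walk hp hr
    have hne : W ≠ [] := by
      rintro rfl
      have := hpos (hnil' rfl ha)
      simp at hlen
      omega
    rw [← hlen]
    refine h.le_length_of_closed hp hodd hG hL hne hW hchain hshort ?_
    rw [hlast _ (List.getLast_mem_getLast? hne), hclosed, (hhead _ (List.head_mem_head? hne)).1 ha]
  have hflive : ∀ {a f m}, h.network.Run (dartRev H) (dartLength H M) a f m → dartRev H f ≠ f := by
    intro a f m hr
    induction hr with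
    | single d hd => exact hd
    | cons _ _ _ _ _ _ _ _ ih => exact ih
  have hf := hflive hr
  by_cases h1 : dartRev H f ∈ M
  · obtain ⟨h2, -⟩ := h.mem_of_node_eq h1 hn
    have h3 : f ∉ M := by
      have := h.rev_notMem h1
      rwa [dartRev_dartRev] at this
    have hr' := NetworkData.Run.cons f a f m hf hn hne hr
    have h4 := h.corner_of_mem h1 h2
    have h5 := turnLength_pos (idx (dartRev H f) - idx a)
    have := main hr' h3 (by rw [if_pos h1]) (fun _ => by omega)
    have h6 : dartLength H M f = 0 := by simp [dartLength, h1]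
    omega
  · obtain ⟨h2, h3⟩ := h.fst_of_node_eq h1 hn
    rw [h.corner_of_notMem h1, add_zero]
    refine main hr h2 ?_ (fun h4 => absurd h4 h1)
    rw [if_neg h1, ← h3, dartRev_of_adj (dartRev_ne_iff.1 hf)]
    rfl

end network

end IsHubSystem

end SimpleGraph

/-! ### Coloring when every ring bounds a face. -/

namespace SimpleGraph

variable {V : Type*} {H : SimpleGraph V} {p L : ℕ}

theorem exists_unit_eq_or {p : ℕ} (a : ℤˣ) :
    (((a : ℤ) : ZMod p) = 1) ∨ (((a : ℤ) : ZMod p) = -1) := by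
  rcases Int.units_eq_one_or a with rfl | rfl <;> simp

namespace IsHubSystem

variable {σ : Perm (V × V)} {M : Set (V × V)}
  {T : Quotient (Perm.SameCycle.setoid (σ * dartRev H)) → ZMod p → V} {idx : V × V → ZMod p}

open scoped Classical in
/-- The admissible color differences. -/
noncomputable def steps (H : SimpleGraph V) (p : ℕ) (M : Set (V × V)) (d : V × V) :
    Finset (ZMod p) :=
  if d ∈ M ∨ dartRev H d ∈ M then {0} else {1, -1}

theorem dartLength_rev (d : V × V) : dartLength H M (dartRev H d) = dartLength H M d := by
  unfold dartLength
  rw [dartRev_dartRev]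
  congr 1
  exact propext or_comm

-- Freedom and length agree here: a spoke has only the difference `0` and length zero, an ordinary
-- edge has the differences `1` and `-1` and length one. Consecutive spokes of a hub are one ring
-- step apart, so the corners at a hub sum to at most `p`.
open scoped Classical in
theorem valid [NeZero p] [Fintype V] (h : IsHubSystem H σ M T idx) (hm : H.IsMap σ) (hp : 3 ≤ p)
    (hodd : Odd p) (hG : H.CyclesGood p L) (hL : 2 * p ≤ L) :
    h.network.Valid L h.rot (dartRev H) (dartLength H M) (dartLength H M) (steps H p M) where
  invol := dartRev_dartRev
  node_rot d := by
    by_cases hd : d ∈ M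
    · rw [h.node_of_mem hd, h.node_of_mem (h.rot_mem_iff.2 hd), h.rot_class hd]
    · rw [h.node_of_notMem hd, h.node_of_notMem (fun h1 => hd (h.rot_mem_iff.1 h1)),
        h.rot_fst hm hd]
  fixed d hd := by
    have hadj : ¬ H.Adj d.1 d.2 := fun h1 => dartRev_ne_iff.2 h1 hd
    have h1 : d ∉ M := fun h1 => hadj (h.adj h1)
    have h2 := hm.fixed d hadj
    rw [h.rot_of_rot_notMem h1 (by rwa [h2]), h2]
  sameCycle d e hd he hn := by
    by_cases h1 : d ∈ M
    · obtain ⟨h2, h3⟩ := h.mem_of_node_eq h1 hn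
      exact h.sameCycle_rot_mem h1 h3
    · obtain ⟨h2, h3⟩ := h.fst_of_node_eq h1 hn
      exact h.sameCycle_rot_notMem h1 h2
        (hm.sameCycle d e (dartRev_ne_iff.1 hd) (dartRev_ne_iff.1 he) h3)
  spherical := h.spherical_rot hm
  n_symm d _ := dartLength_rev d
  n_lt d _ := by
    unfold dartLength
    split_ifs <;> omega
  l_le d _ := by
    rw [dartLength_rev]
    nlinarith
  S_symm d _ t := by
    simp only [steps, dartRev_dartRev, or_comm]
    split_ifs
    · simp
    · simp only [Finset.mem_insert, Finset.mem_singleton]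
      rw [neg_eq_iff_eq_neg, neg_inj, or_comm]
  S_card d _ := by
    unfold dartLength steps
    split_ifs
    · simp
    · rw [Finset.card_pair]
      · norm_num
      · intro h1
        apply IsRing.two_ne_zero hp
        linear_combination h1
  corner_sum x := by
    rcases x with v | q
    · rw [Finset.sum_eq_zero]
      · exact Nat.zero_le _
      intro d hd
      rw [NetworkData.mem_liveAt] at hd
      apply h.corner_of_notMem
      intro h1
      rw [h.node_of_mem h1] at hd
      cases hd.2
    · have hq : ∀ d ∈ h.network.liveAt (dartRev H) (Sum.inr q), d ∈ M ∧ faceClass H σ d = q := by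
        intro d hd
        rw [NetworkData.mem_liveAt] at hd
        by_cases h1 : d ∈ M
        · rw [h.node_of_mem h1] at hd
          exact ⟨h1, Sum.inr_injective hd.2⟩
        · rw [h.node_of_notMem h1] at hd
          cases hd.2
      rw [Finset.sum_congr rfl (g := fun _ => 1)]
      · rw [Finset.sum_const, smul_eq_mul, mul_one]
        change _ ≤ p * 1
        rw [mul_one]
        conv_rhs => rw [← ZMod.card p, ← Finset.card_univ]
        apply Finset.card_le_card_of_injOn idx (fun _ _ => Finset.mem_coe.2 (Finset.mem_univ _))
        intro d hd e he hde
        have h1 := hq d hd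
        have h2 := hq e he
        exact h.ext_of_class h1.1 h2.1 (h1.2.trans h2.2.symm) hde
      · intro d hd
        have h1 := (hq d hd).1
        rw [h.corner_of_mem h1 (h.rot_mem_iff.2 h1), h.idx_rot h1, add_sub_cancel_left, turnLength]
        have : Fact (1 < p) := ⟨by omega⟩
        rw [if_neg one_ne_zero, ZMod.val_one]
  run_le a f m hr hn hne := h.le_run hp hodd hG hL hr hn hne

end IsHubSystem

/-- If all rings bound faces, then the coloring of a ring extends. -/
theorem exists_coloring_of_facial [Finite V] [Fact p.Prime] {σ : Perm (V × V)} (hm : H.IsMap σ)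
    (hp : 3 ≤ p) (hG : H.CyclesGood p L) (hL : 2 * p * p ≤ L + p)
    (hfac : ∀ T : ZMod p → V, H.IsRing T → IsFacial σ T ∨ IsFacial σ fun i => T (-i))
    {C : ZMod p → V} (hC : H.IsRing C) (s : ZMod p) (ε : ℤˣ) :
    ∃ f : V → ZMod p, (∀ u v, H.Adj u v → f v - f u = 1 ∨ f v - f u = -1) ∧
      ∀ i, f (C i) = s + ((ε : ℤ) : ZMod p) * i := by
  classical
  have := Fintype.ofFinite V
  have hodd : Odd p := (Fact.out : p.Prime).odd_of_ne_two (by omega)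
  have hL2 : 2 * p ≤ L := by nlinarith
  obtain ⟨M, T, idx, h⟩ := exists_hubSystem hG hL2 hp hodd hfac
  have hval := h.valid hm hp hodd hG hL2
  have h01 : (0 : ZMod p) ≠ 1 := zero_ne_one
  obtain ⟨d, hd, hd0, hd1⟩ : ∃ d ∈ M, C 0 ∈ Set.range (T (faceClass H σ d)) ∧
      C 1 ∈ Set.range (T (faceClass H σ d)) := by
    rcases h.cover C hC 0 with h1 | h1
    · have h2 := h.eq _ h1
      rw [zero_add] at h1 h2
      exact ⟨_, h1, ⟨_, (congrArg Prod.fst h2).symm⟩, ⟨_, (congrArg Prod.snd h2).symm⟩⟩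
    · have h2 := h.eq _ h1
      rw [zero_add] at h1 h2
      exact ⟨_, h1, ⟨_, (congrArg Prod.snd h2).symm⟩, ⟨_, (congrArg Prod.fst h2).symm⟩⟩
  -- The precolored ring runs once along the ring of some hub, from position `c` in the direction
  -- `ε'`.
  obtain ⟨ε', c, hc⟩ := (h.isRing d hd).exists_unit (by omega) hC
    (fun k => (h.isRing d hd).edge_of_two_common hC hG hL2 hodd h01 hd0 hd1 k)
  -- The spoke of index `j` ends at position `j + 1` of the ring, hence `c - 1`; the product of the
  -- signs translates from the direction of `C` to that of the hub.
  obtain ⟨g, hg, hroot⟩ := hval.exists_colors (by omega) hL (Sum.inr (faceClass H σ d))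
    (s - (((ε * ε' : ℤˣ) : ℤ) : ZMod p) * (c - 1), ε * ε')
  have hhub : ∀ e ∈ M, (g (Sum.inl e.2)).1 = (g (Sum.inr (faceClass H σ e))).1 +
      (((g (Sum.inr (faceClass H σ e))).2 : ℤ) : ZMod p) * idx e := by
    intro e he
    have h1 := hg e (dartRev_ne_iff.2 (h.adj he))
    have h2 := h.rev_notMem he
    rw [IsHubSystem.steps, if_pos (Or.inl he), Finset.mem_singleton, sub_eq_zero,
      NetworkData.read, NetworkData.read, h.node_of_mem he, h.node_of_notMem h2, h.rev_eq he] at h1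
    rw [h.rev_eq he] at h2
    simpa [IsHubSystem.network, he, h2] using h1
  -- The ends of a ring edge are read off two consecutive spokes, so their colors differ by the sign
  -- of the hub.
  have hmark : ∀ e ∈ M, (g (Sum.inl e.2)).1 - (g (Sum.inl e.1)).1 =
      (((g (Sum.inr (faceClass H σ e))).2 : ℤ) : ZMod p) := by
    intro e he
    have h1 := hhub e he
    have h2 := h.mem e he (idx e - 1)
    have h3 := hhub _ h2
    rw [h.cls e he, h.idx_eq he] at h3
    simp only [sub_add_cancel] at h3
    have h4 : e.1 = T (faceClass H σ e) (idx e) := congrArg Prod.fst (h.eq e he)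
    rw [h1, h4, h3]
    ring
  refine ⟨fun v => (g (Sum.inl v)).1, ?_, ?_⟩
  · intro u v huv
    by_cases h1 : (u, v) ∈ M
    · have := hmark _ h1
      simp only at this
      rw [this]
      exact exists_unit_eq_or _
    · by_cases h2 : (v, u) ∈ M
      · have := hmark _ h2
        simp only at this ⊢
        rw [← neg_sub, this]
        rcases exists_unit_eq_or (p := p) (g (Sum.inr (faceClass H σ (v, u)))).2 with h3 | h3
        · right; rw [h3]
        · left; rw [h3, neg_neg]
      · have h3 := hg (u, v) (dartRev_ne_iff.2 huv)
        have h4 : dartRev H (u, v) = (v, u) := dartRev_of_adj huv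
        rw [IsHubSystem.steps, h4, if_neg (by tauto), NetworkData.read, NetworkData.read,
          h.node_of_notMem h1, h.node_of_notMem h2] at h3
        simpa [IsHubSystem.network, h1, h2] using h3
  · intro i
    have h1 := h.mem d hd (c + ((ε' : ℤ) : ZMod p) * i - 1)
    have h2 := hhub _ h1
    rw [h.cls d hd, h.idx_eq hd, hroot] at h2
    simp only [sub_add_cancel] at h2
    rw [hc i]
    simp only [h2]
    have h3 : ((ε' : ℤ) : ZMod p) * ((ε' : ℤ) : ZMod p) = 1 := by
      rcases exists_unit_eq_or (p := p) ε' with h4 | h4 <;> rw [h4] <;> ring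
    push_cast
    linear_combination ((ε : ℤ) : ZMod p) * i * h3

end SimpleGraph

/-! ### Homology modulo two on the sphere. -/

namespace Setoid

variable {D : Type*} (K : Type*) [Field K]

/-- The functions that are constant on the classes of a setoid. -/
def invariants (r : Setoid D) : Submodule K (D → K) :=
  LinearMap.range (LinearMap.funLeft K K (Quotient.mk r))

variable {K}

theorem mem_invariants {r : Setoid D} {w : D → K} :
    w ∈ r.invariants K ↔ r ≤ Setoid.ker w := by
  constructor
  · rintro ⟨g, rfl⟩ a b hab
    exact congrArg g (Quotient.sound hab)
  · intro h
    exact ⟨Quotient.lift w fun a b hab => h hab, rfl⟩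

theorem invariants_inf (r s : Setoid D) :
    r.invariants K ⊓ s.invariants K = (r ⊔ s).invariants K := by
  ext w
  rw [Submodule.mem_inf, mem_invariants, mem_invariants, mem_invariants, sup_le_iff]

theorem finrank_invariants [Finite D] (r : Setoid D) :
    Module.finrank K (r.invariants K) = Nat.card (Quotient r) := by
  have := Fintype.ofFinite (Quotient r)
  rw [invariants, LinearMap.finrank_range_of_inj
    (LinearMap.funLeft_injective_of_surjective _ _ _ Quotient.mk_surjective),
    Module.finrank_fintype_fun_eq_card, Nat.card_eq_fintype_card]

end Setoid

namespace Equiv.Perm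

variable {D : Type*}

theorem mem_invariants_setoid {K : Type*} [Field K] [Finite D] {f : Perm D} {w : D → K} :
    w ∈ (SameCycle.setoid f).invariants K ↔ ∀ d, w (f d) = w d := by
  rw [Setoid.mem_invariants, setoid_le_iff]
  exact forall_congr' fun d => eq_comm

/-- On a sphere, a function on the darts that is orthogonal to all vertex coboundaries has the same
boundary as a function on the faces. -/
theorem Spherical.exists_cut [Fintype D] {f g : Perm D} (hs : Spherical f g)
    (hg : ∀ d, g (g d) = d) (u : D → ZMod 2)
    (hu : ∀ w : D → ZMod 2, (∀ d, w (f d) = w d) → ∑ d, u d * (w d + w (g d)) = 0) :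
    ∃ s : D → ZMod 2, (∀ d, s ((f * g) d) = s d) ∧ ∀ d, s d + s (g d) = u d + u (g d) := by
  classical
  let K := ZMod 2
  let A : Submodule K (D → K) := (SameCycle.setoid (f * g)).invariants K
  let B : Submodule K (D → K) := (SameCycle.setoid g).invariants K
  let C : Submodule K (D → K) := (SameCycle.setoid f).invariants K
  let N : (D → K) →ₗ[K] (D → K) := LinearMap.id + LinearMap.funLeft K K g
  have hN : ∀ w d, N w d = w d + w (g d) := fun w d => rfl
  -- `W` consists of the coboundaries of vertex functions and `U` of the functions orthogonal to
  -- them; `A`, `B` and `C` are the functions on faces, edges and vertices.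
  let W : Submodule K (D → K) := C.map N
  let U : Submodule K (D → K) :=
    W.dualAnnihilator.map (dotProductEquiv K D).symm.toLinearMap
  have hU : ∀ v, v ∈ U ↔ ∀ w : D → K, (∀ d, w (f d) = w d) → ∑ d, v d * (w d + w (g d)) = 0 := by
    intro v
    have h1 : v ∈ U ↔ dotProductEquiv K D v ∈ W.dualAnnihilator := by
      constructor
      · rintro ⟨y, hy, rfl⟩
        simpa using hy
      · intro h
        exact ⟨_, h, by simp⟩
    rw [h1, Submodule.mem_dualAnnihilator]
    constructor
    · intro h w hw
      exact h (N w) ⟨w, mem_invariants_setoid.2 hw, rfl⟩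
    · rintro h _ ⟨w, hw, rfl⟩
      exact h w (mem_invariants_setoid.1 hw)
  have hkerN : LinearMap.ker N = B := by
    ext w
    rw [LinearMap.mem_ker, mem_invariants_setoid]
    constructor
    · intro h d
      have := congrFun h d
      rw [hN, Pi.zero_apply, CharTwo.add_eq_zero] at this
      exact this.symm
    · intro h
      funext d
      rw [hN, Pi.zero_apply, CharTwo.add_eq_zero, h]
  -- A vertex function with zero coboundary is constant on components.
  have hW : cycleCount f ≤ Module.finrank K W + orbitCount f g := by
    have h1 := LinearMap.finrank_range_add_finrank_ker (N.domRestrict C)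
    rw [LinearMap.range_domRestrict, LinearMap.ker_domRestrict, hkerN] at h1
    have h2 := Submodule.finrank_map_subtype_eq C (B.comap C.subtype)
    rw [Submodule.map_comap_subtype, Setoid.invariants_inf, Setoid.finrank_invariants] at h2
    have h3 : Module.finrank K C = cycleCount f := Setoid.finrank_invariants _
    have h4 : orbitCount f g = Module.finrank K (B.comap C.subtype) := h2
    change Module.finrank K W + _ = _ at h1
    omega
  have hUdim : Module.finrank K W + Module.finrank K U = Nat.card D := by
    have h1 := Subspace.finrank_add_finrank_dualAnnihilator_eq W
    rw [Module.finrank_fintype_fun_eq_card] at h1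
    have h2 : Module.finrank K U = Module.finrank K W.dualAnnihilator :=
      LinearEquiv.finrank_map_eq _ _
    rw [h2, h1, Nat.card_eq_fintype_card]
  have hAB : Module.finrank K ↥(A ⊔ B) + orbitCount f g = cycleCount (f * g) + cycleCount g := by
    have h1 := Submodule.finrank_sup_add_finrank_inf_eq A B
    rw [Setoid.invariants_inf, Setoid.finrank_invariants, Setoid.finrank_invariants,
      Setoid.finrank_invariants] at h1
    have h2 : SameCycle.setoid (f * g) ⊔ SameCycle.setoid g =
        SameCycle.setoid f ⊔ SameCycle.setoid g := by
      apply le_antisymm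
      · refine sup_le (setoid_le_iff.2 fun a => ?_) le_sup_right
        exact Setoid.trans' _ (setoid_le_iff.1 le_sup_right a) (setoid_le_iff.1 le_sup_left (g a))
      · refine sup_le (setoid_le_iff.2 fun a => ?_) le_sup_right
        have h3 := setoid_le_iff.1 (le_sup_left :
          SameCycle.setoid (f * g) ≤ SameCycle.setoid (f * g) ⊔ SameCycle.setoid g) (g a)
        have h4 := setoid_le_iff.1 (le_sup_right :
          SameCycle.setoid g ≤ SameCycle.setoid (f * g) ⊔ SameCycle.setoid g) a
        rw [mul_apply, hg] at h3
        exact Setoid.trans' _ h4 h3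
    rw [h2] at h1
    exact h1
  have hAU : A ≤ U := by
    intro v hv
    rw [hU]
    intro w hw
    have hv' : ∀ d, v (g d) = v (f d) := by
      intro d
      have := mem_invariants_setoid.1 hv (g d)
      rw [mul_apply, hg] at this
      exact this.symm
    have h1 : ∑ d, v d * w (g d) = ∑ d, v (g d) * w d := by
      apply Fintype.sum_equiv g
      intro d; rw [hg]
    have h2 : ∑ d, v (g d) * w d = ∑ d, v d * w d := by
      rw [← Equiv.sum_comp f (fun d => v d * w d)]
      exact Finset.sum_congr rfl fun d _ => by rw [hv', hw]
    simp_rw [mul_add]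
    rw [Finset.sum_add_distrib, h1, h2, CharTwo.add_self_eq_zero]
  have hBU : B ≤ U := by
    intro v hv
    rw [hU]
    intro w hw
    have h1 : ∑ d, v d * w (g d) = ∑ d, v d * w d := by
      apply Fintype.sum_equiv g
      intro d; rw [mem_invariants_setoid.1 hv]
    simp_rw [mul_add]
    rw [Finset.sum_add_distrib, h1, CharTwo.add_self_eq_zero]
  -- The dimension of `U` is at most `D - V + c`, with `c` the number of components; sphericity
  -- bounds this by `F + E - c`, the dimension of `A ⊔ B`.
  have heq : A ⊔ B = U := by
    apply Submodule.eq_of_le_of_finrank_le (sup_le hAU hBU)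
    unfold Spherical at hs
    omega
  have hmem : u ∈ A ⊔ B := by
    rw [heq, hU]; exact hu
  obtain ⟨s, hsA, w, hw, rfl⟩ := Submodule.mem_sup.1 hmem
  refine ⟨s, mem_invariants_setoid.1 hsA, fun d => ?_⟩
  rw [Pi.add_apply, Pi.add_apply, mem_invariants_setoid.1 hw]
  have := CharTwo.add_self_eq_zero (w d)
  linear_combination -this

end Equiv.Perm

/-! ### Subgraphs of embedded graphs and the two sides of a ring. -/

namespace SimpleGraph

variable {V : Type*} {H : SimpleGraph V} {p L : ℕ}

theorem fst_remove [Finite V] {σ : Perm (V × V)} [DecidableEq (V × V)] (h : ∀ d, (σ d).1 = d.1)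
    (d x : V × V) : (Perm.remove σ d x).1 = x.1 := by
  rcases eq_or_ne x d with rfl | hx
  · rw [Perm.remove_apply_self]
  by_cases h1 : σ x = d
  · rw [Perm.remove_apply_of_apply_eq hx h1, h, ← h1, h]
  · rw [Perm.remove_apply_of_ne hx h1, h]

theorem remove_apply_of_apply_self {D : Type*} [Finite D] [DecidableEq D] {σ : Perm D} {d x : D}
    (h : σ x = x) : Perm.remove σ d x = x := by
  rcases eq_or_ne x d with rfl | hx
  · rw [Perm.remove_apply_self]
  · rw [Perm.remove_apply_of_ne hx (by rwa [h]), h]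

/-- Deleting an edge from an embedded graph. -/
theorem IsMap.deleteEdge [Finite V] {σ : Perm (V × V)} (h : H.IsMap σ) {d : V × V}
    (hd : H.Adj d.1 d.2) : ∃ σ', (H.deleteEdges {s(d.1, d.2)}).IsMap σ' := by
  classical
  have hne : d.swap ≠ d := by
    rw [← dartRev_of_adj hd]; exact dartRev_ne_iff.2 hd
  have hadj : ∀ x : V × V, (H.deleteEdges {s(d.1, d.2)}).Adj x.1 x.2 ↔
      H.Adj x.1 x.2 ∧ x ≠ d ∧ x ≠ d.swap := by
    rintro ⟨x, y⟩
    obtain ⟨a, b⟩ := d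
    simp only [deleteEdges_adj, Set.mem_singleton_iff, Sym2.eq_iff, ne_eq, Prod.mk.injEq,
      Prod.swap_prod_mk, not_or]
  have hrev : dartRev (H.deleteEdges {s(d.1, d.2)}) = Perm.remove (dartRev H) d := by
    ext1 x
    by_cases hx : x = d ∨ x = d.swap
    · rw [dartRev_of_not_adj (by rw [hadj]; tauto)]
      rcases hx with rfl | rfl
      · rw [Perm.remove_apply_self]
      · have h1 : dartRev H d.swap = d := by rw [dartRev_of_adj (by exact hd.symm), Prod.swap_swap]
        rw [Perm.remove_apply_of_apply_eq hne h1, dartRev_of_adj hd]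
    · push Not at hx
      have h1 : dartRev H x ≠ d := by
        intro h1
        apply hx.2
        rw [← dartRev_of_adj hd, ← h1, dartRev_dartRev]
      rw [Perm.remove_apply_of_ne hx.1 h1]
      by_cases h2 : H.Adj x.1 x.2
      · rw [dartRev_of_adj h2, dartRev_of_adj ((hadj x).2 ⟨h2, hx⟩)]
      · rw [dartRev_of_not_adj h2, dartRev_of_not_adj (by rw [hadj]; tauto)]
  refine ⟨Perm.remove (Perm.remove σ d) d.swap, ?_, ?_, ?_, ?_⟩
  · exact fst_remove (fst_remove h.fst d) d.swap
  · intro x hx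
    rw [hadj] at hx
    by_cases h1 : x = d.swap
    · subst h1; rw [Perm.remove_apply_self]
    · apply remove_apply_of_apply_self
      by_cases h2 : x = d
      · subst h2; rw [Perm.remove_apply_self]
      · apply remove_apply_of_apply_self
        exact h.fixed x (by tauto)
  · intro x y hx hy hxy
    rw [hadj] at hx hy
    exact Perm.sameCycle_remove hx.2.2 hy.2.2
      (Perm.sameCycle_remove hx.2.1 hy.2.1 (h.sameCycle x y hx.1 hy.1 hxy))
  · rw [hrev]
    exact ((h.spherical.remove_left d).remove_left d.swap).remove_right d

theorem IsMap.exists_of_le [Finite V] (H' : SimpleGraph V) (hle : H' ≤ H)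
    (h : ∃ σ, H.IsMap σ) : ∃ σ, H'.IsMap σ := by
  induction H using WellFoundedLT.induction with
  | ind H ih =>
    rcases hle.eq_or_lt with rfl | hlt
    · exact h
    obtain ⟨u, v, huv, huv'⟩ : ∃ u v, H.Adj u v ∧ ¬ H'.Adj u v := by
      by_contra! hno
      exact hlt.not_ge fun u v => hno u v
    obtain ⟨σ, hσ⟩ := h
    refine ih (H.deleteEdges {s(u, v)}) ?_ ?_ (hσ.deleteEdge (d := (u, v)) huv)
    · refine lt_of_le_of_ne (deleteEdges_le _) fun h1 => ?_
      rw [← h1] at huv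
      simp at huv
    · intro a b hab
      rw [deleteEdges_adj]
      refine ⟨hle hab, fun h1 => ?_⟩
      rw [Set.mem_singleton_iff, Sym2.eq_iff] at h1
      rcases h1 with ⟨rfl, rfl⟩ | ⟨rfl, rfl⟩
      · exact huv' hab
      · exact huv' hab.symm

/-- The darts of a ring, in either direction. -/
def RingDart (T : ZMod p → V) (d : V × V) : Prop :=
  ∃ i, d = (T i, T (i + 1)) ∨ d = (T (i + 1), T i)

theorem RingDart.swap {T : ZMod p → V} {d : V × V} (h : RingDart T d) : RingDart T d.swap := by
  obtain ⟨i, rfl | rfl⟩ := h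
  · exact ⟨i, Or.inr rfl⟩
  · exact ⟨i, Or.inl rfl⟩

theorem RingDart.fst_mem {T : ZMod p → V} {d : V × V} (h : RingDart T d) : d.1 ∈ Set.range T := by
  obtain ⟨i, rfl | rfl⟩ := h
  · exact ⟨_, rfl⟩
  · exact ⟨_, rfl⟩

theorem RingDart.snd_mem {T : ZMod p → V} {d : V × V} (h : RingDart T d) : d.2 ∈ Set.range T :=
  h.swap.fst_mem

theorem IsRing.adj_of_ringDart {T : ZMod p → V} (hT : H.IsRing T) {d : V × V} (h : RingDart T d) :
    H.Adj d.1 d.2 := by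
  obtain ⟨i, rfl | rfl⟩ := h
  · exact hT.adj i
  · exact (hT.adj i).symm

theorem IsRing.ringDart_at {T : ZMod p → V} (hT : H.IsRing T) {d : V × V} (h : RingDart T d)
    {i : ZMod p} (hd : d.1 = T (i + 1)) :
    d = (T (i + 1), T i) ∨ d = (T (i + 1), T (i + 1 + 1)) := by
  obtain ⟨j, rfl | rfl⟩ := h
  · right
    rw [hT.inj hd]
  · left
    rw [add_right_cancel (hT.inj hd)]

/-- A ring separates the sphere into two sides. -/
theorem IsRing.exists_sides [Finite V] {σ : Perm (V × V)} (hm : H.IsMap σ) (hp : 3 ≤ p)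
    {T : ZMod p → V} (hT : H.IsRing T) :
    ∃ s : V × V → ZMod 2, (∀ d, H.Adj d.1 d.2 → ¬ RingDart T d → s d.swap = s d) ∧
      (∀ d, ¬ RingDart T d → s (σ d) = s d) ∧
      (∀ d, RingDart T d → s d.swap = s d + 1) ∧
      (∀ d, RingDart T d → s (σ d) = s d + 1) := by
  classical
  have := Fintype.ofFinite V
  have : NeZero p := ⟨by omega⟩
  let P : V × V → Prop := fun d => ∃ i, d = (T i, T (i + 1))
  have hPs : ∀ d, P d → ¬ P d.swap := by
    rintro _ ⟨i, rfl⟩ ⟨j, hj⟩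
    simp only [Prod.swap_prod_mk, Prod.mk.injEq] at hj
    have h1 := hT.inj hj.1
    have h2 := hT.inj hj.2
    apply IsRing.two_ne_zero hp
    linear_combination h1 - h2
  have hring : ∀ d, RingDart T d ↔ P d ∨ P d.swap := by
    intro d
    constructor
    · rintro ⟨i, rfl | rfl⟩
      · exact Or.inl ⟨i, rfl⟩
      · exact Or.inr ⟨i, rfl⟩
    · rintro (⟨i, rfl⟩ | ⟨i, hi⟩)
      · exact ⟨i, Or.inl rfl⟩
      · exact ⟨i, Or.inr (by rw [← Prod.swap_swap d, hi]; rfl)⟩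
  -- The ring as a chain with one dart for each edge; the function `s` obtained from it is constant
  -- on faces and jumps exactly across ring edges.
  let u : V × V → ZMod 2 := fun d => if P d then 1 else 0
  obtain ⟨s, hs1, hs2⟩ := hm.spherical.exists_cut dartRev_dartRev u (by
    intro w hw
    have hsame : ∀ d e : V × V, H.Adj d.1 d.2 → H.Adj e.1 e.2 → d.1 = e.1 → w d = w e := by
      intro d e hd he hde
      have h1 := hm.sameCycle d e hd he hde
      have h2 : w ∈ (Perm.SameCycle.setoid σ).invariants (ZMod 2) :=
        Perm.mem_invariants_setoid.2 hw
      exact Setoid.mem_invariants.1 h2 h1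
    have h1 : ∑ d, u d * (w d + w (dartRev H d)) =
        ∑ i : ZMod p, (w (T i, T (i + 1)) + w (T (i + 1), T i)) := by
      symm
      apply Finset.sum_of_injOn (fun i : ZMod p => (T i, T (i + 1)))
      · intro i _ j _ hij
        exact hT.inj (congrArg Prod.fst hij)
      · intro i _; exact Finset.mem_coe.2 (Finset.mem_univ _)
      · intro d _ hd
        have : ¬ P d := by
          rintro ⟨i, rfl⟩
          exact hd ⟨i, by simp, rfl⟩
        simp [u, this]
      · intro i _
        have : P (T i, T (i + 1)) := ⟨i, rfl⟩
        simp only [u, this, if_true, one_mul]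
        rw [dartRev_of_adj (hT.adj i)]
        rfl
    rw [h1, Finset.sum_add_distrib]
    -- The ring enters and leaves each of its vertices once, and `w` takes the same value on both
    -- darts there.
    have h2 : ∑ i : ZMod p, w (T i, T (i + 1)) = ∑ i : ZMod p, w (T (i + 1), T i) := by
      rw [← Equiv.sum_comp (Equiv.addRight (1 : ZMod p)) (fun i => w (T i, T (i + 1)))]
      apply Finset.sum_congr rfl
      intro i _
      exact hsame _ _ (hT.adj _) (hT.adj i).symm rfl
    rw [h2, CharTwo.add_self_eq_zero])
  have hrot : ∀ d, s (σ d) = s (dartRev H d) := by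
    intro d
    have := hs1 (dartRev H d)
    rwa [Perm.mul_apply, dartRev_dartRev] at this
  have hzero : ∀ d, ¬ RingDart T d → u d = 0 := by
    intro d hd
    rw [hring] at hd
    simp only [u, if_neg (fun h => hd (Or.inl h))]
  have hnr : ∀ d, ¬ RingDart T d → s (dartRev H d) = s d := by
    intro d hd
    have hd' : ¬ RingDart T (dartRev H d) := by
      by_cases h1 : H.Adj d.1 d.2
      · rw [dartRev_of_adj h1]
        exact fun h2 => hd (by simpa using h2.swap)
      · rwa [dartRev_of_not_adj h1]
    have h1 := hs2 d
    rw [hzero d hd, hzero _ hd', add_zero, CharTwo.add_eq_zero] at h1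
    exact h1.symm
  have hr : ∀ d, RingDart T d → s (dartRev H d) = s d + 1 := by
    intro d hd
    have h1 := hs2 d
    have h2 : u d + u (dartRev H d) = 1 := by
      rw [dartRev_of_adj (hT.adj_of_ringDart hd)]
      rcases (hring d).1 hd with h3 | h3
      · simp only [u, if_pos h3, if_neg (hPs d h3), add_zero]
      · have h4 : ¬ P d := fun h4 => hPs d h4 h3
        simp only [u, if_pos h3, if_neg h4, zero_add]
    rw [h2] at h1
    linear_combination h1 - CharTwo.add_self_eq_zero (s d)
  refine ⟨s, fun d h1 hd => ?_, fun d hd => ?_, fun d hd => ?_, fun d hd => ?_⟩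
  · rw [← dartRev_of_adj h1]; exact hnr d hd
  · rw [hrot]; exact hnr d hd
  · rw [← dartRev_of_adj (hT.adj_of_ringDart hd)]; exact hr d hd
  · rw [hrot]; exact hr d hd

end SimpleGraph

/-! ### Cutting along a ring that bounds no face. -/

namespace SimpleGraph

variable {V : Type*} {H : SimpleGraph V} {p L : ℕ}

/-- The part of the graph on one side of a ring, ring included. -/
def side (H : SimpleGraph V) (T : ZMod p → V) (s : V × V → ZMod 2) (b : ZMod 2) :
    SimpleGraph V where
  Adj u v := H.Adj u v ∧ (RingDart T (u, v) ∨ (s (u, v) = b ∧ s (v, u) = b))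
  symm := ⟨fun u v h => ⟨h.1.symm, h.2.imp (fun h1 => h1.swap) And.symm⟩⟩
  loopless := ⟨fun u h => H.loopless.irrefl u h.1⟩

theorem side_le (T : ZMod p → V) (s : V × V → ZMod 2) (b : ZMod 2) : side H T s b ≤ H :=
  fun _ _ h => h.1

section sides

variable [Finite V] {σ : Perm (V × V)} {T : ZMod p → V} {s : V × V → ZMod 2}

/-- Rotating around a vertex off the ring, no ring dart is met, so the side does not change. -/
theorem side_eq_of_notMem (hm : H.IsMap σ) (hrot : ∀ d, ¬ RingDart T d → s (σ d) = s d)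
    {d e : V × V} (hd : H.Adj d.1 d.2) (he : H.Adj e.1 e.2) (hde : d.1 = e.1)
    (hv : d.1 ∉ Set.range T) : s d = s e := by
  obtain ⟨i, -, rfl⟩ := (hm.sameCycle d e hd he hde).exists_pow_eq'
  clear hde he
  have key : ((σ ^ i) d).1 = d.1 ∧ s ((σ ^ i) d) = s d := by
    induction i with
    | zero => exact ⟨rfl, rfl⟩
    | succ i ih =>
      rw [pow_succ', Perm.mul_apply]
      refine ⟨(hm.fst _).trans ih.1, (hrot _ fun h => hv ?_).trans ih.2⟩
      rw [← ih.1]; exact h.fst_mem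
  exact key.2.symm

/-- Rotating at a ring vertex from the dart back to the dart forward, the side changes once, right
after the dart back. Reversing that dart changes it once more. -/
theorem IsRing.side_succ (hm : H.IsMap σ) (hT : H.IsRing T) (hp : 3 ≤ p)
    (hrot : ∀ d, ¬ RingDart T d → s (σ d) = s d)
    (hrev' : ∀ d, RingDart T d → s d.swap = s d + 1)
    (hrot' : ∀ d, RingDart T d → s (σ d) = s d + 1) (i : ZMod p) :
    s (T (i + 1), T (i + 1 + 1)) = s (T i, T (i + 1)) := by
  classical
  set a := (T (i + 1), T i) with ha
  set b := (T (i + 1), T (i + 1 + 1)) with hb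
  have hab : a ≠ b := by
    intro h
    have h1 := hT.inj (congrArg Prod.snd h)
    apply IsRing.two_ne_zero hp
    linear_combination -h1
  have hcyc := hm.sameCycle a b (hT.adj i).symm (hT.adj (i + 1)) rfl
  obtain ⟨n0, -, hn0⟩ := hcyc.exists_pow_eq'
  have hex : ∃ n, (σ ^ n) a = b := ⟨n0, hn0⟩
  obtain ⟨n, hn, hmin⟩ : ∃ n, (σ ^ n) a = b ∧ ∀ m < n, (σ ^ m) a ≠ b :=
    ⟨Nat.find hex, Nat.find_spec hex, fun m hm => Nat.find_min hex hm⟩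
  have hn1 : 1 ≤ n := by
    rw [Nat.one_le_iff_ne_zero]
    rintro rfl
    exact hab hn
  have hfst : ∀ j : ℕ, ((σ ^ j) a).1 = T (i + 1) := by
    intro j
    induction j with
    | zero => rfl
    | succ j ih => rw [pow_succ', Perm.mul_apply, hm.fst, ih]
  have key : ∀ j, 1 ≤ j → j ≤ n → s ((σ ^ j) a) = s (σ a) := by
    intro j hj
    induction j, hj using Nat.le_induction with
    | base => intro _; rw [pow_one]
    | succ j hj ih =>
      intro hjn
      rw [pow_succ', Perm.mul_apply, hrot, ih (by omega)]
      intro hr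
      rcases hT.ringDart_at hr (hfst j) with h1 | h1
      · apply hmin (n - j) (by omega)
        have h2 := hn
        rw [show n = (n - j) + j by omega, pow_add, Perm.mul_apply, h1] at h2
        exact h2
      · exact hmin j (by omega) h1
  have h1 := key n hn1 le_rfl
  have har : RingDart T a := ⟨i, Or.inr rfl⟩
  rw [hn, hrot' a har, ← hrev' a har] at h1
  exact h1

end sides

/-- In a planar graph without short cycles apart from those of length `p`, the coloring of a cycle
of length `p` extends. -/
theorem exists_coloring [Finite V] [Fact p.Prime] (hp : 3 ≤ p) (hL : 2 * p * p ≤ L + p)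
    (hm : ∃ σ, H.IsMap σ) (hG : H.CyclesGood p L) {C : ZMod p → V} (hC : H.IsRing C)
    (c : ZMod p) (ε : ℤˣ) :
    ∃ f : V → ZMod p, (∀ u v, H.Adj u v → f v - f u = 1 ∨ f v - f u = -1) ∧
      ∀ i, f (C i) = c + ((ε : ℤ) : ZMod p) * i := by
  classical
  have hodd : Odd p := (Fact.out : p.Prime).odd_of_ne_two (by omega)
  have hL2 : 2 * p ≤ L := by nlinarith
  induction H using WellFoundedLT.induction generalizing C c ε with
  | ind H ih =>
  obtain ⟨σ, hm⟩ := hm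
  by_cases hfac : ∀ T : ZMod p → V, H.IsRing T → IsFacial σ T ∨ IsFacial σ fun i => T (-i)
  · exact exists_coloring_of_facial hm hp hG hL hfac hC c ε
  push Not at hfac
  obtain ⟨T, hT, hn1, hn2⟩ := hfac
  obtain ⟨s, hrev, hrot, hrev', hrot'⟩ := hT.exists_sides hm hp
  let G : ZMod 2 → SimpleGraph V := side H T s
  have hTG : ∀ b, (G b).IsRing T := fun b =>
    ⟨hT.inj, fun i => ⟨hT.adj i, Or.inl ⟨i, Or.inl rfl⟩⟩⟩
  have htwo : ∀ x y : ZMod 2, x ≠ y → x = y + 1 := by decide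
  have hone : ∀ x : ZMod 2, x + 1 ≠ x := by decide
  have hcover : ∀ b u v, H.Adj u v → (G b).Adj u v ∨ (G (b + 1)).Adj u v := by
    intro b u v huv
    by_cases h1 : RingDart T (u, v)
    · exact Or.inl ⟨huv, Or.inl h1⟩
    · have h2 : s (v, u) = s (u, v) := hrev (u, v) huv h1
      by_cases h3 : s (u, v) = b
      · exact Or.inl ⟨huv, Or.inr ⟨h3, h2.trans h3⟩⟩
      · have h4 := htwo _ _ h3
        exact Or.inr ⟨huv, Or.inr ⟨h4, h2.trans h4⟩⟩
  have hβ : ∀ i, s (T i, T (i + 1)) = s (T 0, T (0 + 1)) := by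
    intro i
    have key : ∀ m : ℕ, s (T (m : ZMod p), T ((m : ZMod p) + 1)) = s (T 0, T (0 + 1)) := by
      intro m
      induction m with
      | zero => simp
      | succ m ih =>
        rw [← ih]
        push_cast
        exact hT.side_succ hm hp hrot hrev' hrot' m
    have := key i.val
    rwa [ZMod.natCast_zmod_val] at this
  have hβ' : ∀ i, s (T (i + 1), T i) = s (T 0, T (0 + 1)) + 1 := by
    intro i
    rw [← hβ i]
    exact hrev' (T i, T (i + 1)) ⟨i, Or.inl rfl⟩
  -- If one side were the whole graph, the other would carry ring darts only. The rotation at each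
  -- ring vertex would then lead on that side directly from one ring dart to the other, and `T`
  -- would be facial in one of its directions.
  have hlt : ∀ b, G b < H := by
    intro b
    refine lt_of_le_of_ne (side_le T s b) fun heq => ?_
    have hall : ∀ d : V × V, H.Adj d.1 d.2 → s d ≠ b → RingDart T d := by
      intro d hd hsd
      have h1 : (G b).Adj d.1 d.2 := by rw [heq]; exact hd
      rcases h1.2 with h2 | h2
      · exact h2
      · exact absurd h2.1 hsd
    by_cases hb : s (T 0, T (0 + 1)) = b
    · apply hn2
      intro i
      obtain ⟨j, hj⟩ : ∃ j, j = -(i + 1 + 1) := ⟨_, rfl⟩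
      beta_reduce
      rw [← hj, show -(i + 1) = j + 1 by rw [hj]; ring, show -i = j + 1 + 1 by rw [hj]; ring]
      have h1 : RingDart T (T (j + 1), T (j + 1 + 1)) := ⟨j + 1, Or.inl rfl⟩
      have h2 := hrot' _ h1
      have h3 : RingDart T (σ (T (j + 1), T (j + 1 + 1))) := by
        apply hall
        · rw [hm.adj_iff]; exact hT.adj (j + 1)
        · rw [h2, hβ, hb]; exact hone b
      rcases hT.ringDart_at h3 (hm.fst _) with h4 | h4
      · exact h4
      · rw [h4] at h2
        exact absurd h2.symm (hone _)
    · apply hn1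
      intro i
      have h1 : RingDart T (T (i + 1), T i) := ⟨i, Or.inr rfl⟩
      have h2 := hrot' _ h1
      have h3 : RingDart T (σ (T (i + 1), T i)) := by
        apply hall
        · rw [hm.adj_iff]; exact (hT.adj i).symm
        · rw [h2, hβ', add_assoc, CharTwo.add_self_eq_zero, add_zero]; exact hb
      rcases hT.ringDart_at h3 (hm.fst _) with h4 | h4
      · rw [h4] at h2
        exact absurd h2.symm (hone _)
      · exact h4
  -- Either `C` has the edges of `T`, which belong to both sides, or it meets `T` in at most one
  -- vertex and never changes sides.
  have hCb : ∃ b, (G b).IsRing C := by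
    by_cases h2 : ∃ i j, i ≠ j ∧ C i ∈ Set.range T ∧ C j ∈ Set.range T
    · obtain ⟨i, j, hij, hi, hj⟩ := h2
      refine ⟨0, hC.inj, fun k => ⟨hC.adj k, Or.inl ?_⟩⟩
      obtain ⟨a, ⟨h3, h4⟩ | ⟨h3, h4⟩⟩ := hT.edge_of_two_common hC hG hL2 hodd hij hi hj k
      · exact ⟨a, Or.inl (by rw [h3, h4])⟩
      · exact ⟨a, Or.inr (by rw [h3, h4])⟩
    · push Not at h2
      have hnr : ∀ k, ¬ RingDart T (C k, C (k + 1)) := fun k hk =>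
        h2 k (k + 1) (by simp) hk.fst_mem hk.snd_mem
      obtain ⟨j, hj⟩ : ∃ j, ∀ i, i ≠ j → C i ∉ Set.range T := by
        by_cases h3 : ∃ j, C j ∈ Set.range T
        · obtain ⟨j, hj⟩ := h3
          exact ⟨j, fun i hij => h2 j i hij.symm hj⟩
        · push Not at h3
          exact ⟨0, fun i _ => h3 i⟩
      have hconst : ∀ m : ℕ, m < p →
          s (C (j + m), C (j + m + 1)) = s (C j, C (j + 1)) := by
        intro m
        induction m with
        | zero => intro _; simp
        | succ m ihm =>
          intro hmp
          rw [← ihm (by omega)]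
          have h3 : C (j + m + 1) ∉ Set.range T := by
            apply hj
            intro h4
            have h5 : ((m + 1 : ℕ) : ZMod p) = (0 : ℕ) := by push_cast; linear_combination h4
            have := natCast_inj_of_lt hmp (by omega) h5
            omega
          have h4 := hrev (C (j + m), C (j + m + 1)) (hC.adj _) (hnr _)
          rw [← h4]
          push_cast
          rw [← add_assoc]
          exact side_eq_of_notMem hm hrot (hC.adj (j + m + 1)) (hC.adj (j + m)).symm rfl h3
      refine ⟨s (C j, C (j + 1)), hC.inj, fun k => ⟨hC.adj k, Or.inr ?_⟩⟩
      have h3 := hconst (k - j).val (ZMod.val_lt _)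
      rw [ZMod.natCast_zmod_val, add_sub_cancel] at h3
      exact ⟨h3, (hrev _ (hC.adj k) (hnr k)).trans h3⟩
  obtain ⟨b, hCb⟩ := hCb
  have hmap : ∀ b, ∃ σ, (G b).IsMap σ := fun b =>
    IsMap.exists_of_le (G b) (side_le T s b) ⟨σ, hm⟩
  have hgood : ∀ b, (G b).CyclesGood p L := fun b => hG.mono (side_le T s b)
  obtain ⟨f₁, hf₁, hfC⟩ := ih (G b) (hlt b) (hmap b) (hgood b) hCb c ε
  -- The first coloring winds once around `T`, so it prescribes there a coloring of the kind that
  -- the induction hypothesis extends.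
  obtain ⟨ε', hε'⟩ := exists_unit_of_steps (p := p) (by omega) (fun i => f₁ (T i))
    fun i => hf₁ _ _ ((hTG b).adj i)
  obtain ⟨f₂, hf₂, hfT⟩ := ih (G (b + 1)) (hlt _) (hmap _) (hgood _) (hTG _) (f₁ (T 0)) ε'
  have h12 : ∀ v ∈ Set.range T, f₂ v = f₁ v := by
    rintro _ ⟨i, rfl⟩
    rw [hfT, hε' i]
  -- Gluing is consistent: the colorings agree on `T`, and a vertex off `T` has all its edges on one
  -- side.
  let f : V → ZMod p := fun v => if ∃ w, (G (b + 1)).Adj v w then f₂ v else f₁ v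
  have hfb : ∀ v w, (G b).Adj v w → f v = f₁ v := by
    intro v w hvw
    by_cases h1 : ∃ w, (G (b + 1)).Adj v w
    · simp only [f, if_pos h1]
      apply h12
      by_contra hv
      obtain ⟨w', hw'⟩ := h1
      have h2 := hvw.2.resolve_left fun h => hv h.fst_mem
      have h3 := hw'.2.resolve_left fun h => hv h.fst_mem
      have h4 := side_eq_of_notMem hm hrot (d := (v, w)) (e := (v, w')) hvw.1 hw'.1 rfl hv
      rw [h2.1, h3.1] at h4
      exact hone _ h4.symm
    · simp only [f, if_neg h1]
  have hfb' : ∀ v w, (G (b + 1)).Adj v w → f v = f₂ v := by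
    intro v w hvw
    simp only [f, if_pos (⟨w, hvw⟩ : ∃ w, (G (b + 1)).Adj v w)]
  refine ⟨f, fun u v huv => ?_, fun i => ?_⟩
  · rcases hcover b u v huv with h1 | h1
    · rw [hfb u v h1, hfb v u h1.symm]
      exact hf₁ u v h1
    · rw [hfb' u v h1, hfb' v u h1.symm]
      exact hf₂ u v h1
  · rw [hfb _ _ (hCb.adj i), hfC]

end SimpleGraph

/-! ### From rotation systems and homomorphisms to permutations of pairs and residues. -/

namespace SimpleGraph

variable {V : Type*} {G : SimpleGraph V}

/-- The darts of a graph as pairs of adjacent vertices. -/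
def dartEquiv (G : SimpleGraph V) : G.Dart ≃ {d : V × V // G.Adj d.1 d.2} where
  toFun d := ⟨d.toProd, d.adj⟩
  invFun d := ⟨d.1, d.2⟩
  left_inv _ := rfl
  right_inv _ := rfl

theorem card_pairs [Finite V] (G : SimpleGraph V) :
    Nat.card (V × V) = Nat.card {d : V × V // ¬ G.Adj d.1 d.2} + 2 * Nat.card G.edgeSet := by
  classical
  have := Fintype.ofFinite V
  have h1 := Nat.card_congr (Equiv.sumCompl (fun d : V × V => G.Adj d.1 d.2))
  rw [Nat.card_sum, ← Nat.card_congr G.dartEquiv, Nat.card_eq_fintype_card (α := G.Dart),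
    G.dart_card_eq_twice_card_edges] at h1
  rw [Nat.card_eq_fintype_card (α := G.edgeSet), ← edgeFinset_card]
  omega

open scoped Classical in
/-- The rotation as a permutation of the pairs of vertices. -/
noncomputable def pairRotation (R : RotationSystem G) : Perm (V × V) :=
  R.next.extendDomain G.dartEquiv

theorem pairRotation_of_adj (R : RotationSystem G) {d : V × V} (hd : G.Adj d.1 d.2) :
    pairRotation R d = (R.next ⟨d, hd⟩).toProd := by
  classical
  exact Perm.extendDomain_apply_subtype (p := fun d : V × V => G.Adj d.1 d.2) _ _ hd

theorem pairRotation_of_not_adj (R : RotationSystem G) {d : V × V} (hd : ¬ G.Adj d.1 d.2) :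
    pairRotation R d = d := by
  classical
  exact Perm.extendDomain_apply_not_subtype _ _ hd

theorem pairRotation_pow (R : RotationSystem G) (d : G.Dart) (i : ℕ) :
    (pairRotation R ^ i) d.toProd = ((R.next ^ i) d).toProd := by
  induction i with
  | zero => rfl
  | succ i ih =>
    rw [pow_succ', Perm.mul_apply, ih, pairRotation_of_adj R (Dart.adj _), pow_succ',
      Perm.mul_apply]

theorem fst_pairRotation (R : RotationSystem G) (d : V × V) : (pairRotation R d).1 = d.1 := by
  by_cases hd : G.Adj d.1 d.2
  · rw [pairRotation_of_adj R hd]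
    exact R.next_fst ⟨d, hd⟩
  · rw [pairRotation_of_not_adj R hd]

theorem sameCycle_pairRotation [Finite V] (R : RotationSystem G) {d e : V × V}
    (hd : G.Adj d.1 d.2) (he : G.Adj e.1 e.2) (h : d.1 = e.1) :
    (pairRotation R).SameCycle d e := by
  have : Finite G.Dart := Finite.of_equiv _ G.dartEquiv.symm
  obtain ⟨i, -, hi⟩ := (R.sameCycle_of_fst_eq ⟨d, hd⟩ ⟨e, he⟩ h).exists_pow_eq'
  refine ⟨i, ?_⟩
  rw [zpow_natCast]
  have := pairRotation_pow R ⟨d, hd⟩ i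
  rw [hi] at this
  exact this

/-- Pairs that are not darts are orbits of their own, different orbits of darts lie in different
components of the graph, and isolated vertices are further components. -/
theorem orbitCount_pairRotation_le [Finite V] (R : RotationSystem G) :
    Perm.orbitCount (pairRotation R) (dartRev G) + Nat.card {v : V // ∀ w, ¬ G.Adj v w} ≤
      Nat.card {d : V × V // ¬ G.Adj d.1 d.2} + Nat.card G.ConnectedComponent := by
  classical
  set r := Perm.SameCycle.setoid (pairRotation R) ⊔ Perm.SameCycle.setoid (dartRev G) with hr
  have hα : ∀ a, r a (dartRev G a) := Perm.setoid_le_iff.1 le_sup_right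
  have hσ : ∀ d e : V × V, G.Adj d.1 d.2 → G.Adj e.1 e.2 → d.1 = e.1 → r d e :=
    fun d e hd he h => (le_sup_left : Perm.SameCycle.setoid (pairRotation R) ≤ r)
      (sameCycle_pairRotation R hd he h)
  have hreach : ∀ {u v : V} (w : G.Walk u v) (d e : V × V), G.Adj d.1 d.2 → G.Adj e.1 e.2 →
      d.1 = u → e.1 = v → r d e := by
    intro u v w
    induction w with
    | nil => intro d e hd he h1 h2; exact hσ d e hd he (h1.trans h2.symm)
    | @cons u x v h w ih =>
      intro d e hd he h1 h2
      refine r.trans' (hσ d (u, x) hd h h1) (r.trans' (hα (u, x)) ?_)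
      rw [dartRev_of_adj (by exact h)]
      exact ih (x, u) e h.symm he rfl h2
  let F : Quotient r ⊕ {v : V // ∀ w, ¬ G.Adj v w} →
      {d : V × V // ¬ G.Adj d.1 d.2} ⊕ G.ConnectedComponent :=
    Sum.elim (fun q => if h : G.Adj q.out.1 q.out.2 then Sum.inr (G.connectedComponentMk q.out.1)
      else Sum.inl ⟨q.out, h⟩) fun v => Sum.inr (G.connectedComponentMk v)
  have hiso : ∀ (v : {v : V // ∀ w, ¬ G.Adj v w}) (x : V),
      G.connectedComponentMk v.1 = G.connectedComponentMk x → v.1 = x := by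
    rintro ⟨v, hv⟩ x h
    obtain ⟨w⟩ := ConnectedComponent.exact h
    cases w with
    | nil => rfl
    | cons h' _ => exact absurd h' (hv _)
  have hF : Function.Injective F := by
    rintro (q | v) (q' | v') h
    · congr 1
      simp only [F, Sum.elim_inl] at h
      rw [← q.out_eq, ← q'.out_eq]
      split_ifs at h with h1 h2 h2
      · obtain ⟨w⟩ := ConnectedComponent.exact (Sum.inr_injective h)
        exact Quotient.sound (hreach w _ _ h1 h2 rfl rfl)
      · have := Sum.inl_injective h
        simp only [Subtype.mk.injEq] at this
        rw [this]
    · simp only [F, Sum.elim_inl, Sum.elim_inr] at h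
      split_ifs at h with h1
      have h2 := hiso v' _ (Sum.inr_injective h).symm
      rw [← h2] at h1
      exact absurd h1 (v'.2 _)
    · simp only [F, Sum.elim_inl, Sum.elim_inr] at h
      split_ifs at h with h1
      have h2 := hiso v _ (Sum.inr_injective h)
      rw [← h2] at h1
      exact absurd h1 (v.2 _)
    · simp only [F, Sum.elim_inr] at h
      have h2 := hiso v _ (Sum.inr_injective h)
      exact congrArg Sum.inr (Subtype.ext h2)
  have := Nat.card_le_card_of_injective F hF
  rwa [Nat.card_sum, Nat.card_sum] at this

/-- A pair that is not a dart is fixed by everything and adds three to both sides of the Euler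
inequality; what remains is Euler's formula of the rotation system. -/
theorem _root_.RotationSystem.IsPlanar.isMap [Finite V] {R : RotationSystem G} (hR : R.IsPlanar) :
    G.IsMap (pairRotation R) where
  fst := fst_pairRotation R
  fixed _ hd := pairRotation_of_not_adj R hd
  sameCycle _ _ hd he h := sameCycle_pairRotation R hd he h
  spherical := by
    classical
    have : Finite G.Dart := Finite.of_equiv _ G.dartEquiv.symm
    have h1 := orbitCount_pairRotation_le R
    have h2 := G.card_pairs
    have hrevadj : ∀ d : V × V, G.Adj (dartRev G d).1 (dartRev G d).2 ↔ G.Adj d.1 d.2 := by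
      intro d
      by_cases hd : G.Adj d.1 d.2
      · rw [dartRev_of_adj hd]; exact ⟨fun _ => hd, fun _ => hd.symm⟩
      · rw [dartRev_of_not_adj hd]
    have hrotadj : ∀ d : V × V, G.Adj (pairRotation R d).1 (pairRotation R d).2 ↔
        G.Adj d.1 d.2 := by
      intro d
      by_cases hd : G.Adj d.1 d.2
      · rw [pairRotation_of_adj R hd]; exact ⟨fun _ => hd, fun _ => Dart.adj _⟩
      · rw [pairRotation_of_not_adj R hd]
    have h3 : Nat.card {d : V × V // ¬ G.Adj d.1 d.2} + Nat.card {v : V // ∃ w, G.Adj v w} ≤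
        Perm.cycleCount (pairRotation R) := by
      rw [← Nat.card_sum]
      refine Perm.card_le_cycleCount _ (fun d => if h : G.Adj d.1 d.2 then
        Sum.inr ⟨d.1, d.2, h⟩ else Sum.inl ⟨d, h⟩) ?_ ?_
      · intro d
        by_cases hd : G.Adj d.1 d.2
        · simp only [hd, (hrotadj d).2 hd, dif_pos, Sum.inr.injEq, Subtype.mk.injEq]
          exact fst_pairRotation R d
        · rw [pairRotation_of_not_adj R hd]
      · rintro (⟨d, hd⟩ | ⟨v, w, hvw⟩)
        · exact ⟨d, by simp [hd]⟩
        · exact ⟨(v, w), by simp [hvw]⟩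
    have h4 : Nat.card {d : V × V // ¬ G.Adj d.1 d.2} + Nat.card G.edgeSet ≤
        Perm.cycleCount (dartRev G) := by
      rw [← Nat.card_sum]
      refine Perm.card_le_cycleCount _ (fun d => if h : G.Adj d.1 d.2 then
        Sum.inr ⟨s(d.1, d.2), h⟩ else Sum.inl ⟨d, h⟩) ?_ ?_
      · intro d
        by_cases hd : G.Adj d.1 d.2
        · simp only [hd, (hrevadj d).2 hd, dif_pos, Sum.inr.injEq]
          apply Subtype.ext
          change s((dartRev G d).1, (dartRev G d).2) = s(d.1, d.2)
          rw [dartRev_of_adj hd]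
          exact Sym2.eq_swap
        · rw [dartRev_of_not_adj hd]
      · rintro (⟨d, hd⟩ | ⟨e, he⟩)
        · exact ⟨d, by simp [hd]⟩
        · induction e using Sym2.ind with
          | h v w =>
            have hvw : G.Adj v w := he
            exact ⟨(v, w), by simp [hvw]⟩
    have h5 : Nat.card {d : V × V // ¬ G.Adj d.1 d.2} +
        Nat.card (Quotient (Perm.SameCycle.setoid R.face)) ≤
        Perm.cycleCount (pairRotation R * dartRev G) := by
      rw [← Nat.card_sum]
      refine Perm.card_le_cycleCount _ (fun d => if h : G.Adj d.1 d.2 then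
        Sum.inr (Quotient.mk _ ⟨d, h⟩) else Sum.inl ⟨d, h⟩) ?_ ?_
      · intro d
        rw [Perm.mul_apply]
        by_cases hd : G.Adj d.1 d.2
        · simp only [hd, (hrotadj _).2 ((hrevadj d).2 hd), dif_pos, Sum.inr.injEq]
          apply Quotient.sound
          refine Perm.SameCycle.symm ⟨1, ?_⟩
          rw [zpow_one]
          ext1
          simp only [pairRotation_of_adj R ((hrevadj d).2 hd)]
          change (R.next (Dart.symm ⟨d, hd⟩)).toProd = _
          congr 2
          ext1
          simp only [dartRev_of_adj hd]
          rfl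
        · rw [dartRev_of_not_adj hd, pairRotation_of_not_adj R hd]
      · rintro (⟨d, hd⟩ | q)
        · exact ⟨d, by simp [hd]⟩
        · induction q using Quotient.inductionOn with
          | h d => exact ⟨d.toProd, by simp [d.adj]⟩
    have h6 : Nat.card {v : V // ∃ w, G.Adj v w} + Nat.card {v : V // ∀ w, ¬ G.Adj v w} =
        Nat.card V := by
      rw [← Nat.card_sum]
      have := Nat.card_congr (Equiv.sumCompl (fun v : V => ∃ w, G.Adj v w))
      simpa only [not_exists] using this
    unfold RotationSystem.IsPlanar RotationSystem.numFaces at hR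
    unfold Perm.Spherical
    omega

/-- A cyclic sequence of vertices is a homomorphism from a cycle. -/
def homOfCycle {m : ℕ} (c : ℕ → V) (hadj : ∀ i, i + 1 < m + 3 → G.Adj (c i) (c (i + 1)))
    (hlast : G.Adj (c (m + 2)) (c 0)) : cycleGraph (m + 3) →g G where
  toFun i := c i
  map_rel' := by
    have key : ∀ u v : Fin (m + 3), v - u = 1 → G.Adj (c u) (c v) := by
      intro u v h
      have hv : v = u + 1 := (sub_eq_iff_eq_add.1 h).trans (add_comm 1 u)
      subst hv
      rcases (Nat.lt_succ_iff.1 u.isLt).lt_or_eq with h1 | h1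
      · have h2 : ((u + 1 : Fin (m + 3)) : ℕ) = u + 1 := by
          rw [Fin.val_add_one, if_neg]
          rintro rfl
          simp at h1
        rw [h2]
        exact hadj u (by omega)
      · have h2 : u = Fin.last (m + 2) := Fin.ext h1
        subst h2
        simpa using hlast
    intro u v h
    rw [cycleGraph_adj] at h
    rcases h with h | h
    · exact (key v u h).symm
    · exact key u v h

theorem exists_isCycle_of_injOn {m : ℕ} (hm : 3 ≤ m) (c : ℕ → V) (hc : Set.InjOn c (Set.Iio m))
    (hadj : ∀ i, i + 1 < m → G.Adj (c i) (c (i + 1))) (hlast : G.Adj (c (m - 1)) (c 0)) :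
    ∃ (v : V) (w : G.Walk v v), w.IsCycle ∧ w.length = m := by
  obtain ⟨m, rfl⟩ : ∃ n, m = n + 3 := ⟨m - 3, by omega⟩
  refine ⟨_, (cycleGraph.cycle m).map (homOfCycle c hadj hlast), ?_, ?_⟩
  · refine cycleGraph.isCycle_cycle.map ?_
    intro u v huv
    exact Fin.ext (hc u.isLt v.isLt huv)
  · rw [Walk.length_map, cycleGraph.length_cycle]

theorem cyclesGood_of_noCycleLengthIn {p L : ℕ} (hg : (p : ℕ∞) ≤ G.egirth)
    (hL : G.NoCycleLengthIn (p + 1) (L - 1)) : G.CyclesGood p L := by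
  intro m c hm hc hadj hlast
  obtain ⟨v, w, hw, rfl⟩ := exists_isCycle_of_injOn hm c hc hadj hlast
  have h1 : p ≤ w.length := by exact_mod_cast le_egirth.1 hg v w hw
  have h2 := hL v w hw
  omega

theorem Walk.IsCycle.isRing {p : ℕ} [NeZero p] {v : V} {w : G.Walk v v} (hw : w.IsCycle)
    (hp : w.length = p) : G.IsRing (fun i : ZMod p => w.getVert i.val) where
  inj i j hij := by
    apply ZMod.val_injective p
    have h1 := ZMod.val_lt i
    have h2 := ZMod.val_lt j
    exact hw.getVert_injOn' (by simp only [Set.mem_ofPred_eq]; omega)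
      (by simp only [Set.mem_ofPred_eq]; omega) hij
  adj i := by
    have h1 := ZMod.val_lt i
    have h2 := w.adj_getVert_succ (i := i.val) (by omega)
    have h3 : w.getVert (i + 1).val = w.getVert (i.val + 1) := by
      obtain ⟨k, hk⟩ : ∃ k : ℕ, k = i.val := ⟨_, rfl⟩
      have h4 : i + 1 = ((k + 1 : ℕ) : ZMod p) := by rw [hk]; simp
      rw [h4, ZMod.val_natCast, ← hk]
      rcases (show k + 1 ≤ p by omega).lt_or_eq with h5 | h5
      · rw [Nat.mod_eq_of_lt h5]
      · rw [h5, Nat.mod_self, Walk.getVert_zero, ← hp, Walk.getVert_length]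
    rw [h3]
    exact h2

theorem Walk.exists_getVert_val {p : ℕ} [NeZero p] {v : V} {w : G.Walk v v} (hp : w.length = p)
    {x : V} (hx : x ∈ w.support) : ∃ i : ZMod p, w.getVert i.val = x := by
  obtain ⟨n, rfl, hn⟩ := Walk.mem_support_iff_exists_getVert.1 hx
  refine ⟨(n : ZMod p), ?_⟩
  rw [ZMod.val_natCast]
  rcases (show n ≤ p by omega).lt_or_eq with h5 | h5
  · rw [Nat.mod_eq_of_lt h5]
  · rw [h5, Nat.mod_self, Walk.getVert_zero, ← hp, Walk.getVert_length]

/-- `ZMod (n + 2)` is by definition `Fin (n + 2)`, so homomorphisms to the cycle are functions to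
the residues with steps `1` and `-1`. -/
theorem cycleGraph_adj_zmod {n : ℕ} (a b : ZMod (n + 2)) :
    (cycleGraph (n + 2)).Adj (a : Fin (n + 2)) (b : Fin (n + 2)) ↔ b - a = 1 ∨ b - a = -1 := by
  refine (@cycleGraph_adj n a b).trans ?_
  change a - b = 1 ∨ b - a = 1 ↔ _
  rw [or_comm]
  refine or_congr Iff.rfl ?_
  rw [← neg_sub, neg_eq_iff_eq_neg]

/-- The coloring of a shortest cycle extends. -/
theorem exists_extension [Finite V] {p : ℕ} (hp : p.Prime) (hp3 : 3 ≤ p) (hG : G.IsPlanar)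
    (hgirth : (p : ℕ∞) ≤ G.egirth)
    (hno : G.NoCycleLengthIn (p + 1) (2 * (p - 1) * (p + 2) - 1))
    {v : V} {c : G.Walk v v} (hc : c.IsCycle) (hlen : c.length = p)
    (ω : G.induce {x | x ∈ c.support} →g cycleGraph p) :
    ∃ φ : G →g cycleGraph p, ∀ x : {x | x ∈ c.support}, φ (x : V) = ω x := by
  obtain ⟨R, hR⟩ := hG
  have hgood := cyclesGood_of_noCycleLengthIn hgirth hno
  obtain ⟨n, rfl⟩ : ∃ n, p = n + 2 := ⟨p - 2, by omega⟩
  have : Fact (n + 2).Prime := ⟨hp⟩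
  have hring := hc.isRing hlen
  have hmem : ∀ i : ZMod (n + 2), c.getVert i.val ∈ {x | x ∈ c.support} :=
    fun i => Walk.getVert_mem_support _ _
  let a : ZMod (n + 2) → ZMod (n + 2) := fun i => (ω ⟨c.getVert i.val, hmem i⟩ : Fin (n + 2))
  obtain ⟨ε, hε⟩ := exists_unit_of_steps (by omega) a (fun i => by
    rw [← cycleGraph_adj_zmod]
    exact ω.map_rel (hring.adj i))
  -- Only `L ≥ 2 p ^ 2 - p` is needed; `L = 2 (p - 1) (p + 2)` is larger.
  obtain ⟨f, hf, hfC⟩ := exists_coloring hp3 (by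
    have : n + 2 - 1 = n + 1 := by omega
    rw [this]
    nlinarith) ⟨_, hR.isMap⟩ hgood hring (a 0) ε
  refine ⟨⟨fun x => (f x : ZMod (n + 2)),
    fun {x y} hxy => (cycleGraph_adj_zmod _ _).2 (hf x y hxy)⟩, ?_⟩
  rintro ⟨x, hx⟩
  obtain ⟨i, rfl⟩ := Walk.exists_getVert_val hlen hx
  have := (hfC i).trans (hε i).symm
  exact this

theorem exists_isCycle_of_egirth_eq {p : ℕ} (h : G.egirth = (p : ℕ∞)) :
    ∃ (v : V) (c : G.Walk v v), c.IsCycle ∧ c.length = p := by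
  have h1 : ¬ G.IsAcyclic := by
    rw [← egirth_eq_top, h]
    exact ENat.natCast_ne_top p
  obtain ⟨v, c, hc, h2⟩ := exists_egirth_eq_length.2 h1
  refine ⟨v, c, hc, ?_⟩
  rw [h] at h2
  exact_mod_cast h2.symm

end SimpleGraph

/-! ### The upper bound for the threshold. -/

open SimpleGraph in
theorem steinbergProperty_of_prime {p : ℕ} (hp : p.Prime) (hp3 : 3 ≤ p) :
    SteinbergProperty p (2 * (p - 1) * (p + 2) - 1) := by
  intro V _ G hG hgirth hno
  obtain ⟨v, c, hc, hlen⟩ := exists_isCycle_of_egirth_eq hgirth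
  obtain ⟨R, hR⟩ := hG
  have hgood := cyclesGood_of_noCycleLengthIn hgirth.ge hno
  obtain ⟨n, rfl⟩ : ∃ n, p = n + 2 := ⟨p - 2, by omega⟩
  have : Fact (n + 2).Prime := ⟨hp⟩
  obtain ⟨f, hf, -⟩ := exists_coloring hp3 (by
    have : n + 2 - 1 = n + 1 := by omega
    rw [this]
    nlinarith) ⟨_, hR.isMap⟩ hgood (hc.isRing hlen) 0 1
  exact ⟨⟨fun x => (f x : ZMod (n + 2)), fun {x y} hxy => (cycleGraph_adj_zmod _ _).2 (hf x y hxy)⟩⟩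

theorem exists_steinbergNumber_eq {k m : ℕ} (h : SteinbergProperty k m) :
    ∃ N : ℕ, steinbergNumber k = (N : ℕ∞) ∧ SteinbergProperty k N ∧ N ≤ m := by
  classical
  have hex : ∃ n, SteinbergProperty k n := ⟨m, h⟩
  refine ⟨Nat.find hex, le_antisymm ?_ ?_, Nat.find_spec hex, Nat.find_min' hex h⟩
  · exact iInf₂_le (Nat.find hex) (Nat.find_spec hex)
  · exact le_iInf₂ fun n hn => by exact_mod_cast Nat.find_min' hex hn

theorem steinbergNumber_eq_top {k : ℕ} (h : ∀ m, ¬ SteinbergProperty k m) :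
    steinbergNumber k = ⊤ := by
  simp [steinbergNumber, h]

/-! ### Connected maps on the sphere and their graphs. -/

/-- A connected graph without loops and parallel edges drawn on the sphere: `σ` is the rotation of
its darts, `α` their reversal and `t` the vertex from which a dart leaves. -/
structure IsSphereMap {B X : Type*} [Finite B] (σ α : Perm B) (t : B → X) : Prop where
  invol : ∀ d, α (α d) = d
  tail_rot : ∀ d, t (σ d) = t d
  sameCycle : ∀ d e, t d = t e → σ.SameCycle d e
  surj : Function.Surjective t
  ne : ∀ d, t d ≠ t (α d)
  inj : ∀ d e, t d = t e → t (α d) = t (α e) → d = e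
  conn : ∀ d e, (Perm.SameCycle.setoid σ ⊔ Perm.SameCycle.setoid α) d e
  euler : Nat.card B + 2 ≤ Nat.card X + Perm.cycleCount α + Perm.cycleCount (σ * α)

/-- The graph of a map. -/
def mapGraph {B X : Type*} (α : Perm B) (t : B → X) : SimpleGraph X :=
  SimpleGraph.fromRel fun u v => ∃ d, t d = u ∧ t (α d) = v

namespace Equiv.Perm

variable {D E : Type*} [Finite D] [Finite E]

theorem cycleCount_permCongr (e : D ≃ E) (f : Perm D) :
    cycleCount (e.permCongr f) = cycleCount f := by
  have hpow : ∀ (i : ℕ) (x : D), ((e.permCongr f) ^ i) (e x) = e ((f ^ i) x) := by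
    intro i x
    induction i with
    | zero => rfl
    | succ i ih => rw [pow_succ', mul_apply, ih, permCongr_apply, symm_apply_apply, pow_succ',
        mul_apply]
  symm
  refine Nat.card_congr (Quotient.congr e fun x y => ?_)
  constructor
  · intro h
    obtain ⟨i, -, rfl⟩ := SameCycle.exists_pow_eq' h
    exact ⟨i, by rw [zpow_natCast, hpow]⟩
  · intro h
    obtain ⟨i, -, hi⟩ := SameCycle.exists_pow_eq' h
    rw [hpow] at hi
    exact ⟨i, by rw [zpow_natCast]; exact e.injective hi⟩

end Equiv.Perm

namespace IsSphereMap

variable {B X : Type*} [Finite B] {σ α : Perm B} {t : B → X}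

theorem adj_iff (h : IsSphereMap σ α t) {u v : X} :
    (mapGraph α t).Adj u v ↔ ∃ d, t d = u ∧ t (α d) = v := by
  rw [mapGraph, SimpleGraph.fromRel_adj]
  constructor
  · rintro ⟨-, h1 | ⟨d, h1, h2⟩⟩
    · exact h1
    · exact ⟨α d, h2, by rw [h.invol, h1]⟩
  · rintro ⟨d, rfl, rfl⟩
    exact ⟨h.ne d, Or.inl ⟨d, rfl, rfl⟩⟩

/-- The darts of a map are the darts of its graph. -/
noncomputable def dartEquiv (h : IsSphereMap σ α t) : B ≃ (mapGraph α t).Dart :=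
  Equiv.ofBijective (fun d => ⟨(t d, t (α d)), h.adj_iff.2 ⟨d, rfl, rfl⟩⟩) <| by
    constructor
    · intro d e hde
      have h1 : (t d, t (α d)) = (t e, t (α e)) := congrArg SimpleGraph.Dart.toProd hde
      exact h.inj d e (congrArg Prod.fst h1) (congrArg Prod.snd h1)
    · rintro ⟨⟨u, v⟩, huv⟩
      obtain ⟨d, rfl, rfl⟩ := h.adj_iff.1 huv
      exact ⟨d, rfl⟩

theorem symm_dartEquiv (h : IsSphereMap σ α t) (d : B) :
    (h.dartEquiv d).symm = h.dartEquiv (α d) := by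
  ext1
  change (t (α d), t d) = (t (α d), t (α (α d)))
  rw [h.invol]

/-- The field `euler` is one half of Euler's formula; nonnegativity of the genus, `Perm.euler_le`,
is the other. -/
theorem isPlanar [Finite X] (h : IsSphereMap σ α t) : (mapGraph α t).IsPlanar := by
  classical
  set G := mapGraph α t with hG
  let e := h.dartEquiv
  have : Finite G.Dart := Finite.of_equiv _ e
  have := Fintype.ofFinite X
  let R : RotationSystem G :=
    { next := e.permCongr σ
      next_fst := by
        intro d
        obtain ⟨d, rfl⟩ := e.surjective d
        rw [permCongr_apply, symm_apply_apply]
        exact h.tail_rot d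
      sameCycle_of_fst_eq := by
        intro d d' hd
        obtain ⟨d, rfl⟩ := e.surjective d
        obtain ⟨d', rfl⟩ := e.surjective d'
        obtain ⟨i, -, rfl⟩ := (h.sameCycle d d' hd).exists_pow_eq'
        refine ⟨i, ?_⟩
        rw [zpow_natCast]
        clear hd
        induction i with
        | zero => rfl
        | succ i ih => rw [pow_succ', Perm.mul_apply, ih, permCongr_apply, symm_apply_apply,
            pow_succ', Perm.mul_apply] }
  have hface : R.face = e.permCongr (σ * α) := by
    ext1 d
    obtain ⟨d, rfl⟩ := e.surjective d
    rw [permCongr_apply, symm_apply_apply]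
    change e.permCongr σ (e d).symm = _
    rw [show (e d).symm = e (α d) from h.symm_dartEquiv d, permCongr_apply, symm_apply_apply]
    rfl
  refine ⟨R, ?_⟩
  have h1 : Nat.card (Quotient (Perm.SameCycle.setoid R.face)) = Perm.cycleCount (σ * α) := by
    rw [hface]
    exact Perm.cycleCount_permCongr e (σ * α)
  have h2 : Nat.card {v : X // ∀ w, ¬ G.Adj v w} = 0 := by
    rw [Nat.card_eq_zero]
    left
    constructor
    rintro ⟨v, hv⟩
    obtain ⟨d, rfl⟩ := h.surj v
    exact hv _ (h.adj_iff.2 ⟨d, rfl, rfl⟩)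
  by_cases hX : Nonempty X
  swap
  · rw [not_nonempty_iff] at hX
    have hB : IsEmpty B := ⟨fun d => hX.elim (t d)⟩
    have h3 : Perm.cycleCount α = 0 := by
      rw [Perm.cycleCount, Nat.card_eq_zero]
      exact Or.inl ⟨fun q => hB.elim q.out⟩
    have h4 : Perm.cycleCount (σ * α) = 0 := by
      rw [Perm.cycleCount, Nat.card_eq_zero]
      exact Or.inl ⟨fun q => hB.elim q.out⟩
    have := h.euler
    rw [h3, h4, Nat.card_of_isEmpty (α := X)] at this
    omega
  obtain ⟨x0⟩ := hX
  have hreach : ∀ d e : B, G.Reachable (t d) (t e) := by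
    have hle : Perm.SameCycle.setoid σ ⊔ Perm.SameCycle.setoid α ≤
        G.reachableSetoid.comap t := by
      refine sup_le (Perm.setoid_le_iff.2 fun d => ?_) (Perm.setoid_le_iff.2 fun d => ?_)
      · change G.Reachable (t d) (t (σ d))
        rw [h.tail_rot]
      · change G.Reachable (t d) (t (α d))
        exact (h.adj_iff.2 ⟨d, rfl, rfl⟩ : G.Adj (t d) (t (α d))).reachable
    exact fun d e => hle (h.conn d e)
  have h3 : Nat.card G.ConnectedComponent = 1 := by
    rw [Nat.card_eq_one_iff_unique]
    refine ⟨⟨fun a b => ?_⟩, ⟨G.connectedComponentMk x0⟩⟩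
    induction a using SimpleGraph.ConnectedComponent.ind with
    | h u =>
    induction b using SimpleGraph.ConnectedComponent.ind with
    | h v =>
    obtain ⟨d, rfl⟩ := h.surj u
    obtain ⟨d', rfl⟩ := h.surj v
    exact SimpleGraph.ConnectedComponent.sound (hreach d d')
  have h4 : Perm.cycleCount σ = Nat.card X := by
    apply le_antisymm
    · exact Perm.cycleCount_le_card σ t h.sameCycle
    · exact Perm.card_le_cycleCount σ t h.tail_rot h.surj
  have h5 : Perm.cycleCount α = Nat.card G.edgeSet := by
    let ed : B → G.edgeSet := fun d => ⟨s(t d, t (α d)), h.adj_iff.2 ⟨d, rfl, rfl⟩⟩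
    apply le_antisymm
    · refine Perm.cycleCount_le_card α ed fun d d' hd => ?_
      have h6 : s(t d, t (α d)) = s(t d', t (α d')) := congrArg Subtype.val hd
      rw [Sym2.eq_iff] at h6
      rcases h6 with ⟨h6, h7⟩ | ⟨h6, h7⟩
      · rw [h.inj d d' h6 h7]
      · refine ⟨1, ?_⟩
        rw [zpow_one]
        exact h.inj _ _ h7 (by rw [h.invol, h6])
    · refine Perm.card_le_cycleCount α ed (fun d => ?_) ?_
      · apply Subtype.ext
        change s(t (α d), t (α (α d))) = s(t d, t (α d))
        rw [h.invol]
        exact Sym2.eq_swap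
      · rintro ⟨x, hx⟩
        induction x using Sym2.ind with
        | h u v =>
          obtain ⟨d, rfl, rfl⟩ := h.adj_iff.1 (show G.Adj u v from hx)
          exact ⟨d, rfl⟩
  have h6 : Perm.orbitCount σ α ≤ 1 := by
    unfold Perm.orbitCount
    have : Subsingleton (Quotient (Perm.SameCycle.setoid σ ⊔ Perm.SameCycle.setoid α)) := by
      constructor
      intro a b
      rw [← a.out_eq, ← b.out_eq]
      exact Quotient.sound (h.conn _ _)
    exact Finite.card_le_one_iff_subsingleton.2 this
  have h7 := Perm.euler_le σ α
  have h8 := h.euler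
  have h9 : Nat.card B = 2 * Nat.card G.edgeSet := by
    rw [Nat.card_congr e, Nat.card_eq_fintype_card (α := G.Dart), G.dart_card_eq_twice_card_edges,
      Nat.card_eq_fintype_card (α := G.edgeSet), ← SimpleGraph.edgeFinset_card]
  unfold RotationSystem.IsPlanar RotationSystem.numFaces
  omega

end IsSphereMap

/-! ### Replacing every edge by two arcs. -/

namespace SimpleGraph

/-- Cycles whose edges lie on another cycle have the same length. -/
theorem IsRing.length_eq {V : Type*} {G : SimpleGraph V} {m k : ℕ} [NeZero m] [NeZero k]
    (hk : 3 ≤ k) {c : ZMod m → V} {T : ZMod k → V} (hc : G.IsRing c) (hT : G.IsRing T)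
    (h : ∀ i, ∃ j, (T i = c j ∧ T (i + 1) = c (j + 1)) ∨ (T i = c (j + 1) ∧ T (i + 1) = c j)) :
    m = k := by
  classical
  have hTc : ∀ i, T i ∈ Set.range c := by
    intro i
    obtain ⟨j, h1 | h1⟩ := h i
    · exact ⟨_, h1.1.symm⟩
    · exact ⟨_, h1.1.symm⟩
  have hnext : ∀ i j, c j = T i → T (i + 1) = c (j + 1) ∨ T (i + 1) = c (j - 1) := by
    intro i j hij
    obtain ⟨j', ⟨h1, h2⟩ | ⟨h1, h2⟩⟩ := h i
    · left
      rw [h2, hc.inj (hij.trans h1)]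
    · right
      rw [h2, hc.inj (hij.trans h1), add_sub_cancel_right]
  have hprev : ∀ i j, c j = T i → T (i - 1) = c (j + 1) ∨ T (i - 1) = c (j - 1) := by
    intro i j hij
    obtain ⟨j', ⟨h1, h2⟩ | ⟨h1, h2⟩⟩ := h (i - 1)
    · right
      rw [sub_add_cancel] at h2
      rw [h1, hc.inj (hij.trans h2), add_sub_cancel_right]
    · left
      rw [sub_add_cancel] at h2
      rw [h1, hc.inj (hij.trans h2)]
  -- The two neighbours on `T` of a vertex are different and lie among its two neighbours on `c`, so
  -- one of them is `c (j + 1)`.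
  have hstep : ∀ j, c j ∈ Set.range T → c (j + 1) ∈ Set.range T := by
    rintro j ⟨i, hi⟩
    rcases hnext i j hi.symm with h1 | h1
    · exact ⟨_, h1⟩
    · rcases hprev i j hi.symm with h2 | h2
      · exact ⟨_, h2⟩
      · exfalso
        have h3 := hT.inj (h1.trans h2.symm)
        apply IsRing.two_ne_zero hk
        linear_combination h3
  obtain ⟨j0, hj0⟩ := hTc 0
  have hall : ∀ l : ℕ, c (j0 + l) ∈ Set.range T := by
    intro l
    induction l with
    | zero => exact ⟨0, by simp [hj0]⟩
    | succ l ih =>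
      have := hstep _ ih
      push_cast
      rwa [← add_assoc]
  have hcT : ∀ j, c j ∈ Set.range T := by
    intro j
    have := hall (j - j0).val
    rwa [ZMod.natCast_zmod_val, add_sub_cancel] at this
  choose a ha using hTc
  choose b hb using hcT
  have h1 := Fintype.card_le_of_injective a fun i i' hii => hT.inj (by rw [← ha, ← ha, hii])
  have h2 := Fintype.card_le_of_injective b fun i i' hii => hc.inj (by rw [← hb, ← hb, hii])
  rw [ZMod.card, ZMod.card] at h1 h2
  omega

end SimpleGraph

theorem Equiv.Perm.apply_inv_apply {D : Type*} (f : Perm D) (x : D) : f (f⁻¹ x) = x :=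
  f.apply_symm_apply x

/-- The edges of arcs of lengths `A d`, one for each dart `d`. -/
abbrev ArcEdge {B : Type*} (A : B → ℕ) := {x : B × ℕ // x.2 < A x.1}

/-- The inner points of arcs of lengths `A d`. -/
abbrev ArcPoint {B : Type*} (A : B → ℕ) := {x : B × ℕ // 0 < x.2 ∧ x.2 < A x.1}

section Arcs

variable {B X : Type*} [Finite B] {A : B → ℕ}

instance : Finite (ArcEdge A) :=
  Finite.of_equiv (Σ d, Fin (A d))
    { toFun := fun x => ⟨(x.1, x.2.1), x.2.2⟩
      invFun := fun x => ⟨x.1.1, ⟨x.1.2, x.2⟩⟩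
      left_inv := fun _ => rfl
      right_inv := fun _ => rfl }

instance : Finite (ArcPoint A) :=
  Finite.of_injective (fun x : ArcPoint A => (⟨x.1, x.2.2⟩ : ArcEdge A))
    fun x y h => Subtype.ext (congrArg (fun z : ArcEdge A => z.1) h)

theorem card_arcEdge (hA : ∀ d, 0 < A d) :
    Nat.card (ArcEdge A) = Nat.card B + Nat.card (ArcPoint A) := by
  rw [← Nat.card_sum]
  symm
  refine Nat.card_congr (Equiv.ofBijective (Sum.elim (fun d => ⟨(d, 0), hA d⟩)
    fun x => ⟨x.1, x.2.2⟩) ⟨?_, ?_⟩)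
  · rintro (d | ⟨⟨d, i⟩, hi⟩) (e | ⟨⟨e, j⟩, hj⟩) h <;>
      simp only [Sum.elim_inl, Sum.elim_inr, Subtype.mk.injEq, Prod.mk.injEq] at h
    · rw [h.1]
    · have := hj.1
      dsimp only at this
      omega
    · have := hi.1
      dsimp only at this
      omega
    · obtain ⟨rfl, rfl⟩ := h; rfl
  · rintro ⟨⟨d, i⟩, hi⟩
    rcases Nat.eq_zero_or_pos i with rfl | h
    · exact ⟨Sum.inl d, rfl⟩
    · exact ⟨Sum.inr ⟨(d, i), h, hi⟩, rfl⟩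

/-- The next edge on an arc, or the first edge of the arc chosen by `β`. -/
noncomputable def arcSucc (hA : ∀ d, 0 < A d) (β : Perm B) : Perm (ArcEdge A) :=
  Equiv.ofBijective (fun x => if h : x.1.2 + 1 < A x.1.1 then ⟨(x.1.1, x.1.2 + 1), h⟩
    else ⟨(β x.1.1, 0), hA _⟩) <| Finite.injective_iff_bijective.1 <| by
      rintro ⟨⟨d, i⟩, hi⟩ ⟨⟨e, j⟩, hj⟩ h
      dsimp only at h hi hj
      split_ifs at h with h1 h2 h2 <;>
        simp only [Subtype.mk.injEq, Prod.mk.injEq, EmbeddingLike.apply_eq_iff_eq] at h ⊢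
      · exact ⟨h.1, by omega⟩
      · omega
      · omega
      · obtain ⟨rfl, -⟩ := h
        exact ⟨rfl, by omega⟩

theorem arcSucc_of_lt (hA : ∀ d, 0 < A d) (β : Perm B) {d : B} {i : ℕ} (hi : i < A d)
    (h : i + 1 < A d) : arcSucc hA β ⟨(d, i), hi⟩ = ⟨(d, i + 1), h⟩ := by
  simp [arcSucc, h]

theorem arcSucc_of_not_lt (hA : ∀ d, 0 < A d) (β : Perm B) {d : B} {i : ℕ} (hi : i < A d)
    (h : ¬ i + 1 < A d) : arcSucc hA β ⟨(d, i), hi⟩ = ⟨(β d, 0), hA _⟩ := by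
  simp [arcSucc, h]

theorem cycleCount_le_arcSucc (hA : ∀ d, 0 < A d) (β : Perm B) :
    Perm.cycleCount β ≤ Perm.cycleCount (arcSucc hA β) := by
  classical
  refine Perm.card_le_cycleCount _
    (fun x => (Quotient.mk _ x.1.1 : Quotient (Perm.SameCycle.setoid β))) ?_ ?_
  · rintro ⟨⟨d, i⟩, hi⟩
    by_cases h : i + 1 < A d
    · rw [arcSucc_of_lt hA β hi h]
    · rw [arcSucc_of_not_lt hA β hi h]
      exact Quotient.sound (Perm.SameCycle.symm ⟨1, by simp⟩)
  · intro q
    induction q using Quotient.inductionOn with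
    | h d => exact ⟨⟨(d, 0), hA d⟩, rfl⟩

/-- The `i`-th point on the arc that belongs to `d`. -/
def arcPt (α : Perm B) (t : B → X) (A : B → ℕ) (d : B) (i : ℕ) : X ⊕ ArcPoint A :=
  if h : 0 < i ∧ i < A d then Sum.inr ⟨(d, i), h⟩
  else if i = 0 then Sum.inl (t d) else Sum.inl (t (α d))

section arcPt

variable {α : Perm B} {t : B → X}

theorem arcPt_inner {d : B} {i : ℕ} (h : 0 < i ∧ i < A d) :
    arcPt α t A d i = Sum.inr ⟨(d, i), h⟩ := by simp [arcPt, h]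

@[simp] theorem arcPt_zero (d : B) : arcPt α t A d 0 = Sum.inl (t d) := by simp [arcPt]

theorem arcPt_of_le {d : B} {i : ℕ} (h0 : 0 < i) (h : A d ≤ i) :
    arcPt α t A d i = Sum.inl (t (α d)) := by
  simp [arcPt, h0.ne', h.not_gt]

theorem arcPt_eq_inl {d : B} {i : ℕ} {x : X} (h : arcPt α t A d i = Sum.inl x) :
    (i = 0 ∧ t d = x) ∨ (0 < i ∧ A d ≤ i ∧ t (α d) = x) := by
  unfold arcPt at h
  split_ifs at h with h1 h2
  · exact Or.inl ⟨h2, Sum.inl_injective h⟩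
  · exact Or.inr ⟨by omega, by omega, Sum.inl_injective h⟩

theorem arcPt_eq_inner {d e : B} {i j : ℕ} (hi : 0 < i ∧ i < A d)
    (h : arcPt α t A e j = arcPt α t A d i) : e = d ∧ j = i := by
  rw [arcPt_inner hi] at h
  unfold arcPt at h
  split_ifs at h with h1 h2
  simp only [Sum.inr.injEq, Subtype.mk.injEq, Prod.mk.injEq] at h
  exact h

theorem arcPt_arcSucc (hA : ∀ d, 0 < A d) {β : Perm B} (hβ : ∀ d, t (β d) = t (α d))
    (x : ArcEdge A) : arcPt α t A (arcSucc hA β x).1.1 (arcSucc hA β x).1.2 =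
      arcPt α t A x.1.1 (x.1.2 + 1) := by
  obtain ⟨⟨d, i⟩, hi⟩ := x
  by_cases h : i + 1 < A d
  · rw [arcSucc_of_lt hA β hi h]
  · rw [arcSucc_of_not_lt hA β hi h]
    simp only [arcPt_zero]
    rw [arcPt_of_le (by omega) (by omega), hβ]

end arcPt

/-- The rotation of the graph in which every edge is replaced by two arcs. -/
noncomputable def thickRot (hA : ∀ d, 0 < A d) (σ α : Perm B) : Perm (ArcEdge A × Bool) where
  toFun x := if x.2 then ((arcSucc hA (σ⁻¹ * α))⁻¹ x.1, false) else (arcSucc hA α x.1, true)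
  invFun x := if x.2 then ((arcSucc hA α)⁻¹ x.1, false) else (arcSucc hA (σ⁻¹ * α) x.1, true)
  left_inv := by rintro ⟨x, _ | _⟩ <;> simp
  right_inv := by rintro ⟨x, _ | _⟩ <;> simp

/-- The reversal of the graph in which every edge is replaced by two arcs. -/
def thickRev (A : B → ℕ) : Perm (ArcEdge A × Bool) where
  toFun x := (x.1, !x.2)
  invFun x := (x.1, !x.2)
  left_inv := by rintro ⟨x, _ | _⟩ <;> rfl
  right_inv := by rintro ⟨x, _ | _⟩ <;> rfl

/-- The tail of a dart of an arc. -/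
def thickTail (α : Perm B) (t : B → X) (A : B → ℕ) (x : ArcEdge A × Bool) : X ⊕ ArcPoint A :=
  if x.2 then arcPt α t A x.1.1.1 x.1.1.2 else arcPt α t A x.1.1.1 (x.1.1.2 + 1)

theorem thickRot_true (hA : ∀ d, 0 < A d) (σ α : Perm B) (x : ArcEdge A) :
    thickRot hA σ α (x, true) = ((arcSucc hA (σ⁻¹ * α))⁻¹ x, false) := rfl

theorem thickRot_false (hA : ∀ d, 0 < A d) (σ α : Perm B) (x : ArcEdge A) :
    thickRot hA σ α (x, false) = (arcSucc hA α x, true) := rfl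

variable {σ α : Perm B} {t : B → X} {k : ℕ}

/-- The new faces are of two kinds: those between the two arcs of an edge, from the cycles of `α`,
and the old faces, from the cycles of `σ⁻¹ * α`, which is conjugate to the inverse of `σ * α`. -/
theorem cycleCount_thick (hA : ∀ d, 0 < A d) (hα : ∀ d, α (α d) = d) :
    Perm.cycleCount α + Perm.cycleCount (σ * α) ≤
      Perm.cycleCount (thickRot hA σ α * thickRev A) := by
  classical
  have h1 : Perm.cycleCount (σ * α) = Perm.cycleCount (σ⁻¹ * α) := by
    rw [← Perm.cycleCount_inv (σ⁻¹ * α), ← Perm.cycleCount_permCongr α (σ * α)]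
    congr 1
    ext d
    have h2 : α⁻¹ = α := by ext d; rw [Perm.inv_eq_iff_eq, hα]
    rw [permCongr_apply, mul_inv_rev, inv_inv, h2, Perm.mul_apply, Perm.mul_apply,
      show α.symm = α from h2, hα]
  have h2 := add_le_add (cycleCount_le_arcSucc hA α) (cycleCount_le_arcSucc hA (σ⁻¹ * α))
  rw [h1]
  refine h2.trans ?_
  unfold Perm.cycleCount
  rw [← Nat.card_sum]
  refine Perm.card_le_cycleCount (X := Quotient (Perm.SameCycle.setoid (arcSucc hA α)) ⊕
    Quotient (Perm.SameCycle.setoid (arcSucc hA (σ⁻¹ * α)))) _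
    (fun x => if x.2 then Sum.inl ⟦x.1⟧ else Sum.inr ⟦x.1⟧) ?_ ?_
  · rintro ⟨x, _ | _⟩
    · change Sum.inr _ = Sum.inr _
      congr 1
      refine Quotient.sound ⟨1, ?_⟩
      rw [zpow_one]
      exact Perm.apply_inv_apply _ _
    · change Sum.inl _ = Sum.inl _
      congr 1
      exact Quotient.sound (Perm.SameCycle.symm ⟨1, by rw [zpow_one]; rfl⟩)
  · rintro (q | q)
    · induction q using Quotient.inductionOn with
      | h x => exact ⟨(x, true), rfl⟩
    · induction q using Quotient.inductionOn with
      | h x => exact ⟨(x, false), rfl⟩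

theorem thickTail_rot (h : IsSphereMap σ α t) (hA : ∀ d, 0 < A d) (x : ArcEdge A × Bool) :
    thickTail α t A (thickRot hA σ α x) = thickTail α t A x := by
  obtain ⟨x, _ | _⟩ := x
  · rw [thickRot_false]
    exact arcPt_arcSucc hA (fun d => rfl) x
  · rw [thickRot_true]
    have hβ : ∀ d, t ((σ⁻¹ * α) d) = t (α d) := by
      intro d
      rw [← h.tail_rot, Perm.mul_apply, Perm.apply_inv_apply]
    have := arcPt_arcSucc hA hβ ((arcSucc hA (σ⁻¹ * α))⁻¹ x)
    rw [Perm.apply_inv_apply] at this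
    exact this.symm

/-- Around an old vertex, first edges of outgoing arcs alternate with last edges of incoming ones;
two steps lead from the arc of `d` to the arc of `σ d`. -/
theorem thickRot_sq_zero (hA : ∀ d, 0 < A d) (hα : ∀ d, α (α d) = d) (d : B) :
    thickRot hA σ α (thickRot hA σ α (⟨(d, 0), hA d⟩, true)) = (⟨(σ d, 0), hA _⟩, true) := by
  have h2 : (arcSucc hA (σ⁻¹ * α))⁻¹ ⟨(d, 0), hA d⟩ =
      ⟨(α (σ d), A (α (σ d)) - 1), by have := hA (α (σ d)); dsimp only; omega⟩ := by
    have h0 := hA (α (σ d))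
    rw [Perm.inv_eq_iff_eq, arcSucc_of_not_lt _ _ _ (by omega)]
    simp [hα]
  have h0 := hA (α (σ d))
  rw [thickRot_true, h2, thickRot_false, arcSucc_of_not_lt _ _ _ (by omega)]
  simp [hα]

theorem sameCycle_thickRot_of_sameCycle (hA : ∀ d, 0 < A d) (hα : ∀ d, α (α d) = d) {d e : B}
    (h : σ.SameCycle d e) :
    (thickRot hA σ α).SameCycle (⟨(d, 0), hA d⟩, true) (⟨(e, 0), hA e⟩, true) := by
  obtain ⟨i, -, rfl⟩ := h.exists_pow_eq'
  clear h
  induction i with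
  | zero => exact Perm.SameCycle.refl _ _
  | succ i ih =>
    refine ih.trans ⟨2, ?_⟩
    rw [zpow_two, Perm.mul_apply, thickRot_sq_zero hA hα]
    simp only [pow_succ', Perm.mul_apply]

theorem sameCycle_thickRot (h : IsSphereMap σ α t) (hA : ∀ d, 0 < A d)
    (x y : ArcEdge A × Bool) (hxy : thickTail α t A x = thickTail α t A y) :
    (thickRot hA σ α).SameCycle x y := by
  have hred : ∀ x : ArcEdge A × Bool, ∃ e : ArcEdge A, (thickRot hA σ α).SameCycle x (e, true) := by
    rintro ⟨e, _ | _⟩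
    · exact ⟨arcSucc hA α e, 1, by rw [zpow_one, thickRot_false]⟩
    · exact ⟨e, Perm.SameCycle.refl _ _⟩
  have htail : ∀ {x y}, (thickRot hA σ α).SameCycle x y →
      thickTail α t A x = thickTail α t A y := by
    intro x y hs
    obtain ⟨i, -, rfl⟩ := hs.exists_pow_eq'
    clear hs
    induction i with
    | zero => rfl
    | succ i ih => rw [pow_succ', Perm.mul_apply, thickTail_rot h, ih]
  obtain ⟨e, he⟩ := hred x
  obtain ⟨e', he'⟩ := hred y
  refine he.trans (Perm.SameCycle.trans ?_ he'.symm)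
  have h1 := (htail he).symm.trans (hxy.trans (htail he'))
  obtain ⟨⟨d, i⟩, hi⟩ := e
  obtain ⟨⟨d', i'⟩, hi'⟩ := e'
  change arcPt α t A d i = arcPt α t A d' i' at h1
  dsimp only at hi hi'
  rcases Nat.eq_zero_or_pos i' with rfl | h2
  · rcases Nat.eq_zero_or_pos i with rfl | h3
    · rw [arcPt_zero, arcPt_zero] at h1
      exact sameCycle_thickRot_of_sameCycle hA h.invol (h.sameCycle _ _ (Sum.inl_injective h1))
    · obtain ⟨-, h4⟩ := arcPt_eq_inner ⟨h3, hi⟩ h1.symm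
      omega
  · obtain ⟨rfl, rfl⟩ := arcPt_eq_inner ⟨h2, hi'⟩ h1
    exact Perm.SameCycle.refl _ _

theorem thick_ne (h : IsSphereMap σ α t) (hA : ∀ d, 0 < A d) {d : B} {i : ℕ} (hi : i < A d) :
    arcPt α t A d i ≠ arcPt α t A d (i + 1) := by
  intro h1
  by_cases h2 : i + 1 < A d
  · have := (arcPt_eq_inner ⟨by omega, h2⟩ h1).2
    omega
  · rcases Nat.eq_zero_or_pos i with rfl | h3
    · rw [arcPt_zero, arcPt_of_le (by omega) (by omega)] at h1
      exact h.ne d (Sum.inl_injective h1)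
    · have := (arcPt_eq_inner ⟨h3, hi⟩ h1.symm).2
      omega

/-- The ends of an edge determine it. -/
theorem thick_edge_ext (h : IsSphereMap σ α t) (hk : 3 ≤ k) (hA : ∀ d, 0 < A d)
    (hAk : ∀ d, A d + A (α d) = k) {d e : B} {i j : ℕ} (hi : i < A d) (hj : j < A e) :
    (arcPt α t A d i = arcPt α t A e j → arcPt α t A d (i + 1) = arcPt α t A e (j + 1) →
      d = e ∧ i = j) ∧
    ¬ (arcPt α t A d i = arcPt α t A e (j + 1) ∧ arcPt α t A d (i + 1) = arcPt α t A e j) := by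
  -- As `k ≥ 3`, the two arcs of an edge are not both single edges; otherwise they would be
  -- parallel.
  have hA2 : ∀ d, A d = 1 → A (α d) ≠ 1 := fun d h1 h2 => by have := hAk d; omega
  by_cases h1 : i + 1 < A d
  · constructor
    · intro _ h2
      have h3 := arcPt_eq_inner ⟨by omega, h1⟩ h2.symm
      exact ⟨h3.1.symm, by omega⟩
    · rintro ⟨h2, h3⟩
      obtain ⟨rfl, rfl⟩ := arcPt_eq_inner ⟨by omega, h1⟩ h3.symm
      rcases Nat.eq_zero_or_pos i with rfl | h4
      · by_cases h5 : 0 + 1 + 1 < A e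
        · have := (arcPt_eq_inner ⟨by omega, h5⟩ h2).2
          omega
        · rw [arcPt_zero, arcPt_of_le (by omega) (by omega)] at h2
          exact h.ne e (Sum.inl_injective h2)
      · have := (arcPt_eq_inner ⟨h4, hi⟩ h2.symm).2
        omega
  · rcases Nat.eq_zero_or_pos i with rfl | h2
    · have hd1 : A d = 1 := by omega
      rw [arcPt_zero, arcPt_of_le (d := d) (by omega) (by omega)]
      constructor
      · intro h3 h4
        rcases arcPt_eq_inl h3.symm with ⟨rfl, h5⟩ | ⟨h5, h6, -⟩
        · rcases arcPt_eq_inl h4.symm with ⟨h6, -⟩ | ⟨-, h6, h7⟩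
          · omega
          · exact ⟨(h.inj _ _ h5 h7).symm, rfl⟩
        · omega
      · rintro ⟨h3, h4⟩
        rcases arcPt_eq_inl h4.symm with ⟨rfl, h5⟩ | ⟨h5, h6, -⟩
        · rcases arcPt_eq_inl h3.symm with ⟨h6, -⟩ | ⟨-, h6, h7⟩
          · omega
          · have h8 : e = α d := h.inj _ _ h5 (by rw [h7, h.invol])
            subst h8
            exact hA2 d hd1 (by omega)
        · omega
    · constructor
      · intro h3 _
        have := arcPt_eq_inner ⟨h2, hi⟩ h3.symm
        exact ⟨this.1.symm, this.2.symm⟩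
      · rintro ⟨h3, h4⟩
        obtain ⟨rfl, h5⟩ := arcPt_eq_inner ⟨h2, hi⟩ h3.symm
        rw [arcPt_of_le (d := e) (by omega) (by omega)] at h4
        rcases arcPt_eq_inl h4.symm with ⟨rfl, h6⟩ | ⟨h6, h7, -⟩
        · exact h.ne _ h6
        · omega

theorem thick_conn (h : IsSphereMap σ α t) (hA : ∀ d, 0 < A d) (x y : ArcEdge A × Bool) :
    (Perm.SameCycle.setoid (thickRot hA σ α) ⊔ Perm.SameCycle.setoid (thickRev A)) x y := by
  set r := Perm.SameCycle.setoid (thickRot hA σ α) ⊔ Perm.SameCycle.setoid (thickRev A) with hr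
  have hf : ∀ a, r a (thickRot hA σ α a) := Perm.setoid_le_iff.1 le_sup_left
  have hg : ∀ a, r a (thickRev A a) := Perm.setoid_le_iff.1 le_sup_right
  have hq : ∀ e, r (e, true) (arcSucc hA α e, true) := fun e =>
    r.trans' (hg (e, true)) (hf (e, false))
  have harc : ∀ d i (hi : i < A d), r (⟨(d, 0), hA d⟩, true) (⟨(d, i), hi⟩, true) := by
    intro d i
    induction i with
    | zero => intro hi; exact r.refl' _
    | succ i ih =>
      intro hi
      have := hq ⟨(d, i), (by dsimp only; omega)⟩
      rw [arcSucc_of_lt hA α _ hi] at this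
      exact r.trans' (ih (by omega)) this
  have hbase : Perm.SameCycle.setoid σ ⊔ Perm.SameCycle.setoid α ≤
      r.comap (fun d => ((⟨(d, 0), hA d⟩, true) : ArcEdge A × Bool)) := by
    refine sup_le (Perm.setoid_le_iff.2 fun d => ?_) (Perm.setoid_le_iff.2 fun d => ?_)
    · change r _ _
      have h1 := r.trans' (hf (⟨(d, 0), hA d⟩, true)) (hf _)
      rwa [thickRot_sq_zero hA h.invol] at h1
    · change r _ _
      have h0 := hA d
      have h1 := hq ⟨(d, A d - 1), (by dsimp only; omega)⟩
      rw [arcSucc_of_not_lt hA α _ (by omega)] at h1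
      exact r.trans' (harc d _ _) h1
  have hred : ∀ x : ArcEdge A × Bool, r x (⟨(x.1.1.1, 0), hA _⟩, true) := by
    rintro ⟨⟨⟨d, i⟩, hi⟩, _ | _⟩
    · exact r.trans' (hg _) (r.symm' (harc d i hi))
    · exact r.symm' (harc d i hi)
  exact r.trans' (hred x) (r.trans' (hbase (h.conn _ _)) (r.symm' (hred y)))

/-- Replacing every edge by two arcs of total length `k` keeps a map on the sphere. -/
theorem IsSphereMap.thick (h : IsSphereMap σ α t) [Finite X] (hk : 3 ≤ k) (hA : ∀ d, 0 < A d)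
    (hAk : ∀ d, A d + A (α d) = k) :
    IsSphereMap (thickRot hA σ α) (thickRev A) (thickTail α t A) where
  invol := by rintro ⟨x, _ | _⟩ <;> rfl
  tail_rot := thickTail_rot h hA
  sameCycle := sameCycle_thickRot h hA
  surj := by
    rintro (x | ⟨⟨d, i⟩, hi⟩)
    · obtain ⟨d, rfl⟩ := h.surj x
      exact ⟨(⟨(d, 0), hA d⟩, true), arcPt_zero (α := α) d⟩
    · exact ⟨(⟨(d, i), hi.2⟩, true), arcPt_inner hi⟩
  ne := by
    rintro ⟨⟨⟨d, i⟩, hi⟩, _ | _⟩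
    · exact (thick_ne h hA hi).symm
    · exact thick_ne h hA hi
  inj := by
    rintro ⟨⟨⟨d, i⟩, hi⟩, b⟩ ⟨⟨⟨e, j⟩, hj⟩, b'⟩ h1 h2
    have h3 := thick_edge_ext h hk hA hAk hi hj
    rcases b with _ | _ <;> rcases b' with _ | _
    · obtain ⟨rfl, rfl⟩ := h3.1 h2 h1; rfl
    · exact absurd ⟨h2, h1⟩ h3.2
    · exact absurd ⟨h1, h2⟩ h3.2
    · obtain ⟨rfl, rfl⟩ := h3.1 h1 h2; rfl
  conn := thick_conn h hA
  euler := by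
    classical
    have h1 := cycleCount_thick (σ := σ) hA h.invol
    have h2 := card_arcEdge hA
    have h3 : Nat.card (ArcEdge A) ≤ Perm.cycleCount (thickRev A) :=
      Perm.card_le_cycleCount _ Prod.fst (by rintro ⟨x, _ | _⟩ <;> rfl)
        fun x => ⟨(x, true), rfl⟩
    have h4 := h.euler
    rw [Nat.card_prod, Nat.card_sum, Nat.card_eq_fintype_card (α := Bool), Fintype.card_bool]
    omega

end Arcs

/-! ### Girth and colorings of the graph of arcs. -/

/-- Every nonempty set of edges of the graph without vertices of degree one has at least `g`
edges. -/
def HasGirthAtLeast {B X : Type*} (α : Perm B) (t : B → X) (g : ℕ) : Prop :=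
  ∀ P : Set B, P.Nonempty → (∀ d ∈ P, α d ∈ P) → (∀ d ∈ P, ∃ e ∈ P, e ≠ d ∧ t e = t d) →
    2 * g ≤ P.ncard

namespace IsSphereMap

variable {B X : Type*} [Finite B] [Finite X] {A : B → ℕ} {σ α : Perm B} {t : B → X} {k : ℕ}

/-- The graph in which every edge is replaced by two arcs. -/
abbrev thickGraph (α : Perm B) (t : B → X) (A : B → ℕ) : SimpleGraph (X ⊕ ArcPoint A) :=
  mapGraph (thickRev A) (thickTail α t A)

theorem thick_adj_iff (h : IsSphereMap σ α t) (hk : 3 ≤ k) (hA : ∀ d, 0 < A d)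
    (hAk : ∀ d, A d + A (α d) = k) {u v : X ⊕ ArcPoint A} :
    (thickGraph α t A).Adj u v ↔ ∃ e : ArcEdge A,
      (u = arcPt α t A e.1.1 e.1.2 ∧ v = arcPt α t A e.1.1 (e.1.2 + 1)) ∨
      (u = arcPt α t A e.1.1 (e.1.2 + 1) ∧ v = arcPt α t A e.1.1 e.1.2) := by
  rw [(h.thick hk hA hAk).adj_iff]
  constructor
  · rintro ⟨⟨e, _ | _⟩, rfl, rfl⟩
    · exact ⟨e, Or.inr ⟨rfl, rfl⟩⟩
    · exact ⟨e, Or.inl ⟨rfl, rfl⟩⟩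
  · rintro ⟨e, ⟨rfl, rfl⟩ | ⟨rfl, rfl⟩⟩
    · exact ⟨(e, true), rfl, rfl⟩
    · exact ⟨(e, false), rfl, rfl⟩

/-- The cycle formed by the two arcs that replace an edge. -/
def block (α : Perm B) (t : B → X) (A : B → ℕ) (k : ℕ) (d : B) (j : ZMod k) : X ⊕ ArcPoint A :=
  if j.val < A d then arcPt α t A d j.val else arcPt α t A (α d) (j.val - A d)

theorem block_edge (h : IsSphereMap σ α t) (hA : ∀ d, 0 < A d)
    (hAk : ∀ d, A d + A (α d) = k) [NeZero k] (d : B) (j : ZMod k) :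
    ∃ e : ArcEdge A, (e.1.1 = d ∨ e.1.1 = α d) ∧
      block α t A k d j = arcPt α t A e.1.1 e.1.2 ∧
      block α t A k d (j + 1) = arcPt α t A e.1.1 (e.1.2 + 1) := by
  have h1 := hA d
  have h2 := hA (α d)
  have h3 := hAk d
  have hv := ZMod.val_lt j
  have hnext : (j + 1).val = if j.val + 1 < k then j.val + 1 else 0 := by
    have h4 : j + 1 = ((j.val + 1 : ℕ) : ZMod k) := by simp
    rw [h4, ZMod.val_natCast]
    split_ifs with h5
    · exact Nat.mod_eq_of_lt h5
    · rw [show j.val + 1 = k by omega, Nat.mod_self]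
  unfold block
  rw [hnext]
  by_cases h4 : j.val < A d
  · refine ⟨⟨(d, j.val), h4⟩, Or.inl rfl, by rw [if_pos h4], ?_⟩
    rw [if_pos (show j.val + 1 < k by omega)]
    by_cases h5 : j.val + 1 < A d
    · rw [if_pos h5]
    · rw [if_neg h5, show j.val + 1 - A d = 0 by omega, arcPt_zero]
      dsimp only
      exact (arcPt_of_le (by omega) (by omega)).symm
  · refine ⟨⟨(α d, j.val - A d), (by dsimp only; omega)⟩, Or.inr rfl, by rw [if_neg h4], ?_⟩
    by_cases h5 : j.val + 1 < k
    · rw [if_pos h5, if_neg (by omega)]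
      dsimp only
      congr 1
      omega
    · rw [if_neg h5, if_pos h1, arcPt_zero]
      dsimp only
      rw [arcPt_of_le (by omega) (by omega), h.invol]

theorem arcPt_injOn {d e : B} {i j : ℕ} (hi : i < A d) (hj : j < A e)
    (hij : arcPt α t A d i = arcPt α t A e j) : i = j ∧ (d = e ∨ i = 0 ∧ t d = t e) := by
  rcases Nat.eq_zero_or_pos i with rfl | h1
  · rcases Nat.eq_zero_or_pos j with rfl | h2
    · rw [arcPt_zero, arcPt_zero] at hij
      exact ⟨rfl, Or.inr ⟨rfl, Sum.inl_injective hij⟩⟩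
    · obtain ⟨rfl, rfl⟩ := arcPt_eq_inner ⟨h2, hj⟩ hij
      exact ⟨rfl, Or.inl rfl⟩
  · obtain ⟨rfl, rfl⟩ := arcPt_eq_inner ⟨h1, hi⟩ hij.symm
    exact ⟨rfl, Or.inl rfl⟩

theorem isRing_block (h : IsSphereMap σ α t) (hk : 3 ≤ k) (hA : ∀ d, 0 < A d)
    (hAk : ∀ d, A d + A (α d) = k) (d : B) :
    (thickGraph α t A).IsRing (block α t A k d) where
  inj i j hij := by
    have : NeZero k := ⟨by omega⟩
    have h3 := hAk d
    have hi := ZMod.val_lt i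
    have hj := ZMod.val_lt j
    have hne : ¬ t d = t (α d) := h.ne d
    have hne' : d ≠ α d := fun h1 => hne (congrArg t h1)
    apply ZMod.val_injective k
    unfold block at hij
    split_ifs at hij with h1 h2 h2
    · exact (arcPt_injOn h1 h2 hij).1
    · rcases (arcPt_injOn h1 (by omega) hij).2 with h4 | h4
      · exact absurd h4 hne'
      · exact absurd h4.2 hne
    · rcases (arcPt_injOn (by omega) h2 hij).2 with h4 | h4
      · exact absurd h4.symm hne'
      · exact absurd h4.2.symm hne
    · have := (arcPt_injOn (by omega) (by omega) hij).1
      omega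
  adj j := by
    have : NeZero k := ⟨by omega⟩
    obtain ⟨e, -, h1, h2⟩ := h.block_edge hA hAk d j
    exact (h.thick_adj_iff hk hA hAk).2 ⟨e, Or.inl ⟨h1, h2⟩⟩

/-- Inner points of arcs have degree two, so a cycle consists of whole arcs. If it contains both
arcs of some edge, it is the cycle formed by them. Otherwise its arcs belong to distinct edges,
which form a set without ends of degree one; there are at least `g` of these, each contributing at
least `a`. -/
theorem length_of_isRing (h : IsSphereMap σ α t) (hk : 3 ≤ k) (hA : ∀ d, 0 < A d)
    (hAk : ∀ d, A d + A (α d) = k) {a g : ℕ} (ha : ∀ d, a ≤ A d) (hg : HasGirthAtLeast α t g)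
    {m : ℕ} (hm : 3 ≤ m) {c : ZMod m → X ⊕ ArcPoint A} (hc : (thickGraph α t A).IsRing c) :
    m = k ∨ a * g ≤ m := by
  classical
  have : NeZero m := ⟨by omega⟩
  have : NeZero k := ⟨by omega⟩
  set pt : ArcEdge A → X ⊕ ArcPoint A := fun e => arcPt α t A e.1.1 e.1.2 with hpt
  set pt' : ArcEdge A → X ⊕ ArcPoint A := fun e => arcPt α t A e.1.1 (e.1.2 + 1) with hpt'
  have hext : ∀ e e' : ArcEdge A, pt e = pt e' → pt' e = pt' e' → e = e' := by
    rintro ⟨⟨d, i⟩, hi⟩ ⟨⟨d', i'⟩, hi'⟩ h1 h2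
    obtain ⟨rfl, rfl⟩ := (thick_edge_ext h hk hA hAk hi hi').1 h1 h2
    rfl
  have hext' : ∀ e e' : ArcEdge A, pt e = pt' e' → pt' e = pt e' → False := by
    rintro ⟨⟨d, i⟩, hi⟩ ⟨⟨d', i'⟩, hi'⟩ h1 h2
    exact (thick_edge_ext h hk hA hAk hi hi').2 ⟨h1, h2⟩
  have hne : ∀ e, pt e ≠ pt' e := fun e => thick_ne h hA e.2
  let S : Set (ArcEdge A) := {e | ∃ j, (c j = pt e ∧ c (j + 1) = pt' e) ∨
    (c j = pt' e ∧ c (j + 1) = pt e)}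
  have hSm : S.ncard ≤ m := by
    choose f hf using fun e : S => e.2
    have hinj : Function.Injective f := by
      intro e e' hee
      have h1 := hf e
      have h2 := hf e'
      rw [← hee] at h2
      apply Subtype.ext
      rcases h1 with h1 | h1 <;> rcases h2 with h2 | h2
      · exact hext _ _ (h1.1.symm.trans h2.1) (h1.2.symm.trans h2.2)
      · exact (hext' _ _ (h1.1.symm.trans h2.1) (h1.2.symm.trans h2.2)).elim
      · exact (hext' _ _ (h1.2.symm.trans h2.2) (h1.1.symm.trans h2.1)).elim
      · exact hext _ _ (h1.2.symm.trans h2.2) (h1.1.symm.trans h2.1)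
    have := Nat.card_le_card_of_injective f hinj
    rwa [Nat.card_zmod] at this
  have hedge : ∀ j, ∃ e, (c j = pt e ∧ c (j + 1) = pt' e) ∨ (c j = pt' e ∧ c (j + 1) = pt e) :=
    fun j => (h.thick_adj_iff hk hA hAk).1 (hc.adj j)
  have hdeg : ∀ e ∈ S, ∀ v, (v = pt e ∨ v = pt' e) →
      ∃ e' ∈ S, e' ≠ e ∧ (v = pt e' ∨ v = pt' e') := by
    intro e he v hv
    obtain ⟨i, rfl⟩ : ∃ i, v = c i := by
      obtain ⟨j, h1 | h1⟩ := he <;> rcases hv with rfl | rfl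
      · exact ⟨_, h1.1.symm⟩
      · exact ⟨_, h1.2.symm⟩
      · exact ⟨_, h1.2.symm⟩
      · exact ⟨_, h1.1.symm⟩
    obtain ⟨e1, h1⟩ := hedge i
    obtain ⟨e2, h2⟩ := hedge (i - 1)
    rw [sub_add_cancel] at h2
    have h12 : e1 ≠ e2 := by
      rintro rfl
      have hcc : c (i + 1) ≠ c (i - 1) := by
        intro h3
        apply SimpleGraph.IsRing.two_ne_zero hm
        linear_combination hc.inj h3
      rcases h1 with h1 | h1 <;> rcases h2 with h2 | h2
      · exact hne _ (h1.1.symm.trans h2.2)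
      · exact hcc (h1.2.trans h2.1.symm)
      · exact hcc (h1.2.trans h2.1.symm)
      · exact hne _ (h2.2.symm.trans h1.1)
    by_cases h3 : e1 = e
    · refine ⟨e2, ⟨i - 1, by rwa [sub_add_cancel]⟩, fun h4 => h12 (h3.trans h4.symm), ?_⟩
      exact h2.elim (fun h => Or.inr h.2) fun h => Or.inl h.2
    · exact ⟨e1, ⟨i, h1⟩, h3, h1.elim (fun h => Or.inl h.1) fun h => Or.inr h.1⟩
  by_cases hblock : ∃ d, ∀ e : ArcEdge A, e.1.1 = d ∨ e.1.1 = α d → e ∈ S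
  · left
    obtain ⟨d, hd⟩ := hblock
    refine SimpleGraph.IsRing.length_eq hk hc (h.isRing_block hk hA hAk d) fun i => ?_
    obtain ⟨e, he, h1, h2⟩ := h.block_edge hA hAk d i
    obtain ⟨j, h3 | h3⟩ := hd e he
    · exact ⟨j, Or.inl ⟨h1.trans h3.1.symm, h2.trans h3.2.symm⟩⟩
    · exact ⟨j, Or.inr ⟨h1.trans h3.2.symm, h2.trans h3.1.symm⟩⟩
  right
  -- At an inner point the cycle has to continue along the same arc.
  have hup : ∀ d i (hi : i + 1 < A d), (⟨(d, i), by dsimp only; omega⟩ : ArcEdge A) ∈ S →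
      (⟨(d, i + 1), hi⟩ : ArcEdge A) ∈ S := by
    intro d i hi hS
    obtain ⟨⟨⟨d', i'⟩, hi'⟩, h1, h2, h3⟩ := hdeg _ hS (arcPt α t A d (i + 1)) (Or.inr rfl)
    rcases h3 with h3 | h3
    · obtain ⟨rfl, rfl⟩ := arcPt_eq_inner ⟨by omega, hi⟩ h3.symm
      exact h1
    · obtain ⟨rfl, h4⟩ := arcPt_eq_inner ⟨by omega, hi⟩ h3.symm
      dsimp only at h4
      obtain rfl : i' = i := by omega
      exact absurd rfl h2
  have hdown : ∀ d i (hi : i + 1 < A d), (⟨(d, i + 1), hi⟩ : ArcEdge A) ∈ S →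
      (⟨(d, i), by dsimp only; omega⟩ : ArcEdge A) ∈ S := by
    intro d i hi hS
    obtain ⟨⟨⟨d', i'⟩, hi'⟩, h1, h2, h3⟩ := hdeg _ hS (arcPt α t A d (i + 1)) (Or.inl rfl)
    rcases h3 with h3 | h3
    · obtain ⟨rfl, rfl⟩ := arcPt_eq_inner ⟨by omega, hi⟩ h3.symm
      exact absurd rfl h2
    · obtain ⟨rfl, h4⟩ := arcPt_eq_inner ⟨by omega, hi⟩ h3.symm
      dsimp only at h4
      obtain rfl : i' = i := by omega
      exact h1
  let S0 : Set B := {d | (⟨(d, 0), hA d⟩ : ArcEdge A) ∈ S}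
  have hfull : ∀ d ∈ S0, ∀ i (hi : i < A d), (⟨(d, i), hi⟩ : ArcEdge A) ∈ S := by
    intro d hd i
    induction i with
    | zero => intro _; exact hd
    | succ i ih => intro hi; exact hup d i hi (ih (by omega))
  have hS0 : ∀ d i (hi : i < A d), (⟨(d, i), hi⟩ : ArcEdge A) ∈ S → d ∈ S0 := by
    intro d i
    induction i with
    | zero => intro _ h1; exact h1
    | succ i ih => intro hi h1; exact ih _ (hdown d i hi h1)
  have hboth : ∀ d ∈ S0, α d ∉ S0 := by
    intro d h1 h2
    apply hblock
    refine ⟨d, ?_⟩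
    rintro ⟨⟨e, i⟩, hi⟩ (rfl | rfl)
    · exact hfull _ h1 _ _
    · exact hfull _ h2 _ _
  let P : Set B := S0 ∪ α '' S0
  have hmemP : ∀ d, d ∈ P ↔ d ∈ S0 ∨ α d ∈ S0 := by
    intro d
    refine or_congr Iff.rfl ⟨?_, fun h1 => ⟨_, h1, h.invol d⟩⟩
    rintro ⟨e, he, rfl⟩
    rwa [h.invol]
  have hend : ∀ d : B, ∀ e ∈ S, (Sum.inl (t d) = pt e ∨ Sum.inl (t d) = pt' e) →
      e.1.1 ∈ S0 ∧ ((t e.1.1 = t d ∧ e.1.2 = 0) ∨ (t (α e.1.1) = t d ∧ e.1.2 + 1 = A e.1.1)) := by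
    rintro d ⟨⟨e, i⟩, hi⟩ he h1
    refine ⟨hS0 _ _ _ he, ?_⟩
    dsimp only at hi
    rcases h1 with h1 | h1
    · rcases arcPt_eq_inl h1.symm with h2 | h2
      · exact Or.inl ⟨h2.2, h2.1⟩
      · dsimp only at h2; omega
    · rcases arcPt_eq_inl h1.symm with h2 | h2
      · dsimp only at h2; omega
      · exact Or.inr ⟨h2.2.2, by dsimp only at h2 ⊢; omega⟩
  have hP := hg P ?_ ?_ ?_
  · have h1 : P.ncard ≤ S0.ncard + S0.ncard :=
      (Set.ncard_union_le _ _).trans (add_le_add le_rfl (Set.ncard_image_le (Set.toFinite _)))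
    have h2 : S0.ncard * a ≤ S.ncard := by
      let f : S0 × Fin a → S := fun x =>
        ⟨⟨(x.1.1, x.2.1), lt_of_lt_of_le x.2.2 (ha _)⟩, hfull _ x.1.2 _ _⟩
      have hf : Function.Injective f := by
        rintro ⟨⟨d, hd⟩, i⟩ ⟨⟨d', hd'⟩, i'⟩ h3
        have h4 := congrArg (fun z : S => z.1.1) h3
        simp only [f, Prod.mk.injEq] at h4
        obtain ⟨rfl, h5⟩ := h4
        rw [Fin.ext h5]
      have := Nat.card_le_card_of_injective f hf
      rwa [Nat.card_prod, Nat.card_eq_fintype_card (α := Fin a), Fintype.card_fin] at this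
    have h3 : a * g ≤ S0.ncard * a := by
      rw [mul_comm]
      exact Nat.mul_le_mul_right a (by omega)
    omega
  · obtain ⟨e, he⟩ := hedge 0
    exact ⟨e.1.1, Or.inl (hS0 _ _ e.2 ⟨0, he⟩)⟩
  · intro d hd
    rw [hmemP] at hd ⊢
    rw [h.invol]
    exact hd.symm
  · intro d hd
    rw [hmemP] at hd
    -- At the end of a used arc the cycle goes on with another edge of `S`; the arc of that edge
    -- yields a different dart of `P` at the same vertex.
    have hfin : ∀ e0 ∈ S, (Sum.inl (t d) = pt e0 ∨ Sum.inl (t d) = pt' e0) →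
        (∀ e ∈ S0, (e = d → e0 = ⟨(d, 0), hA d⟩) ∧
          (e = α d → e0.1 = (α d, A (α d) - 1))) →
        ∃ e ∈ P, e ≠ d ∧ t e = t d := by
      intro e0 h1 h2 h3
      obtain ⟨e', he', hne', hv⟩ := hdeg e0 h1 _ h2
      obtain ⟨h4, ⟨h5, h6⟩ | ⟨h5, h6⟩⟩ := hend d e' he' hv
      · refine ⟨e'.1.1, (hmemP _).2 (Or.inl h4), fun h7 => hne' ?_, h5⟩
        rw [(h3 _ h4).1 h7]
        apply Subtype.ext
        exact Prod.ext h7 h6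
      · refine ⟨α e'.1.1, (hmemP _).2 (Or.inr (by rwa [h.invol])), fun h7 => hne' ?_, h5⟩
        have h8 : e'.1.1 = α d := by rw [← h7, h.invol]
        apply Subtype.ext
        rw [(h3 _ h4).2 h8]
        refine Prod.ext h8 ?_
        rw [h8] at h6
        dsimp only
        omega
    rcases hd with hd | hd
    · refine hfin _ hd (Or.inl (arcPt_zero d).symm) fun e he => ⟨fun _ => rfl, ?_⟩
      rintro rfl
      exact absurd he (hboth d hd)
    · have h0 := hA (α d)
      refine hfin ⟨(α d, A (α d) - 1), by dsimp only; omega⟩ (hfull _ hd _ _) (Or.inr ?_)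
        fun e he => ⟨?_, fun _ => rfl⟩
      · simp only [hpt']
        rw [arcPt_of_le (by omega) (by omega), h.invol]
      · rintro rfl
        exact absurd hd (hboth _ he)

theorem egirth_thick (h : IsSphereMap σ α t) [Nonempty B] (hk : 3 ≤ k) (hA : ∀ d, 0 < A d)
    (hAk : ∀ d, A d + A (α d) = k) {a g : ℕ} (ha : ∀ d, a ≤ A d) (hg : HasGirthAtLeast α t g)
    (hkg : k ≤ a * g) : (thickGraph α t A).egirth = (k : ℕ∞) := by
  have : NeZero k := ⟨by omega⟩
  apply le_antisymm
  · have hr := h.isRing_block hk hA hAk (Classical.arbitrary B)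
    obtain ⟨v, w, hw, hlen⟩ := SimpleGraph.exists_isCycle_of_injOn hk
      (fun i : ℕ => block α t A k (Classical.arbitrary B) (i : ZMod k)) (by
        intro i hi j hj hij
        exact SimpleGraph.natCast_inj_of_lt hi hj (hr.inj hij)) (fun i _ => by
          have := hr.adj i
          push_cast
          exact this) (by
        have := hr.adj ((k - 1 : ℕ) : ZMod k)
        rw [← Nat.cast_add_one, Nat.sub_add_cancel (by omega), ZMod.natCast_self] at this
        simpa using this)
    rw [← hlen]
    exact SimpleGraph.egirth_le_length hw
  · rw [SimpleGraph.le_egirth]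
    intro v w hw
    have h3 := hw.three_le_length
    have : NeZero w.length := ⟨by omega⟩
    have := h.length_of_isRing hk hA hAk ha hg h3 (hw.isRing rfl)
    have h4 : k ≤ w.length := by omega
    exact_mod_cast h4

theorem noCycleLengthIn_thick (h : IsSphereMap σ α t) (hk : 3 ≤ k) (hA : ∀ d, 0 < A d)
    (hAk : ∀ d, A d + A (α d) = k) {a g m : ℕ} (ha : ∀ d, a ≤ A d) (hg : HasGirthAtLeast α t g)
    (hm : m < a * g) : (thickGraph α t A).NoCycleLengthIn (k + 1) m := by
  intro v w hw hlen
  have h3 := hw.three_le_length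
  have : NeZero w.length := ⟨by omega⟩
  have := h.length_of_isRing hk hA hAk ha hg h3 (hw.isRing rfl)
  omega

/-- The colors of the ends of an edge differ by the length of the arc. -/
theorem color_sub_color (h : IsSphereMap σ α t) {n : ℕ} (hk : 3 ≤ n + 2) (hA : ∀ d, 0 < A d)
    (hAk : ∀ d, A d + A (α d) = n + 2) (hodd : Odd (n + 2))
    (φ : thickGraph α t A →g SimpleGraph.cycleGraph (n + 2)) :
    ∃ f : X → ZMod (n + 2), ∀ d, f (t (α d)) - f (t d) = (A d : ZMod (n + 2)) ∨
      f (t (α d)) - f (t d) = -(A d : ZMod (n + 2)) := by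
  obtain ⟨f, hf⟩ : ∃ f : X ⊕ ArcPoint A → ZMod (n + 2), ∀ u v, (thickGraph α t A).Adj u v →
      f v - f u = 1 ∨ f v - f u = -1 :=
    ⟨fun u => φ u, fun u v huv => (SimpleGraph.cycleGraph_adj_zmod _ _).1 (φ.map_rel huv)⟩
  refine ⟨fun x => f (Sum.inl x), fun d => ?_⟩
  have hr := h.isRing_block hk hA hAk d
  -- The two arcs form a cycle of odd length `n + 2`, around which the coloring winds once; the far
  -- end of the edge is at position `A d`.
  obtain ⟨ε, hε⟩ := SimpleGraph.exists_unit_of_odd_steps hodd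
    (fun i => f (block α t A (n + 2) d i)) fun i => hf _ _ (hr.adj i)
  have h1 := hA d
  have h2 := hA (α d)
  have h3 := hAk d
  have h4 : block α t A (n + 2) d 0 = Sum.inl (t d) := by
    unfold block
    rw [ZMod.val_zero, if_pos h1, arcPt_zero]
  have h5 : block α t A (n + 2) d ((A d : ℕ) : ZMod (n + 2)) = Sum.inl (t (α d)) := by
    unfold block
    rw [ZMod.val_natCast, Nat.mod_eq_of_lt (by omega), if_neg (lt_irrefl _), Nat.sub_self,
      arcPt_zero]
  have h6 := hε ((A d : ℕ) : ZMod (n + 2))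
  dsimp only at h6 ⊢
  rw [h4, h5] at h6
  rcases Int.units_eq_one_or ε with rfl | rfl
  · left
    rw [h6]
    push_cast
    ring
  · right
    rw [h6]
    push_cast
    ring

theorem thick_adj_of_one (h : IsSphereMap σ α t) (hk : 3 ≤ k) (hA : ∀ d, 0 < A d)
    (hAk : ∀ d, A d + A (α d) = k) {d : B} (hd : A d = 1) :
    (thickGraph α t A).Adj (Sum.inl (t d)) (Sum.inl (t (α d))) := by
  refine (h.thick_adj_iff hk hA hAk).2 ⟨⟨(d, 0), hA d⟩, Or.inl ⟨(arcPt_zero d).symm, ?_⟩⟩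
  exact (arcPt_of_le (by simp) (by simp [hd])).symm

end IsSphereMap

theorem not_steinbergProperty_of_thick {B X : Type} [Finite B] [Finite X] [Nonempty B] {A : B → ℕ}
    {σ α : Perm B} {t : B → X} {k : ℕ} (h : IsSphereMap σ α t) (hk : 3 ≤ k) (hA : ∀ d, 0 < A d)
    (hAk : ∀ d, A d + A (α d) = k) {a g m : ℕ} (ha : ∀ d, a ≤ A d) (hg : HasGirthAtLeast α t g)
    (hkg : k ≤ a * g) (hm : m < a * g)
    (hcol : (IsSphereMap.thickGraph α t A →g SimpleGraph.cycleGraph k) → False) :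
    ¬ SteinbergProperty k m := by
  intro hS
  obtain ⟨φ⟩ := hS _ (IsSphereMap.thickGraph α t A) (h.thick hk hA hAk).isPlanar
    (h.egirth_thick hk hA hAk ha hg hkg) (h.noCycleLengthIn_thick hk hA hAk ha hg hm)
  exact hcol φ

/-! ### Subdivided wheels. -/

/-- The darts of a wheel with `n` spokes of length `s`: for `j < s` the darts with indices `i`, `j`
lie on the `i`-th spoke, and those with indices `i`, `s` on the `i`-th edge of the rim. -/
abbrev WheelDart (n s : ℕ) := ZMod n × Fin (s + 1) × Bool

/-- The hub of a wheel and the points on its spokes. -/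
abbrev WheelPoint (n s : ℕ) := Option (ZMod n × Fin s)

namespace Wheel

variable {n s : ℕ}

/-- The point on a spoke at a given distance from the hub. -/
def point (s : ℕ) (i : ZMod n) (j : ℕ) : WheelPoint n s :=
  if h : 0 < j ∧ j ≤ s then some (i, ⟨j - 1, by omega⟩) else none

theorem point_zero (i : ZMod n) : point s i 0 = none := by simp [point]

theorem point_eq {i i' : ZMod n} {j j' : ℕ} (hj : j ≤ s) (hj' : j' ≤ s)
    (h : point s i j = point s i' j') : j = j' ∧ (j = 0 ∨ i = i') := by
  unfold point at h
  split_ifs at h with h1 h2 h2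
  · simp only [Option.some.injEq, Prod.mk.injEq, Fin.mk.injEq] at h
    exact ⟨by omega, Or.inr h.1⟩
  · omega

theorem exists_point (x : WheelPoint n s) (hx : x ≠ none) :
    ∃ i j, 0 < j ∧ j ≤ s ∧ x = point s i j := by
  obtain ⟨⟨i, j⟩, rfl⟩ := Option.ne_none_iff_exists'.1 hx
  refine ⟨i, j + 1, by omega, by omega, ?_⟩
  rw [point, dif_pos (by omega)]
  simp

/-- The end from which a dart leaves. -/
def tail : WheelDart n s → WheelPoint n s
  | (i, j, true) => point s i j
  | (i, j, false) => if j.val < s then point s i (j + 1) else point s (i + 1) s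

theorem tail_true (i : ZMod n) (j : Fin (s + 1)) : tail (i, j, true) = point s i j := rfl

theorem tail_false_of_lt (i : ZMod n) {j : Fin (s + 1)} (h : j.val < s) :
    tail (i, j, false) = point s i (j + 1) := if_pos h

theorem tail_false_of_not_lt (i : ZMod n) {j : Fin (s + 1)} (h : ¬ j.val < s) :
    tail (i, j, false) = point s (i + 1) s := if_neg h

/-- The reversal of darts. -/
def rev (n s : ℕ) : Perm (WheelDart n s) :=
  Function.Involutive.toPerm (fun d => (d.1, d.2.1, !d.2.2)) fun d => by simp

@[simp]
theorem rev_apply (i : ZMod n) (j : Fin (s + 1)) (b : Bool) : rev n s (i, j, b) = (i, j, !b) := rfl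

/-- The next dart in the rotation. -/
def rotFun : WheelDart n s → WheelDart n s
  | (i, j, true) => if j.val = 0 then (i + 1, 0, true) else (i, ⟨j - 1, by omega⟩, false)
  | (i, j, false) => if h : j.val < s then
      if j.val + 1 = s then (i - 1, ⟨s, by omega⟩, false) else (i, ⟨j.val + 1, by omega⟩, true)
    else (i + 1, j, true)

theorem rotFun_injective [NeZero s] : Function.Injective (rotFun (n := n) (s := s)) := by
  have hs := NeZero.pos s
  rintro ⟨i, ⟨j, hj⟩, _ | _⟩ ⟨i', ⟨j', hj'⟩, _ | _⟩ h <;> unfold rotFun at h <;> dsimp only at h <;>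
    split_ifs at h <;>
    simp only [Prod.mk.injEq, add_left_inj, sub_left_inj, Bool.false_eq_true,
      and_false, Bool.true_eq_false, and_true, Fin.ext_iff, Fin.val_zero] at h ⊢ <;>
    first
    | (obtain ⟨rfl, h1⟩ := h; exact ⟨rfl, by omega⟩)
    | (exfalso; obtain ⟨-, h1⟩ := h; omega)

/-- The rotation. -/
noncomputable def rot (n s : ℕ) [NeZero n] [NeZero s] : Perm (WheelDart n s) :=
  Equiv.ofBijective rotFun (Finite.injective_iff_bijective.1 rotFun_injective)

section

variable [NeZero n] [NeZero s]

theorem rot_hub (i : ZMod n) : rot n s (i, 0, true) = (i + 1, 0, true) := by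
  simp [rot, rotFun]

theorem rot_true (i : ZMod n) {j : ℕ} (hj : j + 1 < s + 1) :
    rot n s (i, ⟨j + 1, hj⟩, true) = (i, ⟨j, by omega⟩, false) := by
  simp [rot, rotFun]

theorem rot_false (i : ZMod n) {j : ℕ} (hj : j + 1 < s) :
    rot n s (i, ⟨j, by omega⟩, false) = (i, ⟨j + 1, by omega⟩, true) := by
  simp [rot, rotFun, hj.ne, (show j < s by omega)]

theorem rot_end (i : ZMod n) {j : ℕ} (hj : j + 1 = s) :
    rot n s (i, ⟨j, by omega⟩, false) = (i - 1, ⟨s, by omega⟩, false) := by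
  subst hj
  simp [rot, rotFun]

theorem rot_rim (i : ZMod n) :
    rot n s (i, ⟨s, by omega⟩, false) = (i + 1, ⟨s, by omega⟩, true) := by
  simp [rot, rotFun]

theorem tail_hub {d : WheelDart n s} (hd : tail d = none) : ∃ i, d = (i, 0, true) := by
  have hs := NeZero.pos s
  obtain ⟨i, ⟨j, hj⟩, _ | _⟩ := d
  · by_cases h : j < s
    · rw [tail_false_of_lt i h, ← point_zero i] at hd
      have := (point_eq (by dsimp only; omega) (by omega) hd).1
      omega
    · rw [tail_false_of_not_lt i h, ← point_zero i] at hd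
      have := (point_eq le_rfl (by omega) hd).1
      omega
  · rw [tail_true, ← point_zero i] at hd
    obtain rfl := (point_eq (by dsimp only; omega) (by omega) hd).1
    exact ⟨i, rfl⟩

theorem tail_point {d : WheelDart n s} {i : ZMod n} {j : ℕ} (hj : j + 1 ≤ s)
    (hd : tail d = point s i (j + 1)) :
    d = (i, ⟨j + 1, by omega⟩, true) ∨ d = (i, ⟨j, by omega⟩, false) ∨
      (j + 1 = s ∧ d = (i - 1, ⟨s, by omega⟩, false)) := by
  obtain ⟨i', ⟨j', hj'⟩, _ | _⟩ := d
  · by_cases h : j' < s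
    · rw [tail_false_of_lt i' h] at hd
      obtain ⟨h1, h2⟩ := point_eq (by dsimp only; omega) hj hd
      obtain rfl : j' = j := by simpa using h1
      obtain rfl : i' = i := by simpa using h2
      exact Or.inr (Or.inl rfl)
    · rw [tail_false_of_not_lt i' h] at hd
      obtain ⟨h1, h2⟩ := point_eq le_rfl hj hd
      obtain rfl : j' = s := by omega
      refine Or.inr (Or.inr ⟨h1.symm, ?_⟩)
      rw [← h2.resolve_left (by omega), add_sub_cancel_right]
  · rw [tail_true] at hd
    obtain ⟨h1, h2⟩ := point_eq (by dsimp only; omega) hj hd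
    obtain rfl : j' = j + 1 := h1
    obtain rfl : i' = i := by simpa using h2
    exact Or.inl rfl

theorem tail_rot (d : WheelDart n s) : tail (rot n s d) = tail d := by
  obtain ⟨i, ⟨j, hj⟩, _ | _⟩ := d
  · rcases lt_trichotomy (j + 1) s with h | h | h
    · rw [rot_false i h, tail_true, tail_false_of_lt i (by dsimp only; omega)]
    · rw [rot_end i h, tail_false_of_not_lt _ (by simp), tail_false_of_lt i (by dsimp only; omega),
        sub_add_cancel]
      dsimp only
      rw [h]
    · obtain rfl : j = s := by omega
      rw [rot_rim, tail_true, tail_false_of_not_lt _ (by simp)]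
  · cases j with
    | zero => exact (congrArg tail (rot_hub i)).trans ((point_zero _).trans (point_zero _).symm)
    | succ j => rw [rot_true, tail_true, tail_false_of_lt i (by dsimp only; omega)]

theorem sameCycle_rot (d e : WheelDart n s) (h : tail d = tail e) :
    (rot n s).SameCycle d e := by
  by_cases h0 : tail d = none
  · obtain ⟨i, rfl⟩ := tail_hub h0
    obtain ⟨i', rfl⟩ := tail_hub (h.symm.trans h0)
    have : ∀ m : ℕ, ((rot n s) ^ m) (i, 0, true) = (i + m, 0, true) := by
      intro m
      induction m with
      | zero => simp
      | succ m ih => rw [pow_succ', Perm.mul_apply, ih, rot_hub]; push_cast; rw [add_assoc]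
    refine ⟨((i' - i).val : ℕ), ?_⟩
    rw [zpow_natCast, this]
    simp
  · obtain ⟨i, j, hj0, hj, h1⟩ := exists_point _ h0
    obtain ⟨j, rfl⟩ : ∃ m, j = m + 1 := ⟨j - 1, by omega⟩
    have key : ∀ e, tail e = point s i (j + 1) →
        (rot n s).SameCycle (i, ⟨j + 1, by omega⟩, true) e := by
      intro e he
      rcases tail_point hj he with rfl | rfl | ⟨h2, rfl⟩
      · exact Perm.SameCycle.refl _ _
      · exact ⟨1, by rw [zpow_one, rot_true]⟩
      · exact ⟨2, by rw [zpow_two, Perm.mul_apply, rot_true, rot_end i h2]⟩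
    exact (key d h1).symm.trans (key e (h.symm.trans h1))

/-- Euler's formula holds with `n s + 1` vertices, `n (s + 1)` edges and `n + 1` faces; `n ≥ 3`
keeps the rim free of loops and parallel edges. -/
theorem isSphereMap (hn : 3 ≤ n) :
    IsSphereMap (rot n s) (rev n s) (tail (n := n) (s := s)) where
  invol d := by
    obtain ⟨i, j, b⟩ := d
    simp
  tail_rot := tail_rot
  sameCycle := sameCycle_rot
  surj x := by
    by_cases hx : x = none
    · exact ⟨(0, 0, true), by rw [hx, tail_true]; exact point_zero 0⟩
    · obtain ⟨i, j, h1, h2, rfl⟩ := exists_point x hx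
      exact ⟨(i, ⟨j, by omega⟩, true), rfl⟩
  ne d := by
    have hs := NeZero.pos s
    have key : ∀ (i : ZMod n) (j : Fin (s + 1)), tail (i, j, true) ≠ tail (i, j, false) := by
      intro i j h
      have : Fact (1 < n) := ⟨by omega⟩
      by_cases h1 : j.val < s
      · rw [tail_true, tail_false_of_lt _ h1] at h
        have := (point_eq (by omega) (by omega) h).1
        omega
      · rw [tail_true, tail_false_of_not_lt _ h1] at h
        obtain ⟨h2, h3⟩ := point_eq (by omega) le_rfl h
        have h4 := h3.resolve_left (by omega)
        simp at h4
    obtain ⟨i, j, _ | _⟩ := d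
    · exact (key i j).symm
    · exact key i j
  inj d e h1 h2 := by
    have hs := NeZero.pos s
    by_cases h0 : tail d = none
    · obtain ⟨i, rfl⟩ := tail_hub h0
      obtain ⟨i', rfl⟩ := tail_hub (h1.symm.trans h0)
      rw [rev_apply, rev_apply, Bool.not_true, tail_false_of_lt _ (by simpa using hs),
        tail_false_of_lt _ (by simpa using hs)] at h2
      have := (point_eq (by simp; omega) (by simp; omega) h2).2.resolve_left (by simp)
      rw [this]
    · obtain ⟨i, j, hj0, hj, h3⟩ := exists_point _ h0
      obtain ⟨j, rfl⟩ : ∃ m, j = m + 1 := ⟨j - 1, by omega⟩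
      have h12 : tail (rev n s (i, ⟨j + 1, by omega⟩, true)) ≠
          tail (rev n s (i, ⟨j, by omega⟩, false)) := by
        rw [rev_apply, rev_apply, Bool.not_false, tail_true, Bool.not_true]
        intro h
        by_cases h4 : j + 1 < s
        · rw [tail_false_of_lt i (by exact h4)] at h
          have := (point_eq (by dsimp only; omega) (by dsimp only; omega) h).1
          dsimp only at this
          omega
        · rw [tail_false_of_not_lt i (by exact h4)] at h
          have := (point_eq le_rfl (by dsimp only; omega) h).1
          dsimp only at this
          omega
      have h23 : j + 1 = s → tail (rev n s (i - 1, ⟨s, by omega⟩, false)) ≠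
          tail (rev n s (i, ⟨j, by omega⟩, false)) := by
        intro hjs
        rw [rev_apply, rev_apply, Bool.not_false, tail_true, tail_true]
        intro h
        have := (point_eq le_rfl (by dsimp only; omega) h).1
        dsimp only at this
        omega
      have h13 : j + 1 = s → tail (rev n s (i, ⟨j + 1, by omega⟩, true)) ≠
          tail (rev n s (i - 1, ⟨s, by omega⟩, false)) := by
        intro hjs
        rw [rev_apply, rev_apply, Bool.not_false, tail_true, Bool.not_true,
          tail_false_of_not_lt i (by dsimp only; omega)]
        intro h
        have := (point_eq le_rfl le_rfl h).2.resolve_left (by omega)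
        exact SimpleGraph.IsRing.two_ne_zero hn (by linear_combination this)
      rcases tail_point hj h3 with rfl | rfl | ⟨hjs, rfl⟩ <;>
        rcases tail_point hj (h1.symm.trans h3) with rfl | rfl | ⟨hjs, rfl⟩
      · rfl
      · exact absurd h2 h12
      · exact absurd h2 (h13 hjs)
      · exact absurd h2.symm h12
      · rfl
      · exact absurd h2.symm (h23 hjs)
      · exact absurd h2.symm (h13 hjs)
      · exact absurd h2 (h23 hjs)
      · rfl
  conn d e := by
    set S := Perm.SameCycle.setoid (rot n s) ⊔ Perm.SameCycle.setoid (rev n s) with hS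
    have hrot : ∀ d, S d (rot n s d) := fun d =>
      (le_sup_left : Perm.SameCycle.setoid (rot n s) ≤ S) ⟨1, by simp⟩
    have hrev : ∀ d, S d (rev n s d) := fun d =>
      (le_sup_right : Perm.SameCycle.setoid (rev n s) ≤ S) ⟨1, by simp⟩
    have hsp : ∀ (i : ZMod n) (j : ℕ) (hj : j < s + 1), S (i, ⟨j, hj⟩, true) (i, 0, true) := by
      intro i j
      induction j with
      | zero => intro hj; exact S.refl _
      | succ j ih =>
        intro hj
        have h1 := hrot (i, ⟨j + 1, hj⟩, true)
        rw [rot_true] at h1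
        exact S.trans (S.trans h1 (hrev _)) (ih (by omega))
    have hall : ∀ (d : WheelDart n s), ∃ i, S d (i, 0, true) := by
      rintro ⟨i, ⟨j, hj⟩, _ | _⟩
      · exact ⟨i, S.trans (hrev _) (hsp i j hj)⟩
      · exact ⟨i, hsp i j hj⟩
    obtain ⟨i, hi⟩ := hall d
    obtain ⟨i', hi'⟩ := hall e
    refine S.trans hi (S.trans ?_ (S.symm hi'))
    refine (le_sup_left : Perm.SameCycle.setoid (rot n s) ≤ S) (sameCycle_rot _ _ ?_)
    exact (point_zero _).trans (point_zero _).symm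
  euler := by
    have hs := NeZero.pos s
    classical
    have h1 : Nat.card (ZMod n × Fin (s + 1)) ≤ Perm.cycleCount (rev n s) := by
      refine Perm.card_le_cycleCount _ (fun d => (d.1, d.2.1)) (fun d => rfl) fun x => ?_
      exact ⟨(x.1, x.2, true), rfl⟩
    -- `none` labels the face outside the rim, `some i` a sector bounded by the `i`-th spoke.
    have h2 : Nat.card (Option (ZMod n)) ≤ Perm.cycleCount (rot n s * rev n s) := by
      refine Perm.card_le_cycleCount _ (fun d : WheelDart n s =>
        if d.2.2 = true then (if d.2.1.val < s then some d.1 else none) else some (d.1 + 1)) ?_ ?_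
      · rintro ⟨i, ⟨j, hj⟩, _ | _⟩
        · cases j with
          | zero =>
            rw [Perm.mul_apply, rev_apply, Bool.not_false,
              show rot n s (i, ⟨0, hj⟩, true) = _ from rot_hub i]
            simp [hs]
          | succ j =>
            rw [Perm.mul_apply, rev_apply, Bool.not_false, rot_true]
            simp
        · rw [Perm.mul_apply, rev_apply, Bool.not_true]
          rcases lt_trichotomy (j + 1) s with h | h | h
          · rw [rot_false i h]
            simp [h, (show j < s by omega)]
          · rw [rot_end i h]
            simp [(show j < s by omega)]
          · obtain rfl : j = s := by omega
            rw [rot_rim]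
            simp
      · rintro (_ | i)
        · exact ⟨(0, ⟨s, by omega⟩, true), by simp⟩
        · exact ⟨(i, 0, true), by simp [hs]⟩
    rw [Finite.card_option, Nat.card_zmod] at h2
    rw [Nat.card_prod, Nat.card_zmod, Nat.card_eq_fintype_card (α := Fin (s + 1)),
      Fintype.card_fin] at h1
    have h3 : Nat.card (WheelDart n s) = n * (s + 1) * 2 := by
      rw [Nat.card_prod, Nat.card_prod, Nat.card_zmod, Nat.card_eq_fintype_card (α := Fin (s + 1)),
        Fintype.card_fin, Nat.card_eq_fintype_card (α := Bool), Fintype.card_bool, mul_assoc]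
    have h4 : Nat.card (WheelPoint n s) = n * s + 1 := by
      rw [Finite.card_option, Nat.card_prod, Nat.card_zmod,
        Nat.card_eq_fintype_card (α := Fin s), Fintype.card_fin]
    rw [h3, h4]
    nlinarith

end

end Wheel

namespace Wheel

variable {n s : ℕ} [NeZero n] [NeZero s]

/-- The inner points of a spoke have degree two, so a spoke is used completely or not at all. If one
is used, the hub requires a second one and its outer end a rim edge, `2 s + 1` edges in all; if none
is used, the whole rim is, with `n` edges. -/
theorem hasGirthAtLeast {g : ℕ} (hn : g ≤ n) (hs : g ≤ 2 * s + 1) :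
    HasGirthAtLeast (rev n s) (tail (n := n) (s := s)) g := by
  intro P hne hrev hdeg
  have hs0 := NeZero.pos s
  have hflip : ∀ i j, ((i, j, true) : WheelDart n s) ∈ P ↔ (i, j, false) ∈ P := fun i j =>
    ⟨fun h => hrev _ h, fun h => hrev _ h⟩
  have hspoke : ∀ (i : ZMod n) (j : ℕ) (hj : j + 1 < s),
      ((i, ⟨j, by omega⟩, true) : WheelDart n s) ∈ P ↔
      (i, ⟨j + 1, by omega⟩, true) ∈ P := by
    intro i j hj
    constructor
    · intro h
      rw [hflip] at h
      obtain ⟨e, he, hne, ht⟩ := hdeg _ h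
      rw [tail_false_of_lt i (by dsimp only; omega)] at ht
      rcases tail_point hj.le ht with rfl | rfl | h1
      · exact he
      · exact absurd rfl hne
      · omega
    · intro h
      obtain ⟨e, he, hne, ht⟩ := hdeg _ h
      rcases tail_point hj.le ht with rfl | rfl | h1
      · exact absurd rfl hne
      · exact (hflip _ _).2 he
      · omega
  have hspoke0 : ∀ (i : ZMod n) (j : ℕ) (hj : j < s),
      ((i, ⟨j, by omega⟩, true) : WheelDart n s) ∈ P ↔
      (i, 0, true) ∈ P := by
    intro i j
    induction j with
    | zero => intro _; exact Iff.rfl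
    | succ j ih => intro hj; rw [← hspoke i j hj, ih (by omega)]
  by_cases h : ∃ i : ZMod n, ((i, 0, true) : WheelDart n s) ∈ P
  · obtain ⟨i, hi⟩ := h
    obtain ⟨e, he, hne', ht⟩ := hdeg _ hi
    obtain ⟨i', rfl⟩ := tail_hub (ht.trans (point_zero i))
    have hii : i' ≠ i := fun h => hne' (by rw [h])
    obtain ⟨l, hl⟩ : ∃ l : ZMod n, ((l, Fin.last s, true) : WheelDart n s) ∈ P := by
      have h1 := (hspoke0 i (s - 1) (by omega)).2 hi
      rw [hflip] at h1
      obtain ⟨e, he, hne, ht⟩ := hdeg _ h1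
      rw [tail_false_of_lt i (by dsimp only; omega)] at ht
      rcases tail_point (by dsimp only; omega) ht with rfl | rfl | ⟨-, rfl⟩
      · refine ⟨i, ?_⟩
        convert he using 3
        ext
        simp
        omega
      · exact absurd rfl hne
      · exact ⟨_, (hflip _ _).2 he⟩
    let f : Option (Bool × Fin s) × Bool → P := fun x => match x with
      | (none, true) => ⟨_, hl⟩
      | (none, false) => ⟨_, (hflip _ _).1 hl⟩
      | (some (true, j), true) => ⟨_, (hspoke0 i j j.2).2 hi⟩
      | (some (true, j), false) => ⟨_, (hflip _ _).1 ((hspoke0 i j j.2).2 hi)⟩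
      | (some (false, j), true) => ⟨_, (hspoke0 i' j j.2).2 he⟩
      | (some (false, j), false) => ⟨_, (hflip _ _).1 ((hspoke0 i' j j.2).2 he)⟩
    have hf : Function.Injective f := by
      have hlt : ∀ j : Fin s, j.val ≠ s := fun j => j.2.ne
      rintro ⟨_ | ⟨_ | _, j⟩, _ | _⟩ ⟨_ | ⟨_ | _, j'⟩, _ | _⟩ h <;>
        simp only [f, Subtype.mk.injEq, Prod.mk.injEq, Fin.ext_iff, Fin.val_last, hlt, (hlt _).symm,
          hii, hii.symm,
          and_false, false_and, true_and, and_true, Bool.false_eq_true, Bool.true_eq_false,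
          Option.some.injEq] at h ⊢ <;> exact h
    have := Nat.card_le_card_of_injective f hf
    rw [Nat.card_prod, Finite.card_option, Nat.card_prod, Nat.card_eq_fintype_card (α := Bool),
      Fintype.card_bool, Nat.card_eq_fintype_card (α := Fin s), Fintype.card_fin] at this
    have h2 : Nat.card P = P.ncard := rfl
    omega
  · push Not at h
    have hnot : ∀ (i : ZMod n) (j : ℕ) (hj : j < s),
        ((i, ⟨j, by omega⟩, true) : WheelDart n s) ∉ P := fun i j hj h1 =>
      h i ((hspoke0 i j hj).1 h1)
    have hstep : ∀ l : ZMod n, ((l, Fin.last s, true) : WheelDart n s) ∈ P →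
        ((l + 1, Fin.last s, true) : WheelDart n s) ∈ P := by
      intro l hl
      obtain ⟨e, he, hne, ht⟩ := hdeg _ ((hflip _ _).1 hl)
      rw [tail_false_of_not_lt l (by simp)] at ht
      obtain ⟨s, rfl⟩ : ∃ m, s = m + 1 := ⟨s - 1, by omega⟩
      rcases tail_point le_rfl ht with rfl | rfl | ⟨-, rfl⟩
      · exact he
      · exact absurd ((hflip _ _).2 he) (hnot _ _ (by omega))
      · exact absurd (by rw [add_sub_cancel_right]; rfl) hne
    obtain ⟨l, hl⟩ : ∃ l : ZMod n, ((l, Fin.last s, true) : WheelDart n s) ∈ P := by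
      obtain ⟨⟨i, ⟨j, hj⟩, b⟩, hd⟩ := hne
      have h1 : ((i, ⟨j, hj⟩, true) : WheelDart n s) ∈ P := by
        cases b
        · exact (hflip _ _).2 hd
        · exact hd
      obtain rfl : j = s := by
        by_contra h2
        exact hnot i j (by omega) h1
      exact ⟨i, h1⟩
    have hall : ∀ m : ℕ, ((l + m, Fin.last s, true) : WheelDart n s) ∈ P := by
      intro m
      induction m with
      | zero => simpa using hl
      | succ m ih => push_cast; rw [← add_assoc]; exact hstep _ ih
    have hall' : ∀ i : ZMod n, ((i, Fin.last s, true) : WheelDart n s) ∈ P := by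
      intro i
      have := hall (i - l).val
      simpa using this
    let f : ZMod n × Bool → P := fun x => match x with
      | (i, true) => ⟨_, hall' i⟩
      | (i, false) => ⟨_, (hflip _ _).1 (hall' i)⟩
    have hf : Function.Injective f := by
      rintro ⟨i, _ | _⟩ ⟨i', _ | _⟩ h <;> simp [f] at h ⊢ <;> exact h
    have := Nat.card_le_card_of_injective f hf
    rw [Nat.card_prod, Nat.card_zmod, Nat.card_eq_fintype_card (α := Bool),
      Fintype.card_bool] at this
    have h2 : Nat.card P = P.ncard := rfl
    omega

/-- The lengths of the arcs that replace the edges, from their lengths on one side. -/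
def arcLength (k : ℕ) (x : ZMod n → ℕ → ℕ) : WheelDart n s → ℕ
  | (i, j, true) => x i j
  | (i, j, false) => k - x i j

theorem le_arcLength {k a : ℕ} {x : ZMod n → ℕ → ℕ} (hx : ∀ i j, a ≤ x i j)
    (hx' : ∀ i j, x i j + a ≤ k) : ∀ d : WheelDart n s, a ≤ arcLength k x d
  | (i, j, true) => hx i j
  | (i, j, false) => Nat.le_sub_of_add_le' (hx' i j)

theorem arcLength_add {k : ℕ} {x : ZMod n → ℕ → ℕ} (hx : ∀ i j, x i j ≤ k) :
    ∀ d : WheelDart n s, arcLength k x d + arcLength k x (rev n s d) = k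
  | (i, j, true) => Nat.add_sub_cancel' (hx i j)
  | (i, j, false) => Nat.sub_add_cancel (hx i j)

theorem not_steinbergProperty {k a g m : ℕ} {x : ZMod n → ℕ → ℕ} (hk : 3 ≤ k) (ha : 0 < a)
    (hx : ∀ i j, a ≤ x i j) (hx' : ∀ i j, x i j + a ≤ k) (hn : 3 ≤ n) (hgn : g ≤ n)
    (hgs : g ≤ 2 * s + 1) (hkg : k ≤ a * g) (hm : m < a * g)
    (hcol : (IsSphereMap.thickGraph (rev n s) tail (arcLength (n := n) (s := s) k x) →g
      SimpleGraph.cycleGraph k) → False) : ¬ SteinbergProperty k m :=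
  not_steinbergProperty_of_thick (isSphereMap hn) hk (fun d => ha.trans_le (le_arcLength hx hx' d))
    (arcLength_add fun i j => (Nat.le_add_right _ a).trans (hx' i j)) (le_arcLength hx hx')
    (hasGirthAtLeast hgn hgs) hkg hm hcol

end Wheel

/-! ### Wheels of arcs without colorings. -/

theorem ZMod.sum_sub_shift {n : ℕ} [NeZero n] {R : Type*} [AddCommGroup R] (c : ZMod n → R) :
    ∑ i, (c (i + 1) - c i) = 0 := by
  rw [Finset.sum_sub_distrib, sub_eq_zero]
  exact Equiv.sum_comp (Equiv.addRight (1 : ZMod n)) c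

/-- A cycle of odd length has no proper coloring with two colors. -/
theorem ZMod.even_of_alternating {n : ℕ} [NeZero n] (c : ZMod n → ZMod 2)
    (h : ∀ i, c (i + 1) - c i = 1) : Even n := by
  have := ZMod.sum_sub_shift c
  simp only [h, Finset.sum_const, Finset.card_univ, ZMod.card, nsmul_eq_mul, mul_one] at this
  rwa [← ZMod.natCast_eq_zero_iff_even]

namespace Wheel

variable {n s : ℕ} [NeZero n] [NeZero s]

theorem tail_rim_false (i : ZMod n) : tail (rev n s (i, Fin.last s, true)) = point s (i + 1) s :=
  tail_false_of_not_lt i (by simp)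

end Wheel

-- With arcs of lengths `1` and `k - 1` the rim survives as a cycle of odd length, which has no
-- homomorphism to a bipartite graph. The girth `l + m + 3` of the wheel exceeds both `k` and `m`.
open Wheel in
theorem not_steinbergProperty_of_even {k m : ℕ} (hk : 3 ≤ k) (he : Even k) :
    ¬ SteinbergProperty k m := by
  obtain ⟨l, rfl⟩ : ∃ l, k = l + 2 := ⟨k - 2, by omega⟩
  refine not_steinbergProperty (n := 2 * (l + m + 3) + 1) (s := l + m + 3) (g := l + m + 3) (a := 1)
    (x := fun _ _ => 1) hk one_pos (fun _ _ => le_rfl) (fun _ _ => by omega) (by omega) (by omega)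
    (by omega) (by omega) (by omega) fun φ => ?_
  have hadj : ∀ i : ZMod (2 * (l + m + 3) + 1),
      (SimpleGraph.cycleGraph (l + 2)).Adj (φ (Sum.inl (point (l + m + 3) i (l + m + 3))))
        (φ (Sum.inl (point (l + m + 3) (i + 1) (l + m + 3)))) := by
    intro i
    have := (isSphereMap (n := 2 * (l + m + 3) + 1) (s := l + m + 3) (by omega)).thick_adj_of_one
      (A := arcLength (l + 2) fun _ _ => 1) hk
      (le_arcLength (fun _ _ => le_rfl) fun _ _ => (by omega : 1 + 1 ≤ l + 2))
      (arcLength_add fun _ _ => (by omega : 1 ≤ l + 2)) (d := (i, Fin.last _, true)) rfl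
    rw [tail_rim_false] at this
    exact φ.map_rel this
  -- The parity of a color is well defined because `k` is even.
  let c : Fin (l + 2) → ZMod 2 := fun u => ZMod.castHom he.two_dvd (ZMod 2) (u : ZMod (l + 2))
  have hc : ∀ u v : ZMod (l + 2), v - u = 1 ∨ v - u = -1 → c v - c u = 1 := by
    intro u v huv
    change ZMod.castHom he.two_dvd (ZMod 2) v - ZMod.castHom he.two_dvd (ZMod 2) u = 1
    rw [← map_sub]
    rcases huv with h | h <;> rw [h]
    · exact map_one _
    · rw [map_neg, map_one]
      decide
  have := ZMod.even_of_alternating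
      (fun i => c (φ (Sum.inl (point (l + m + 3) i (l + m + 3))))) fun i =>
    hc _ _ ((SimpleGraph.cycleGraph_adj_zmod _ _).1 (hadj i))
  rw [← Nat.not_odd_iff_even] at this
  exact this ⟨_, rfl⟩

-- Rim arcs have length `b`, except for a single one of length `1`. The total color change around
-- the rim is zero, but modulo `b` it is `1` or `-1`.
open Wheel in
theorem not_steinbergProperty_of_dvd {k b m : ℕ} (hk : 3 ≤ k) (hodd : Odd k) (hb : b ∣ k)
    (hb1 : 1 < b) (hbk : b < k) : ¬ SteinbergProperty k m := by
  obtain ⟨l, rfl⟩ : ∃ l, k = l + 2 := ⟨k - 2, by omega⟩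
  have h3 : 3 ≤ l + m + 3 := by omega
  let x : ZMod (l + m + 3) → ℕ → ℕ := fun i _ => if i = 0 then 1 else b
  have hx : ∀ i j, 1 ≤ x i j ∧ x i j + 1 ≤ l + 2 := by
    intro i j
    simp only [x]
    split_ifs <;> omega
  refine not_steinbergProperty (n := l + m + 3) (s := l + m + 3) (g := l + m + 3) (a := 1)
    (x := x) hk one_pos (fun i j => (hx i j).1) (fun i j => (hx i j).2) h3 le_rfl
    (by omega) (by omega) (by omega) fun φ => ?_
  obtain ⟨f, hf⟩ := (isSphereMap h3).color_sub_color hk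
    (le_arcLength (fun i j => (hx i j).1) fun i j => (hx i j).2)
    (arcLength_add fun i j => (Nat.le_succ _).trans (hx i j).2) hodd φ
  let c : ZMod (l + m + 3) → ZMod b := fun i =>
    ZMod.castHom hb (ZMod b) (f (point (l + m + 3) i (l + m + 3)))
  have hc : ∀ i, c (i + 1) - c i = x i 0 ∨ c (i + 1) - c i = -(x i 0) := by
    intro i
    simp only [c]
    rw [← map_sub, ← tail_rim_false]
    rcases hf (i, Fin.last _, true) with h | h
    · left
      exact (congrArg _ h).trans (map_natCast _ _)
    · right
      exact (congrArg _ h).trans ((map_neg _ _).trans (congrArg _ (map_natCast _ _)))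
  have : Fact (1 < b) := ⟨hb1⟩
  have hsum := ZMod.sum_sub_shift c
  rw [Finset.sum_eq_single 0] at hsum
  · rcases hc 0 with h | h <;> rw [hsum] at h <;> simp [x] at h
  · intro i _ hi
    rcases hc i with h | h <;> rw [h] <;> simp [x, hi]
  · simp

theorem not_steinbergProperty_of_not_odd_prime {k m : ℕ} (hk : 3 ≤ k)
    (h : ¬ (k.Prime ∧ Odd k)) : ¬ SteinbergProperty k m := by
  rcases Nat.even_or_odd k with he | ho
  · exact not_steinbergProperty_of_even hk he
  · obtain ⟨b, hb, h1, h2⟩ := Nat.exists_dvd_of_not_prime2 (by omega) fun hp => h ⟨hp, ho⟩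
    exact not_steinbergProperty_of_dvd hk ho hb h1 h2

/-- The signs of odd integers of absolute value less than `p - 1` change if the integers differ
by `1` modulo `p`. -/
theorem Int.sign_change_of_odd {p : ℕ} (hp : Odd p) {z w : ℤ} (hz : Odd z) (hw : Odd w)
    (hzp : |z| + 2 ≤ p) (hwp : |w| + 2 ≤ p)
    (h : (w : ZMod p) - z = 1 ∨ (w : ZMod p) - z = -1) : (0 < w) ↔ ¬ 0 < z := by
  obtain ⟨ε, hε, h⟩ : ∃ ε : ℤ, (ε = 1 ∨ ε = -1) ∧ (p : ℤ) ∣ w - z - ε := by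
    rcases h with h | h
    · exact ⟨1, Or.inl rfl, (ZMod.intCast_zmod_eq_zero_iff_dvd _ _).1 (by push_cast; rw [h]; simp)⟩
    · exact ⟨-1, Or.inr rfl, (ZMod.intCast_zmod_eq_zero_iff_dvd _ _).1 (by push_cast; rw [h]; simp)⟩
  obtain ⟨y, hy⟩ := h
  rw [← Int.odd_coe_nat] at hp
  -- An odd multiple of `p` of absolute value less than `2 p` is `p` or `-p`, so `z` and `w` are too
  -- far apart to have the same sign.
  have hodd : Odd (w - z - ε) := by
    rcases hε with rfl | rfl
    · exact (hw.sub_odd hz).sub_odd odd_one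
    · exact (hw.sub_odd hz).sub_odd odd_one.neg
  have hy0 : y ≠ 0 := by
    rintro rfl
    rw [hy, mul_zero] at hodd
    exact absurd hodd (by decide)
  obtain ⟨h1, h2⟩ := abs_le.1 (show |z| ≤ p - 2 by omega)
  obtain ⟨h3, h4⟩ := abs_le.1 (show |w| ≤ p - 2 by omega)
  have hp0 : (0 : ℤ) < p := by have := abs_nonneg z; omega
  have hy1 : y < 2 := by
    by_contra! h
    have := mul_le_mul_of_nonneg_left h hp0.le
    omega
  have hy2 : -2 < y := by
    by_contra! h
    have := mul_le_mul_of_nonneg_left h hp0.le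
    omega
  have hy3 : y = 1 ∨ y = -1 := by omega
  have hz0 : z ≠ 0 := by rintro rfl; exact absurd hz (by decide)
  have hw0 : w ≠ 0 := by rintro rfl; exact absurd hw (by decide)
  rcases hy3 with rfl | rfl <;> omega

-- With arcs of lengths `(p - 1) / 2` and `(p + 1) / 2`, doubled colors change by `1` or `-1` along
-- every edge of the wheel. Spokes of odd length `p - 2` make the rim differ from the hub by odd
-- integers below `p - 1` in absolute value, whose signs must alternate along the rim of odd length
-- `2 p - 3`. The girth of the wheel is `2 p - 3` too, which yields the bound.
open Wheel in
theorem not_steinbergProperty_of_odd {p m : ℕ} (hp : Odd p) (hp5 : 5 ≤ p)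
    (hm : m < (p - 1) / 2 * (2 * p - 3)) : ¬ SteinbergProperty p m := by
  obtain ⟨q, rfl⟩ := hp
  rw [show (2 * q + 1 - 1) / 2 = q by omega, show 2 * (2 * q + 1) - 3 = 4 * q - 1 by omega] at hm
  have : NeZero (4 * q - 1) := ⟨by omega⟩
  have : NeZero (2 * q - 1) := ⟨by omega⟩
  have hn : 3 ≤ 4 * q - 1 := by omega
  refine not_steinbergProperty (n := 4 * q - 1) (s := 2 * q - 1) (g := 4 * q - 1) (a := q)
    (x := fun _ _ => q) (by omega) (by omega) (fun _ _ => le_rfl)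
    (fun _ _ => show q + q ≤ 2 * q + 1 by omega) hn le_rfl
    (by omega) (by nlinarith [show 7 ≤ 4 * q - 1 by omega]) hm fun φ => ?_
  obtain ⟨l, hl⟩ : ∃ l, 2 * q + 1 = l + 2 := ⟨2 * q - 1, by omega⟩
  obtain ⟨f, hf⟩ : ∃ f : WheelPoint (4 * q - 1) (2 * q - 1) → ZMod (2 * q + 1), ∀ i j,
      f (tail (i, j, false)) - f (tail (i, j, true)) = 1 ∨
        f (tail (i, j, false)) - f (tail (i, j, true)) = -1 := by
    -- As `2 q = -1`, doubling turns the differences `q` and `-q` into `-1` and `1`.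
    have hp1 : (2 : ZMod (2 * q + 1)) * (q : ℕ) = -1 := by
      have := ZMod.natCast_self (2 * q + 1)
      push_cast at this
      linear_combination this
    have hodd : Odd (2 * q + 1) := ⟨q, rfl⟩
    have hlen : ∀ (i : ZMod (4 * q - 1)) (j : Fin (2 * q - 1 + 1)),
        arcLength (2 * q + 1) (fun _ _ => q) (i, j, true) = q := fun _ _ => rfl
    have hA : ∀ d : WheelDart (4 * q - 1) (2 * q - 1),
        0 < arcLength (2 * q + 1) (fun _ _ => q) d := fun d => (by omega : 0 < q).trans_le
      (le_arcLength (fun _ _ => le_rfl) (fun _ _ => (by omega : q + q ≤ 2 * q + 1)) d)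
    have hAk : ∀ d : WheelDart (4 * q - 1) (2 * q - 1), arcLength (2 * q + 1) (fun _ _ => q) d +
        arcLength (2 * q + 1) (fun _ _ => q) (rev _ _ d) = 2 * q + 1 :=
      arcLength_add fun _ _ => (by omega : q ≤ 2 * q + 1)
    generalize arcLength (2 * q + 1) (fun _ _ => q) = A at *
    generalize 2 * q + 1 = p at *
    subst hl
    obtain ⟨f, hf⟩ := (isSphereMap hn).color_sub_color (by omega) hA hAk hodd φ
    refine ⟨fun x => 2 * f x, fun i j => ?_⟩
    have := hf (i, j, true)
    rw [hlen, rev_apply, Bool.not_true] at this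
    rcases this with h | h
    · exact Or.inr (by linear_combination 2 * h + hp1)
    · exact Or.inl (by linear_combination 2 * h - hp1)
  -- The difference to the hub is lifted to an integer; after `j` steps it has the parity of `j` and
  -- absolute value at most `j`.
  have hspoke : ∀ (i : ZMod (4 * q - 1)) (j : ℕ), j ≤ 2 * q - 1 → ∃ z : ℤ,
      f (point (2 * q - 1) i j) - f none = z ∧ |z| ≤ j ∧ Odd (z + j + 1) := by
    intro i j
    induction j with
    | zero => exact fun _ => ⟨0, by simp [point_zero], by simp, by simp⟩
    | succ j ih =>
      intro hj
      obtain ⟨z, h1, h2, h3⟩ := ih (by omega)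
      have h4 := hf i ⟨j, by omega⟩
      rw [tail_true, tail_false_of_lt i (by dsimp only; omega)] at h4
      dsimp only at h4
      have habs := abs_le.1 h2
      rcases h4 with h4 | h4
      · refine ⟨z + 1, ?_, abs_le.2 ?_, ?_⟩
        · push_cast
          rw [← h1, ← h4]
          ring
        · push_cast
          omega
        · convert h3.add_even even_two using 1
          push_cast
          ring
      · refine ⟨z - 1, ?_, abs_le.2 ?_, ?_⟩
        · push_cast
          rw [← h1]
          linear_combination h4
        · push_cast
          omega
        · convert h3 using 1
          omega
  choose z hz1 hz2 hz3 using fun i => hspoke i (2 * q - 1) le_rfl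
  have hzodd : ∀ i, Odd (z i) := by
    intro i
    obtain ⟨y, hy⟩ := hz3 i
    exact ⟨y - q, by omega⟩
  have hchange : ∀ i, 0 < z (i + 1) ↔ ¬ 0 < z i := by
    intro i
    refine Int.sign_change_of_odd (p := 2 * q + 1) ⟨q, rfl⟩ (hzodd _) (hzodd _) ?_ ?_ ?_
    · have := hz2 i; omega
    · have := hz2 (i + 1); omega
    · have h := hf i (Fin.last _)
      rw [tail_true, tail_false_of_not_lt i (by simp), Fin.val_last] at h
      rw [← hz1, ← hz1, sub_sub_sub_cancel_right]
      exact h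
  -- The signs would color the rim properly with two colors, but its length `4 q - 1` is odd.
  have heven := ZMod.even_of_alternating (fun i => if 0 < z i then (1 : ZMod 2) else 0) fun i => by
    simp only [hchange i]
    by_cases h : 0 < z i
    · simp only [h, not_true_eq_false, if_false, if_true]
      decide
    · simp [h]
  obtain ⟨y, hy⟩ := heven
  omega

/-! ### Assembling the bounds. -/

theorem theorem1p3 :
    (∀ k : ℕ, 3 ≤ k → (steinbergNumber k ≠ ⊤ ↔ k.Prime ∧ Odd k)) ∧
    (∀ p : ℕ, p.Prime → 5 ≤ p →
      ∃ N : ℕ, steinbergNumber p = (N : ℕ∞) ∧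
        (p : ℝ) ^ 2 - (5 * (p : ℝ) - 3) / 2 ≤ (N : ℝ) ∧
        (N : ℝ) ≤ 2 * (p : ℝ) ^ 2 + 2 * (p : ℝ) - 5) ∧
    (∀ p : ℕ, p.Prime → 5 ≤ p →
      ∀ (V : Type) [Finite V] (G : SimpleGraph V), G.IsPlanar → G.egirth = (p : ℕ∞) →
        G.NoCycleLengthIn (p + 1) (2 * (p - 1) * (p + 2) - 1) →
        ∀ (v : V) (c : G.Walk v v), c.IsCycle → c.length = p →
          ∀ ω : G.induce {x | x ∈ c.support} →g SimpleGraph.cycleGraph p,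
            ∃ φ : G →g SimpleGraph.cycleGraph p,
              ∀ x : {x | x ∈ c.support}, φ (x : V) = ω x) := by
  refine ⟨fun k hk => ⟨fun h => ?_, fun h => ?_⟩, fun p hp hp5 => ?_,
    fun p hp hp5 V _ G hG hgirth hno v c hc hlen ω =>
      SimpleGraph.exists_extension hp (by omega) hG hgirth.ge hno hc hlen ω⟩
  · by_contra h1
    exact h (steinbergNumber_eq_top fun m => not_steinbergProperty_of_not_odd_prime hk h1)
  · obtain ⟨N, hN, -, -⟩ := exists_steinbergNumber_eq (steinbergProperty_of_prime h.1 hk)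
    rw [hN]
    exact ENat.natCast_ne_top N
  · obtain ⟨N, hN, hS, hle⟩ := exists_steinbergNumber_eq (steinbergProperty_of_prime hp (by omega))
    have hodd : Odd p := hp.odd_of_ne_two (by omega)
    have hge : (p - 1) / 2 * (2 * p - 3) ≤ N := by
      by_contra! h
      exact not_steinbergProperty_of_odd hodd hp5 h hS
    refine ⟨N, hN, ?_, ?_⟩
    · obtain ⟨q, rfl⟩ := hodd
      rw [show (2 * q + 1 - 1) / 2 = q by omega] at hge
      have h1 : q * (4 * q) ≤ N + q := by
        have : q * (4 * q) = q * (2 * (2 * q + 1) - 3) + q := by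
          rw [show 4 * q = 2 * (2 * q + 1) - 3 + 1 by omega]
          ring
        omega
      have h2 : (q : ℝ) * (4 * q) ≤ N + q := by exact_mod_cast h1
      push_cast
      linarith
    · obtain ⟨q, rfl⟩ : ∃ q, p = q + 1 := ⟨p - 1, by omega⟩
      have h1 : N + 1 ≤ 2 * q * (q + 3) := by
        have : 0 < 2 * q * (q + 3) := Nat.mul_pos (by omega) (by omega)
        have h3 : q + 1 - 1 = q := rfl
        rw [h3] at hle
        change N ≤ 2 * q * (q + 3) - 1 at hle
        omega
      have h2 : (N : ℝ) + 1 ≤ 2 * q * (q + 3) := by exact_mod_cast h1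
      push_cast
      linarith
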